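/- **Setting.** Let $N,\bar n\ge 1$ and $m,l\ge 0$ be integers. Consider $N$ agents, each with state $x_i=(x_{i1},\dots,x_{i\bar n})$ and scalar control $u_i$, in strict-feedback form $$\dot x_{i\ell}=\Gamma_{i\ell}(x^{[1\sim \ell]})+\Theta_{i\ell}(x^{[1\sim \ell]})\,x_{i(\ell+1)}\ (1\le \ell\le\bar n-1),\qquad \dot x_{i\bar n}=\Gamma_{i\bar n}(x)+\Theta_{i\bar n}(x)\,u_i ,$$ where $x^{[\ell]}=(x_{i\ell})_{i=1}^N$ and $x^{[1\sim\ell]}=(x^{[1]},\dots,x^{[\ell]})$. Assume that $\Gamma_{i\ell},\Theta_{i\ell}:\mathbb R^{\ell N}\to\mathbb R$ are of class $C^{\bar n-\ell}$ and that $\Theta_{i\ell}$ vanishes nowhere. Let $f_i:\mathbb R^N\to\mathbb R$ $(1\le i\le N)$, $H:\mathbb R^N\to\mathbb R^m$ and $G:\mathbb R^N\to\mathbb R^l$ be such that $H$ is affine, each $G_j$ is convex, each $f_i$ is convex in its $i$-th variable, all $f_i$ and $G_j$ are of class $C^{\bar n}$, and $\nabla G_j$ and $\nabla F=(\partial f_i/\partial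 y_i)_{i=1}^N$ are locally Lipschitz. Assume Slater's condition ($H(\bar y)=0$ and $G(\bar y)<0$ for some $\bar y$) and that $\nabla F$ is strongly monotone on $\mathbb R^N$ with constant $M>0$. In the associated generalized Nash equilibrium problem (GNEP), agent $i$ minimizes $f_i(y_i,y_{-i})$ over the $y_i\in\mathbb R$ with $H(y)=0$, $G(y)\le 0$. A variational equilibrium (VE) is a Nash equilibrium $\tilde y$ with $H(\tilde y)=0$, $G(\tilde y)\le0$ and $(w-\tilde y)^T\nabla F(\tilde y)\ge 0$ for all $w$ with $H(w)=0$, $G(w)\le 0$. Assume that a VE exists. Put $L_i(y,\lambda,\mu)=f_i(y)+\lambda^TH(y)+\mu^TG(y)$. **Algorithm.** Given gains $k_1$ and $k_{i2},\dots,k_{i\bar n}$, let $T^i_{\alpha,\beta}$ be the sum of all products of order $\alpha$, with repetition, of $k_{i2},\dots,k_{i(\beta+1)}$, and put $\Theta_{i,1\sim q}=\Theta_{i1}\cdots\Theta_{iq}$. For $2\le\ell\le\bar n+1$ let $$B_{i\ell}=\sum_{p=2}^{\ell-1}(-1)^{\ell-p+1}T^i_{\ell-p,\,p-1}z_{ip}+\frac{d^{\ell-2}}{dt^{\ell-2}}\Big(k_1\frac{\partial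 L_i}{\partial x_{i1}}+\Gamma_{i1}\Big)+\sum_{q=2}^{\ell-1}\frac{d^{\ell-1-q}}{dt^{\ell-1-q}}\Big(x_{iq}\frac{d}{dt}\Theta_{i,1\sim(q-1)}+\Theta_{i,1\sim(q-1)}\Gamma_{iq}\Big).$$ The coordinate change is $z_{i1}=x_{i1}$ and $z_{i\ell}=B_{i\ell}+\Theta_{i,1\sim(\ell-1)}x_{i\ell}$ for $2\le\ell\le\bar n$; the control law is $u_i=-B_{i(\bar n+1)}/\Theta_{i,1\sim\bar n}$; the dual update is $\dot\lambda=k_1H(z^{[1]})$, $\dot\mu=\Pi_{\mathbb R^l_+}(\mu,k_1G(z^{[1]}))$ with $\mu\ge 0$, where $\Pi_K(\mu,v)=\lim_{\delta\to0^+}(\mathrm{Proj}_K(\mu+\delta v)-\mu)/\delta$. Differential equations are solved on $[0,\infty)$ by locally absolutely continuous functions, almost everywhere in time. A *trajectory* is a tuple $(x,u,z,\lambda,\mu)$ satisfying the plant equations, the coordinate change, the control law and the dual update on $[0,\infty)$, with $x$, $z$, $\lambda$, $\mu$ locally absolutely continuous, where the time derivatives in the coordinate change and the control law are right derivatives, which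 are required to exist at every $t\ge0$. The *transformed system* is $$\dot z_{i1}=-k_1\frac{\partial L_i}{\partial z_{i1}}(z^{[1]},\lambda,\mu)+z_{i2},\qquad \dot z_{i\ell}=-k_{i\ell}z_{i\ell}+z_{i(\ell+1)}\ (2\le\ell\le\bar n)\qquad (z_{i(\bar n+1)}:=0)$$ together with the dual update. **Theorem.** Suppose $k_1M>1$ and $k_{i\ell}>1$ for all $i$ and all $2\le\ell\le\bar n$. Then the GNEP has exactly one VE, and the plant has exactly one steady state $(\tilde x,\tilde u)$ for which $\tilde x^{[1]}$ is this VE. Moreover: 1. For every trajectory, $(z,\lambda,\mu)$ solves the transformed system, and $(x(t),u(t))\to(\tilde x,\tilde u)$ as $t\to\infty$. 2. If $l=0$ or $\bar n\le 2$, there is a trajectory from every initial state $x(0)\in\mathbb R^{\bar nN}$, $\lambda(0)\in\mathbb R^m$, $\mu(0)\in\mathbb R^l_+$. 3. For all $l$ and $\bar n$, the transformed system has a solution on $[0,\infty)$ from every initial state $z(0)\in\mathbb R^{\bar nN}$, $\lambda(0)\in\mathbb R^m$, $\mu(0)\in\mathbb R^l_+$, and every solution satisfies $z^{[1]}(t)\to\tilde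 x^{[1]}$ and $z^{[\ell]}(t)\to0$ for $2\le\ell\le\bar n$. -/

import Mathlib

open MeasureTheory Filter Topology

noncomputable section

/-! ### Derivatives and projections -/

/-- `i`-th partial derivative of `φ : ℝᴺ → ℝ` at `y`. -/
def partialAt {N : ℕ} (φ : (Fin N → ℝ) → ℝ) (i : Fin N) (y : Fin N → ℝ) : ℝ :=
  fderiv ℝ φ y (Pi.single i 1)

/-- Right time derivative `d⁺g/dt`. -/
def rightDeriv (g : ℝ → ℝ) : ℝ → ℝ := fun t => derivWithin g (Set.Ici t) t

/-- The right derivatives of `g` of orders `1, …, r` exist at every time `t ≥ 0`. -/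
def RightDifferentiable (r : ℕ) (g : ℝ → ℝ) : Prop :=
  ∀ s < r, ∀ t, 0 ≤ t → DifferentiableWithinAt ℝ (rightDeriv^[s] g) (Set.Ici t) t

/-- Local absolute continuity on `[0, ∞)`. -/
def LocallyAC (g : ℝ → ℝ) : Prop :=
  ∀ T, 0 < T → AbsolutelyContinuousOnInterval g 0 T

/-- `p` is the Euclidean point projection of `y` onto `K`. -/
def IsPointProjection {l : ℕ} (K : Set (Fin l → ℝ)) (y p : Fin l → ℝ) : Prop :=
  p ∈ K ∧ ∀ q ∈ K, ∑ j, (p j - y j) ^ 2 ≤ ∑ j, (q j - y j) ^ 2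

/-- `w = lim_{δ → 0⁺} (Proj_K (y + δ v) - y) / δ`. -/
def IsVectorProjection {l : ℕ} (K : Set (Fin l → ℝ)) (y v w : Fin l → ℝ) : Prop :=
  ∃ P : ℝ → Fin l → ℝ, (∀ δ, 0 < δ → IsPointProjection K (y + δ • v) (P δ)) ∧
    Tendsto (fun δ : ℝ => δ⁻¹ • (P δ - y)) (𝓝[>] 0) (𝓝 w)

/-- The nonnegative orthant of `ℝˡ`. -/
def nonnegOrthant (l : ℕ) : Set (Fin l → ℝ) := {μ | ∀ j, 0 ≤ μ j}

/-! ### The game -/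

/-- Data of a generalized Nash equilibrium problem with `N` agents, each with a real decision
variable, `m` shared equality constraints `H = 0` and `l` shared inequality constraints `G ≤ 0`. -/
structure SharedGame (N m l : ℕ) where
  f : Fin N → (Fin N → ℝ) → ℝ
  H : Fin m → (Fin N → ℝ) → ℝ
  G : Fin l → (Fin N → ℝ) → ℝ

namespace SharedGame

variable {N m l : ℕ} (g : SharedGame N m l)

/-- The overall feasible set. -/
def feasible : Set (Fin N → ℝ) := {y | (∀ j, g.H j y = 0) ∧ ∀ j, g.G j y ≤ 0}

/-- The feasible decisions of agent `i`, given the decisions of the other agents in `y`. -/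
def feasibleFor (i : Fin N) (y : Fin N → ℝ) : Set ℝ :=
  {s | (∀ j, g.H j (Function.update y i s) = 0) ∧ ∀ j, g.G j (Function.update y i s) ≤ 0}

/-- The pseudo-gradient `(∂ f_i / ∂ y_i)_i`. -/
def pseudoGrad (y : Fin N → ℝ) : Fin N → ℝ := fun i => partialAt (g.f i) i y

/-- Nash equilibrium. -/
def IsNE (y : Fin N → ℝ) : Prop :=
  ∀ i, y i ∈ g.feasibleFor i y ∧
    ∀ s ∈ g.feasibleFor i y, g.f i y ≤ g.f i (Function.update y i s)

/-- Solution of the variational inequality for the pseudo-gradient on the feasible set. -/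
def SolvesVI (y : Fin N → ℝ) : Prop :=
  y ∈ g.feasible ∧ ∀ w ∈ g.feasible, 0 ≤ ∑ i, (w i - y i) * g.pseudoGrad y i

/-- Variational equilibrium: a Nash equilibrium that solves the variational inequality. -/
def IsVE (y : Fin N → ℝ) : Prop := g.IsNE y ∧ g.SolvesVI y

/-- The Lagrangian `L_i = f_i + λᵀ H + μᵀ G`. -/
def lagrangian (i : Fin N) (lam : Fin m → ℝ) (mu : Fin l → ℝ) (y : Fin N → ℝ) : ℝ :=
  g.f i y + ∑ j, lam j * g.H j y + ∑ j, mu j * g.G j y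

/-- `∂ L_i / ∂ y_i`. -/
def gradL (i : Fin N) (lam : Fin m → ℝ) (mu : Fin l → ℝ) (y : Fin N → ℝ) : ℝ :=
  partialAt (g.lagrangian i lam mu) i y

/-- Convexity and regularity of the game: `H` is affine, `G` is convex, `f_i` is convex in the
decision of agent `i`, `f` and `G` are of class `Cⁿ`, and the gradients of `G` and the
pseudo-gradient are locally Lipschitz. -/
structure Regular (n : ℕ) : Prop where
  affine_H : ∀ j, ∃ a : (Fin N → ℝ) →ᵃ[ℝ] ℝ, ∀ y, g.H j y = a y
  convex_G : ∀ j, ConvexOn ℝ Set.univ (g.G j)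
  convex_f : ∀ i y, ConvexOn ℝ Set.univ (fun s => g.f i (Function.update y i s))
  smooth_G : ∀ j, ContDiff ℝ n (g.G j)
  smooth_f : ∀ i, ContDiff ℝ n (g.f i)
  lipschitz_G : ∀ j, LocallyLipschitz (fun y => fun i => partialAt (g.G j) i y)
  lipschitz_f : LocallyLipschitz g.pseudoGrad

/-- Slater's condition. -/
def Slater : Prop := ∃ y, (∀ j, g.H j y = 0) ∧ ∀ j, g.G j y < 0

/-- The pseudo-gradient is strongly monotone on `ℝᴺ` with constant `M`. -/
def StronglyMonotone (M : ℝ) : Prop :=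
  ∀ w w' : Fin N → ℝ,
    M * ∑ i, (w i - w' i) ^ 2 ≤ ∑ i, (w i - w' i) * (g.pseudoGrad w i - g.pseudoGrad w' i)

end SharedGame

/-! ### The plant -/

/-- The blocks `0, …, ℓ` of the state `x`. -/
def firstBlocks {N n : ℕ} (x : Fin n → Fin N → ℝ) (ℓ : Fin n) : Fin (ℓ.val + 1) → Fin N → ℝ :=
  fun p => x ⟨p.val, by omega⟩

/-- A network of `N` agents in strict-feedback form, each with `n` states (counted from `0`) and a
scalar control; `Γ ℓ i` and `Θ ℓ i` depend on the blocks `0, …, ℓ` of the states of all agents. -/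
structure StrictFeedback (N n : ℕ) where
  Γ : (ℓ : Fin n) → Fin N → (Fin (ℓ.val + 1) → Fin N → ℝ) → ℝ
  Θ : (ℓ : Fin n) → Fin N → (Fin (ℓ.val + 1) → Fin N → ℝ) → ℝ

namespace StrictFeedback

variable {N n : ℕ} (S : StrictFeedback N n)

/-- Right-hand side of the plant: `Γ_{iℓ} + Θ_{iℓ} x_{i(ℓ+1)}`, with `u_i` in place of
`x_{i(ℓ+1)}` for the last state. -/
def rhs (x : Fin n → Fin N → ℝ) (u : Fin N → ℝ) (ℓ : Fin n) (i : Fin N) : ℝ :=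
  S.Γ ℓ i (firstBlocks x ℓ) + S.Θ ℓ i (firstBlocks x ℓ) *
    (if h : ℓ.val + 1 < n then x ⟨ℓ.val + 1, h⟩ i else u i)

/-- Steady states of the plant. -/
def IsSteadyState (x : Fin n → Fin N → ℝ) (u : Fin N → ℝ) : Prop :=
  ∀ ℓ i, S.rhs x u ℓ i = 0

/-- `Θ_{iℓ}` does not vanish, and `Γ_{iℓ}`, `Θ_{iℓ}` are `n - 1 - ℓ` times continuously
differentiable (`ℓ = 0, …, n - 1`): the orders of differentiation that the control law uses. -/
structure Regular : Prop where
  smooth_Γ : ∀ ℓ i, ContDiff ℝ (n - 1 - ℓ.val : ℕ) (S.Γ ℓ i)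
  smooth_Θ : ∀ ℓ i, ContDiff ℝ (n - 1 - ℓ.val : ℕ) (S.Θ ℓ i)
  ne_zero : ∀ ℓ i y, S.Θ ℓ i y ≠ 0

/-- The product `Θ_{i0} ⋯ Θ_{i(q-1)}` of the first `q` input gains. -/
def gainProd (x : Fin n → Fin N → ℝ) (q : ℕ) (i : Fin N) : ℝ :=
  ∏ r : Fin n with r.val < q, S.Θ r i (firstBlocks x r)

end StrictFeedback

/-- Sum of all products of order `α`, with repetition, of `κ 1, …, κ β`. -/
def symProd {n : ℕ} (κ : Fin n → ℝ) (α β : ℕ) : ℝ :=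
  ∑ s ∈ (Finset.univ.filter (fun p : Fin n => 1 ≤ p.val ∧ p.val ≤ β)).sym α,
    ((s : Multiset (Fin n)).map κ).prod

/-! ### The algorithm -/

section Algorithm

variable {N m l n : ℕ} [NeZero n] (S : StrictFeedback N n) (g : SharedGame N m l)
  (k₁ : ℝ) (k : Fin N → Fin n → ℝ)

/-- `k₁ ∂L_i/∂x_{i0} + Γ_{i0}` along a curve. -/
def leadTerm (x : ℝ → Fin n → Fin N → ℝ) (lam : ℝ → Fin m → ℝ) (mu : ℝ → Fin l → ℝ)
    (i : Fin N) : ℝ → ℝ :=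
  fun t => k₁ * g.gradL i (lam t) (mu t) (x t 0) + S.Γ 0 i (firstBlocks (x t) 0)

/-- `x_{iq} d/dt(Θ_{i0} ⋯ Θ_{i(q-1)}) + Θ_{i0} ⋯ Θ_{i(q-1)} Γ_{iq}` along a curve. -/
def innerTerm (x : ℝ → Fin n → Fin N → ℝ) (q : Fin n) (i : Fin N) : ℝ → ℝ :=
  fun t => x t q i * rightDeriv (fun s => S.gainProd (x s) q.val i) t +
    S.gainProd (x t) q.val i * S.Γ q i (firstBlocks (x t) q)

/-- The part that does not contain `x_{iℓ}` of the coordinate change defining `z_{iℓ}`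
(`1 ≤ ℓ < n`); for `ℓ = n` it is the bracket in the control law. -/
def bracket (x z : ℝ → Fin n → Fin N → ℝ) (lam : ℝ → Fin m → ℝ) (mu : ℝ → Fin l → ℝ)
    (ℓ : ℕ) (i : Fin N) (t : ℝ) : ℝ :=
  (∑ p : Fin n with 1 ≤ p.val ∧ p.val < ℓ,
      (-1) ^ (ℓ - p.val + 1) * symProd (k i) (ℓ - p.val) p.val * z t p i) +
    rightDeriv^[ℓ - 1] (leadTerm S g k₁ x lam mu i) t +
    ∑ q : Fin n with 1 ≤ q.val ∧ q.val < ℓ, rightDeriv^[ℓ - 1 - q.val] (innerTerm S x q i) t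

/-- The dual update `λ' = k₁ H(z_0)`, `μ' = Π(μ, k₁ G(z_0))`, with the vector projection `Π` for the
nonnegative orthant: locally absolutely continuous curves that satisfy it almost everywhere. -/
structure IsDualSolution (z : ℝ → Fin n → Fin N → ℝ) (lam : ℝ → Fin m → ℝ)
    (mu : ℝ → Fin l → ℝ) : Prop where
  lam_ac : ∀ j, LocallyAC (fun t => lam t j)
  mu_ac : ∀ j, LocallyAC (fun t => mu t j)
  mu_mem : ∀ t, 0 ≤ t → mu t ∈ nonnegOrthant l
  lam_ode : ∀ᵐ t ∂(volume.restrict (Set.Ioi (0 : ℝ))),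
    ∀ j, HasDerivAt (fun s => lam s j) (k₁ * g.H j (z t 0)) t
  mu_ode : ∀ᵐ t ∂(volume.restrict (Set.Ioi (0 : ℝ))),
    ∃ w, IsVectorProjection (nonnegOrthant l) (mu t) (fun j => k₁ * g.G j (z t 0)) w ∧
      HasDerivAt mu w t

/-- Right-hand side of the transformed system: `-k₁ ∂L_i/∂z_{i0} + z_{i1}` for `ℓ = 0` and
`-k_{iℓ} z_{iℓ} + z_{i(ℓ+1)}` for `ℓ ≥ 1`, without the term `z_{i(ℓ+1)}` when `ℓ = n - 1`. -/
def transformedRhs (z : Fin n → Fin N → ℝ) (lam : Fin m → ℝ) (mu : Fin l → ℝ)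
    (ℓ : Fin n) (i : Fin N) : ℝ :=
  (if ℓ = 0 then -k₁ * g.gradL i lam mu (z 0) else -k i ℓ * z ℓ i) +
    (if h : ℓ.val + 1 < n then z ⟨ℓ.val + 1, h⟩ i else 0)

/-- Solutions of the transformed system together with the dual update. -/
structure IsTransformedSolution (z : ℝ → Fin n → Fin N → ℝ) (lam : ℝ → Fin m → ℝ)
    (mu : ℝ → Fin l → ℝ) : Prop where
  z_ac : ∀ ℓ i, LocallyAC (fun t => z t ℓ i)
  z_ode : ∀ᵐ t ∂(volume.restrict (Set.Ioi (0 : ℝ))),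
    ∀ ℓ i, HasDerivAt (fun s => z s ℓ i) (transformedRhs g k₁ k (z t) (lam t) (mu t) ℓ i) t
  dual : IsDualSolution g k₁ z lam mu

/-- Trajectories of the plant under the algorithm: `x` solves the plant with the control `u` given
by the control law, `z` is given by the coordinate change, and `(λ, μ)` follows the dual update.
Time derivatives in the coordinate change and in the control law are right derivatives; they
exist, and `x` and `z` are locally absolutely continuous. -/
structure IsTrajectory (x : ℝ → Fin n → Fin N → ℝ) (u : ℝ → Fin N → ℝ)
    (z : ℝ → Fin n → Fin N → ℝ) (lam : ℝ → Fin m → ℝ) (mu : ℝ → Fin l → ℝ) : Prop where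
  x_ac : ∀ ℓ i, LocallyAC (fun t => x t ℓ i)
  z_ac : ∀ ℓ i, LocallyAC (fun t => z t ℓ i)
  plant : ∀ᵐ t ∂(volume.restrict (Set.Ioi (0 : ℝ))),
    ∀ ℓ i, HasDerivAt (fun s => x s ℓ i) (S.rhs (x t) (u t) ℓ i) t
  diff_lead : ∀ i, RightDifferentiable (n - 1) (leadTerm S g k₁ x lam mu i)
  diff_gain : ∀ (q : Fin n) i, RightDifferentiable 1 (fun t => S.gainProd (x t) q.val i)
  diff_inner : ∀ (q : Fin n) i, 1 ≤ q.val →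
    RightDifferentiable (n - 1 - q.val) (innerTerm S x q i)
  coord_zero : ∀ t, 0 ≤ t → z t 0 = x t 0
  coord : ∀ t, 0 ≤ t → ∀ (ℓ : Fin n) i, 1 ≤ ℓ.val →
    z t ℓ i = bracket S g k₁ k x z lam mu ℓ.val i t + S.gainProd (x t) ℓ.val i * x t ℓ i
  control : ∀ t, 0 ≤ t → ∀ i,
    u t i = -(1 / S.gainProd (x t) n i) * bracket S g k₁ k x z lam mu n i t
  dual : IsDualSolution g k₁ z lam mu

end Algorithm

end

/-! ### Absolutely continuous functions -/

namespace LocallyAC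

variable {h h₁ h₂ : ℝ → ℝ}

lemma mono_interval (hh : LocallyAC h) {a b : ℝ} (ha : 0 ≤ a) (hab : a ≤ b) :
    AbsolutelyContinuousOnInterval h a b := by
  refine (hh (b + 1) (by linarith)).mono ?_
  rw [Set.uIcc_of_le hab, Set.uIcc_of_le (by linarith)]
  exact Set.Icc_subset_Icc ha (by linarith)

lemma continuousOn (hh : LocallyAC h) : ContinuousOn h (Set.Ici 0) := by
  intro t ht
  have h1 := (hh.mono_interval le_rfl (show (0 : ℝ) ≤ t + 1 by
    linarith [Set.mem_Ici.1 ht])).continuousOn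
  rw [Set.uIcc_of_le (by linarith [Set.mem_Ici.1 ht])] at h1
  refine (h1 t ⟨ht, by linarith⟩).mono_of_mem_nhdsWithin ?_
  exact mem_nhdsWithin.2 ⟨Set.Iio (t + 1), isOpen_Iio, by simp, fun s hs => ⟨hs.2, hs.1.le⟩⟩

lemma congr (hh : LocallyAC h₁) (he : Set.EqOn h₁ h₂ (Set.Ici 0)) : LocallyAC h₂ := by
  intro T hT
  have h1 := hh T hT
  rw [absolutelyContinuousOnInterval_iff] at h1 ⊢
  intro ε hε
  obtain ⟨δ, hδ, H⟩ := h1 ε hε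
  refine ⟨δ, hδ, fun E hE hs => ?_⟩
  convert H E hE hs using 2 with i hi
  have := hE.1 i hi
  rw [Set.uIcc_of_le hT.le] at this
  rw [he this.1.1, he this.2.1]

lemma of_lipschitz {K : NNReal} (hh : LipschitzOnWith K h (Set.Ici 0)) : LocallyAC h := by
  intro T hT
  apply LipschitzOnWith.absolutelyContinuousOnInterval (K := K)
  rw [Set.uIcc_of_le hT.le]
  exact hh.mono fun s hs => hs.1

lemma const (c : ℝ) : LocallyAC (fun _ => c) :=
  of_lipschitz (K := 0) (LipschitzWith.const c).lipschitzOnWith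

lemma add (h1 : LocallyAC h₁) (h2 : LocallyAC h₂) : LocallyAC (fun t => h₁ t + h₂ t) :=
  fun T hT => (h1 T hT).add (h2 T hT)

lemma mul (h1 : LocallyAC h₁) (h2 : LocallyAC h₂) : LocallyAC (fun t => h₁ t * h₂ t) :=
  fun T hT => (h1 T hT).mul (h2 T hT)

lemma sum {ι : Type*} (s : Finset ι) {c : ι → ℝ → ℝ} (hc : ∀ i ∈ s, LocallyAC (c i)) :
    LocallyAC (fun t => ∑ i ∈ s, c i t) := by
  classical
  induction s using Finset.induction_on with
  | empty => simpa using const 0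
  | insert i s hi ih =>
    simp only [Finset.sum_insert hi]
    exact (hc i (by simp)).add (ih fun j hj => hc j (by simp [hj]))

lemma ae_differentiableAt (hh : LocallyAC h) :
    ∀ᵐ t ∂(volume.restrict (Set.Ioi (0 : ℝ))), DifferentiableAt ℝ h t := by
  rw [ae_restrict_iff' measurableSet_Ioi]
  have h1 : ∀ᵐ t : ℝ, ∀ m : ℕ, t ∈ Set.uIcc (0 : ℝ) (m + 1) → DifferentiableAt ℝ h t :=
    ae_all_iff.2 fun m => (hh _ (by positivity)).ae_differentiableAt
  filter_upwards [h1] with t ht h0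
  obtain ⟨m, hm⟩ := exists_nat_ge t
  refine ht m ?_
  rw [Set.uIcc_of_le (by positivity)]
  exact ⟨(Set.mem_Ioi.1 h0).le, by linarith⟩

/-- The increment of an absolutely continuous function is bounded by an almost everywhere bound of
its derivative. -/
lemma sub_le_of_ae_deriv_le (hh : LocallyAC h) {a b C : ℝ} (ha : 0 ≤ a) (hab : a ≤ b)
    (hC : ∀ᵐ t ∂(volume.restrict (Set.Ioi (0 : ℝ))), t ∈ Set.Ioo a b → deriv h t ≤ C) :
    h b - h a ≤ C * (b - a) := by
  have hac := hh.mono_interval ha hab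
  rw [← hac.integral_deriv_eq_sub]
  have h2 : ∫ _ in a..b, C = C * (b - a) := by simp [mul_comm]
  rw [← h2]
  refine intervalIntegral.integral_mono_ae_restrict hab hac.intervalIntegrable_deriv
    (by simp) ?_
  rw [ae_restrict_iff' measurableSet_Ioi] at hC
  have hne : ∀ c : ℝ, ∀ᵐ t : ℝ, t ≠ c := fun c => by
    have h0 : volume ({c} : Set ℝ) = 0 := measure_singleton c
    exact compl_mem_ae_iff.2 h0
  rw [EventuallyLE, ae_restrict_iff' measurableSet_Icc]
  filter_upwards [hC, hne a, hne b] with t ht h1 h2 h3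
  have h4 : a < t := lt_of_le_of_ne h3.1 (Ne.symm h1)
  exact ht (lt_of_le_of_lt ha h4) ⟨h4, lt_of_le_of_ne h3.2 h2⟩

lemma abs_sub_le_of_ae (hh : LocallyAC h) {a b C : ℝ} (ha : 0 ≤ a) (hab : a ≤ b)
    (hC : ∀ᵐ t ∂(volume.restrict (Set.Ioi (0 : ℝ))), t ∈ Set.Ioo a b → |deriv h t| ≤ C) :
    |h b - h a| ≤ C * (b - a) := by
  rw [abs_le]
  constructor
  · have h1 : LocallyAC (fun t => (-1) * h t) := (const (-1)).mul hh
    have := h1.sub_le_of_ae_deriv_le ha hab (C := C) (by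
      filter_upwards [hC] with t ht h2
      rw [deriv_const_mul_field]
      have := (abs_le.1 (ht h2)).1
      linarith)
    linarith
  · refine hh.sub_le_of_ae_deriv_le ha hab ?_
    filter_upwards [hC] with t ht h2
    exact (abs_le.1 (ht h2)).2

lemma lipschitz_of_ae (hh : LocallyAC h) {C : ℝ} (hC0 : 0 ≤ C)
    (hC : ∀ᵐ t ∂(volume.restrict (Set.Ioi (0 : ℝ))), |deriv h t| ≤ C) :
    LipschitzOnWith C.toNNReal h (Set.Ici 0) := by
  refine LipschitzOnWith.of_dist_le_mul fun s hs t ht => ?_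
  rw [Real.coe_toNNReal _ hC0]
  have hC' : ∀ a b : ℝ, ∀ᵐ t ∂(volume.restrict (Set.Ioi (0 : ℝ))),
      t ∈ Set.Ioo a b → |deriv h t| ≤ C := fun a b => by
    filter_upwards [hC] with t ht _ using ht
  rcases le_total s t with h1 | h1
  · rw [dist_comm, dist_comm s t, Real.dist_eq, Real.dist_eq, abs_of_nonneg (sub_nonneg.2 h1)]
    exact hh.abs_sub_le_of_ae hs h1 (hC' _ _)
  · rw [Real.dist_eq, Real.dist_eq, abs_of_nonneg (sub_nonneg.2 h1)]
    exact hh.abs_sub_le_of_ae ht h1 (hC' _ _)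

/-- An absolutely continuous function whose derivative has a right limit is right
differentiable. -/
lemma hasDerivWithinAt_of_tendsto (hh : LocallyAC h) {r : ℝ → ℝ} {t c : ℝ} (ht : 0 ≤ t)
    (hr : ∀ᵐ s ∂(volume.restrict (Set.Ioi (0 : ℝ))), HasDerivAt h (r s) s)
    (hc : Tendsto r (𝓝[>] t) (𝓝 c)) : HasDerivWithinAt h c (Set.Ici t) t := by
  rw [hasDerivWithinAt_iff_isLittleO, Asymptotics.isLittleO_iff]
  intro ε hε
  have h1 := Metric.tendsto_nhds.1 hc ε hε
  obtain ⟨b, hb, H⟩ := mem_nhdsGT_iff_exists_Ioo_subset.1 h1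
  have hmem : Set.Ico t b ∈ 𝓝[≥] t := Ico_mem_nhdsGE hb
  filter_upwards [hmem] with s hs
  have hac : LocallyAC (fun u => h u + (-c) * u) :=
    hh.add ((const (-c)).mul (of_lipschitz (K := 1) LipschitzWith.id.lipschitzOnWith))
  have h3 := hac.abs_sub_le_of_ae (C := ε) ht hs.1 (by
    filter_upwards [hr] with u hu hu2
    have h4 : HasDerivAt (fun u => h u + (-c) * u) (r u + (-c) * 1) u :=
      hu.add ((hasDerivAt_id u).const_mul (-c))
    rw [h4.deriv]
    have h5 := H ⟨hu2.1, hu2.2.trans hs.2⟩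
    rw [Set.mem_ofPred_eq, Real.dist_eq] at h5
    have : r u + -c * 1 = r u - c := by ring
    rw [this]
    exact h5.le)
  rw [Real.norm_eq_abs, Real.norm_eq_abs, abs_of_nonneg (sub_nonneg.2 hs.1), smul_eq_mul]
  convert h3 using 2
  ring

/-- Composition with a locally Lipschitz function preserves absolute continuity. -/
lemma comp_locallyLipschitz {ι : Type*} [Fintype ι] {φ : (ι → ℝ) → ℝ}
    (hφ : LocallyLipschitz φ) {c : ι → ℝ → ℝ} (hc : ∀ i, LocallyAC (c i)) :
    LocallyAC (fun t => φ (fun i => c i t)) := by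
  intro T hT
  have hcont : ContinuousOn (fun t i => c i t) (Set.Icc 0 T) :=
    continuousOn_pi.2 fun i => (hc i).continuousOn.mono fun s hs => hs.1
  obtain ⟨K, hK⟩ := (hφ.locallyLipschitzOn).exists_lipschitzOnWith_of_compact
    (isCompact_Icc.image_of_continuousOn hcont)
  rw [absolutelyContinuousOnInterval_iff]
  intro ε hε
  have hpos : 0 < ε / ((K : ℝ) * (Fintype.card ι) + 1) := by positivity
  choose δ hδ H using fun i => (absolutelyContinuousOnInterval_iff _ _ _).1 (hc i T hT) _ hpos
  obtain ⟨δ₀, hδ₀, hle⟩ : ∃ δ₀ > 0, ∀ i, δ₀ ≤ δ i := by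
    rcases isEmpty_or_nonempty ι with h | h
    · exact ⟨1, one_pos, fun i => h.elim i⟩
    · obtain ⟨i, hi⟩ := Finite.exists_min δ
      exact ⟨δ i, hδ i, hi⟩
  refine ⟨δ₀, hδ₀, fun I hI hs => ?_⟩
  have hterm : ∀ q ∈ Finset.range I.1,
      dist (φ (fun i => c i (I.2 q).1)) (φ (fun i => c i (I.2 q).2)) ≤
        (K : ℝ) * ∑ i, dist (c i (I.2 q).1) (c i (I.2 q).2) := by
    intro q hq
    have hm := hI.1 q hq
    rw [Set.uIcc_of_le hT.le] at hm
    refine (hK.dist_le_mul _ ⟨_, hm.1, rfl⟩ _ ⟨_, hm.2, rfl⟩).trans ?_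
    refine mul_le_mul_of_nonneg_left ?_ K.2
    refine (dist_pi_le_iff (Finset.sum_nonneg fun i _ => dist_nonneg)).2 fun i => ?_
    exact Finset.single_le_sum (f := fun i => dist (c i (I.2 q).1) (c i (I.2 q).2))
      (fun i _ => dist_nonneg) (Finset.mem_univ i)
  calc _ ≤ ∑ q ∈ Finset.range I.1, (K : ℝ) * ∑ i, dist (c i (I.2 q).1) (c i (I.2 q).2) :=
        Finset.sum_le_sum hterm
    _ = (K : ℝ) * ∑ i, ∑ q ∈ Finset.range I.1, dist (c i (I.2 q).1) (c i (I.2 q).2) := by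
        rw [Finset.sum_comm, ← Finset.mul_sum]
    _ ≤ (K : ℝ) * ∑ _i : ι, ε / ((K : ℝ) * (Fintype.card ι) + 1) := by
        refine mul_le_mul_of_nonneg_left (Finset.sum_le_sum fun i _ => ?_) K.2
        exact (H i I hI (hs.trans_le (hle i))).le
    _ = (K * Fintype.card ι) * (ε / ((K : ℝ) * (Fintype.card ι) + 1)) := by
        rw [Finset.sum_const, Finset.card_univ, nsmul_eq_mul]; ring
    _ < ε := by
        rw [mul_div_assoc', div_lt_iff₀ (by positivity)]
        nlinarith

end LocallyAC

/-! ### Right derivatives -/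

lemma HasDerivWithinAt.rightDeriv_eq {h : ℝ → ℝ} {c t : ℝ}
    (hh : HasDerivWithinAt h c (Set.Ici t) t) : rightDeriv h t = c :=
  hh.derivWithin (uniqueDiffWithinAt_Ici t)

/-- Right differentiability at all nonnegative times. -/
def RDiff (h : ℝ → ℝ) : Prop := ∀ t, 0 ≤ t → DifferentiableWithinAt ℝ h (Set.Ici t) t

lemma RDiff.hasDeriv {h : ℝ → ℝ} (hh : RDiff h) {t : ℝ} (ht : 0 ≤ t) :
    HasDerivWithinAt h (rightDeriv h t) (Set.Ici t) t :=
  (hh t ht).hasDerivWithinAt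

lemma rightDeriv_congr_Ico {h₁ h₂ : ℝ → ℝ} {a b : ℝ} (he : Set.EqOn h₁ h₂ (Set.Ico a b)) :
    Set.EqOn (rightDeriv h₁) (rightDeriv h₂) (Set.Ico a b) := by
  intro t ht
  have h1 : h₁ =ᶠ[𝓝[≥] t] h₂ := by
    filter_upwards [Ico_mem_nhdsGE ht.2] with s hs
    exact he ⟨ht.1.trans hs.1, hs.2⟩
  exact h1.derivWithin_eq (he ht)

lemma iterate_rightDeriv_congr_Ico {h₁ h₂ : ℝ → ℝ} {a b : ℝ}
    (he : Set.EqOn h₁ h₂ (Set.Ico a b)) (r : ℕ) :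
    Set.EqOn (rightDeriv^[r] h₁) (rightDeriv^[r] h₂) (Set.Ico a b) := by
  induction r generalizing h₁ h₂ with
  | zero => exact he
  | succ r ih => exact ih (rightDeriv_congr_Ico he)

lemma rightDeriv_congr {h₁ h₂ : ℝ → ℝ} {a : ℝ} (he : Set.EqOn h₁ h₂ (Set.Ici a)) :
    Set.EqOn (rightDeriv h₁) (rightDeriv h₂) (Set.Ici a) := fun t ht =>
  rightDeriv_congr_Ico (a := a) (b := t + 1) (fun s hs => he hs.1) ⟨ht, by linarith⟩

lemma RDiff.congr {h₁ h₂ : ℝ → ℝ} (hh : RDiff h₁) (he : Set.EqOn h₁ h₂ (Set.Ici 0)) :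
    RDiff h₂ := fun t ht =>
  (hh t ht).congr (fun _ hs => (he (le_trans ht hs)).symm) (he ht).symm

/-- A solution of a differential equation with continuous right-hand side has right derivatives. -/
lemma LocallyAC.hasDerivWithinAt_of_continuousOn {h r : ℝ → ℝ} (hh : LocallyAC h)
    (hr : ∀ᵐ s ∂(volume.restrict (Set.Ioi (0 : ℝ))), HasDerivAt h (r s) s)
    (hc : ContinuousOn r (Set.Ici 0)) {t : ℝ} (ht : 0 ≤ t) :
    HasDerivWithinAt h (r t) (Set.Ici t) t :=
  hh.hasDerivWithinAt_of_tendsto ht hr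
    ((hc t ht).mono fun _ (hs : t < _) => le_trans ht hs.le)

/-! ### Towers of right derivatives -/

/-- A notion of regularity for families of real functions of time. The predicate `P` is for
functions that are not differentiated any further, `Q` for those that are. -/
structure RegClass (Ω : Type) where
  P : (Ω → ℝ → ℝ) → Prop
  Q : (Ω → ℝ → ℝ) → Prop
  P_of_Q : ∀ {h}, Q h → P h
  rdiff : ∀ {h}, Q h → ∀ ω, RDiff (h ω)
  P_congr : ∀ {h₁ h₂ : Ω → ℝ → ℝ}, P h₁ → (∀ ω, Set.EqOn (h₁ ω) (h₂ ω) (Set.Ici 0)) → P h₂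
  Q_congr : ∀ {h₁ h₂ : Ω → ℝ → ℝ}, Q h₁ → (∀ ω, Set.EqOn (h₁ ω) (h₂ ω) (Set.Ici 0)) → Q h₂
  P_comp : ∀ {ι : Type} [Fintype ι] {φ : (ι → ℝ) → ℝ} {c : ι → Ω → ℝ → ℝ}, Continuous φ →
    (∀ i, P (c i)) → P (fun ω t => φ (fun i => c i ω t))
  Q_comp : ∀ {ι : Type} [Fintype ι] {φ : (ι → ℝ) → ℝ} {c : ι → Ω → ℝ → ℝ}, ContDiff ℝ 1 φ →
    (∀ i, Q (c i)) → Q (fun ω t => φ (fun i => c i ω t))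

lemma clm_apply_eq_sum {ι : Type*} [Fintype ι] [DecidableEq ι] (L : (ι → ℝ) →L[ℝ] ℝ)
    (v : ι → ℝ) : L v = ∑ i, L (Pi.single i 1) * v i := by
  have hv : v = ∑ i, v i • (Pi.single i 1 : ι → ℝ) := by
    ext j
    simp [Finset.sum_apply, Pi.single_apply]
  conv_lhs => rw [hv]
  simp [map_sum, mul_comm]

lemma hasDerivWithinAt_comp_pi {ι : Type} [Fintype ι] [DecidableEq ι] {φ : (ι → ℝ) → ℝ}
    {c : ι → ℝ → ℝ} (hφ : ContDiff ℝ 1 φ) (hc : ∀ i, RDiff (c i)) {t : ℝ} (ht : 0 ≤ t) :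
    HasDerivWithinAt (fun s => φ (fun i => c i s))
      (∑ i, fderiv ℝ φ (fun i => c i t) (Pi.single i 1) * rightDeriv (c i) t) (Set.Ici t) t := by
  have h1 : HasDerivWithinAt (fun s i => c i s) (fun i => rightDeriv (c i) t) (Set.Ici t) t :=
    hasDerivWithinAt_pi.2 fun i => (hc i).hasDeriv ht
  have h2 : HasFDerivAt φ (fderiv ℝ φ (fun i => c i t)) (fun i => c i t) :=
    ((hφ.differentiable one_ne_zero) _).hasFDerivAt
  have h3 := h2.comp_hasDerivWithinAt t h1
  rw [clm_apply_eq_sum] at h3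
  exact h3

lemma RDiff.comp_pi {ι : Type} [Fintype ι] {φ : (ι → ℝ) → ℝ}
    {c : ι → ℝ → ℝ} (hφ : ContDiff ℝ 1 φ) (hc : ∀ i, RDiff (c i)) :
    RDiff (fun s => φ (fun i => c i s)) := by
  classical
  exact fun t ht => (hasDerivWithinAt_comp_pi hφ hc ht).differentiableWithinAt

namespace RegClass

variable {Ω : Type} (R : RegClass Ω)

/-- Right derivatives up to order `a` exist, those of order less than `a` satisfy `Q`, and that of
order `a` satisfies `P`. -/
def Tower : ℕ → (Ω → ℝ → ℝ) → Prop
  | 0, h => R.P h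
  | a + 1, h => R.Q h ∧ Tower a (fun ω => rightDeriv (h ω))

variable {R}

lemma Tower.Q {a : ℕ} {h : Ω → ℝ → ℝ} (hh : R.Tower (a + 1) h) : R.Q h := hh.1

lemma Tower.deriv {a : ℕ} {h : Ω → ℝ → ℝ} (hh : R.Tower (a + 1) h) :
    R.Tower a (fun ω => rightDeriv (h ω)) := hh.2

lemma Tower.congr {a : ℕ} {h₁ h₂ : Ω → ℝ → ℝ} (hh : R.Tower a h₁)
    (he : ∀ ω, Set.EqOn (h₁ ω) (h₂ ω) (Set.Ici 0)) : R.Tower a h₂ := by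
  induction a generalizing h₁ h₂ with
  | zero => exact R.P_congr hh he
  | succ a ih => exact ⟨R.Q_congr hh.1 he, ih hh.2 fun ω => rightDeriv_congr (he ω)⟩

lemma Tower.pred {a : ℕ} {h : Ω → ℝ → ℝ} (hh : R.Tower (a + 1) h) : R.Tower a h := by
  induction a generalizing h with
  | zero => exact R.P_of_Q hh.1
  | succ a ih => exact ⟨hh.1, ih hh.2⟩

lemma Tower.mono {a b : ℕ} {h : Ω → ℝ → ℝ} (hh : R.Tower a h) (hb : b ≤ a) : R.Tower b h := by
  induction a, hb using Nat.le_induction with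
  | base => exact hh
  | succ a _ ih => exact ih hh.pred

lemma Tower.P {a : ℕ} {h : Ω → ℝ → ℝ} (hh : R.Tower a h) : R.P h := hh.mono (Nat.zero_le a)

lemma Tower.iterate {a b : ℕ} {h : Ω → ℝ → ℝ} (hh : R.Tower (a + b) h) :
    R.Tower a (fun ω => rightDeriv^[b] (h ω)) := by
  induction b generalizing h with
  | zero => exact hh
  | succ b ih => exact ih (h := fun ω => rightDeriv (h ω)) hh.2

/-- The right derivative may be replaced by a function that agrees with it. -/
lemma Tower.of_deriv {a : ℕ} {h d : Ω → ℝ → ℝ} (hQ : R.Q h) (hd : R.Tower a d)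
    (he : ∀ ω t, 0 ≤ t → rightDeriv (h ω) t = d ω t) : R.Tower (a + 1) h :=
  ⟨hQ, hd.congr fun ω t ht => (he ω t ht).symm⟩

lemma Tower.comp {a : ℕ} {ι : Type} [Fintype ι] {φ : (ι → ℝ) → ℝ} {c : ι → Ω → ℝ → ℝ}
    (hφ : ContDiff ℝ a φ) (hc : ∀ i, R.Tower a (c i)) :
    R.Tower a (fun ω t => φ (fun i => c i ω t)) := by
  classical
  induction a generalizing ι with
  | zero => exact R.P_comp hφ.continuous hc
  | succ a ih =>
    have hφ1 : ContDiff ℝ 1 φ := hφ.of_le (by norm_cast; omega)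
    refine ⟨R.Q_comp hφ1 fun i => (hc i).1, ?_⟩
    have key := ih (ι := ι ⊕ ι)
      (φ := fun p => ∑ i, fderiv ℝ φ (fun j => p (Sum.inl j)) (Pi.single i 1) * p (Sum.inr i))
      (c := Sum.elim c (fun i ω => rightDeriv (c i ω))) (by
        refine ContDiff.sum fun i _ => ContDiff.mul ?_ (contDiff_apply ℝ ℝ _)
        have h1 : ContDiff ℝ a (fderiv ℝ φ) := hφ.fderiv_right (by norm_cast)
        have h2 : ContDiff ℝ a (fun p : ι ⊕ ι → ℝ => (fun j => p (Sum.inl j))) :=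
          contDiff_pi.2 fun j => contDiff_apply ℝ ℝ _
        exact (h1.comp h2).clm_apply contDiff_const) (by
        rintro (i | i)
        · exact (hc i).pred
        · exact (hc i).2)
    refine key.congr fun ω t ht => ?_
    exact ((hasDerivWithinAt_comp_pi hφ1 (fun i => R.rdiff (hc i).1 ω) ht).rightDeriv_eq).symm

lemma Tower.const (a : ℕ) (b : ℝ) : R.Tower a (fun _ _ => b) :=
  Tower.comp (ι := Empty) (φ := fun _ => b) (c := fun i => i.elim) contDiff_const (fun i => i.elim)

lemma Tower.add {a : ℕ} {h₁ h₂ : Ω → ℝ → ℝ} (hh₁ : R.Tower a h₁) (hh₂ : R.Tower a h₂) :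
    R.Tower a (fun ω t => h₁ ω t + h₂ ω t) :=
  Tower.comp (ι := Bool) (φ := fun p => p true + p false) (c := fun i => bif i then h₁ else h₂)
    ((contDiff_apply ℝ ℝ _).add (contDiff_apply ℝ ℝ _)) (by rintro (_ | _) <;> assumption)

lemma Tower.mul {a : ℕ} {h₁ h₂ : Ω → ℝ → ℝ} (hh₁ : R.Tower a h₁) (hh₂ : R.Tower a h₂) :
    R.Tower a (fun ω t => h₁ ω t * h₂ ω t) :=
  Tower.comp (ι := Bool) (φ := fun p => p true * p false) (c := fun i => bif i then h₁ else h₂)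
    ((contDiff_apply ℝ ℝ _).mul (contDiff_apply ℝ ℝ _)) (by rintro (_ | _) <;> assumption)

lemma Tower.const_mul {a : ℕ} {h : Ω → ℝ → ℝ} (b : ℝ) (hh : R.Tower a h) :
    R.Tower a (fun ω t => b * h ω t) := (Tower.const a b).mul hh

lemma Tower.sub {a : ℕ} {h₁ h₂ : Ω → ℝ → ℝ} (hh₁ : R.Tower a h₁) (hh₂ : R.Tower a h₂) :
    R.Tower a (fun ω t => h₁ ω t - h₂ ω t) :=
  (hh₁.add (hh₂.const_mul (-1))).congr fun ω t _ => by ring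

lemma Tower.sum {a : ℕ} {κ : Type*} (s : Finset κ) {h : κ → Ω → ℝ → ℝ}
    (hh : ∀ i ∈ s, R.Tower a (h i)) : R.Tower a (fun ω t => ∑ i ∈ s, h i ω t) := by
  classical
  induction s using Finset.induction_on with
  | empty => simpa using Tower.const a 0
  | insert i s hi ih =>
    simp only [Finset.sum_insert hi]
    exact (hh i (by simp)).add (ih fun j hj => hh j (by simp [hj]))

lemma Tower.prod {a : ℕ} {κ : Type*} (s : Finset κ) {h : κ → Ω → ℝ → ℝ}
    (hh : ∀ i ∈ s, R.Tower a (h i)) : R.Tower a (fun ω t => ∏ i ∈ s, h i ω t) := by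
  classical
  induction s using Finset.induction_on with
  | empty => simpa using Tower.const a 1
  | insert i s hi ih =>
    simp only [Finset.prod_insert hi]
    exact (hh i (by simp)).mul (ih fun j hj => hh j (by simp [hj]))

/-- Composition with a function of a doubly indexed vector. -/
lemma Tower.comp₂ {a : ℕ} {ι κ : Type} [Fintype ι] [Fintype κ] {φ : (ι → κ → ℝ) → ℝ}
    {c : ι → κ → Ω → ℝ → ℝ} (hφ : ContDiff ℝ a φ) (hc : ∀ i j, R.Tower a (c i j)) :
    R.Tower a (fun ω t => φ (fun i j => c i j ω t)) :=
  Tower.comp (ι := ι × κ) (φ := fun p => φ (fun i j => p (i, j))) (c := fun p => c p.1 p.2)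
    (hφ.comp (contDiff_pi.2 fun _ => contDiff_pi.2 fun _ => contDiff_apply ℝ ℝ _))
    (fun p => hc p.1 p.2)

lemma Tower.rightDifferentiable {a : ℕ} {h : Ω → ℝ → ℝ} (hh : R.Tower a h) (ω : Ω) :
    RightDifferentiable a (h ω) := by
  intro s hs
  obtain ⟨b, rfl⟩ := Nat.exists_eq_add_of_lt hs
  have h1 : R.Tower (b + 1) (fun ω => rightDeriv^[s] (h ω)) :=
    Tower.iterate (hh.mono (by omega))
  exact R.rdiff h1.1 ω

/-- Continuity of all derivatives. -/
def contClass (Ω : Type) : RegClass Ω where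
  P h := ∀ ω, ContinuousOn (h ω) (Set.Ici 0)
  Q h := ∀ ω, ContinuousOn (h ω) (Set.Ici 0) ∧ RDiff (h ω)
  P_of_Q hh ω := (hh ω).1
  rdiff hh ω := (hh ω).2
  P_congr hh he ω := (hh ω).congr fun _ ht => (he ω ht).symm
  Q_congr hh he ω := ⟨(hh ω).1.congr fun _ ht => (he ω ht).symm, (hh ω).2.congr (he ω)⟩
  P_comp hφ hc ω := hφ.comp_continuousOn (continuousOn_pi.2 fun i => hc i ω)
  Q_comp hφ hc ω := ⟨hφ.continuous.comp_continuousOn (continuousOn_pi.2 fun i => (hc i ω).1),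
    RDiff.comp_pi hφ fun i => (hc i ω).2⟩

/-- Absolute continuity of all derivatives but the last. -/
def acClass (Ω : Type) : RegClass Ω where
  P _ := True
  Q h := ∀ ω, LocallyAC (h ω) ∧ RDiff (h ω)
  P_of_Q _ := trivial
  rdiff hh ω := (hh ω).2
  P_congr _ _ := trivial
  Q_congr hh he ω := ⟨(hh ω).1.congr (he ω), (hh ω).2.congr (he ω)⟩
  P_comp _ _ := trivial
  Q_comp hφ hc ω := ⟨LocallyAC.comp_locallyLipschitz hφ.locallyLipschitz fun i => (hc i ω).1,
    RDiff.comp_pi hφ fun i => (hc i ω).2⟩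

/-- All derivatives agree at time `0` for all members of the family. -/
def jetClass (Ω : Type) : RegClass Ω where
  P h := ∀ ω ω', h ω 0 = h ω' 0
  Q h := (∀ ω ω', h ω 0 = h ω' 0) ∧ ∀ ω, RDiff (h ω)
  P_of_Q hh := hh.1
  rdiff hh := hh.2
  P_congr hh he ω ω' := by
    rw [← he ω (Set.mem_Ici.2 le_rfl), ← he ω' (Set.mem_Ici.2 le_rfl)]; exact hh ω ω'
  Q_congr hh he := ⟨fun ω ω' => by
    rw [← he ω (Set.mem_Ici.2 le_rfl), ← he ω' (Set.mem_Ici.2 le_rfl)]; exact hh.1 ω ω',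
    fun ω => (hh.2 ω).congr (he ω)⟩
  P_comp _ hc ω ω' := by simp only [fun i => hc i ω ω']
  Q_comp hφ hc := ⟨fun ω ω' => by simp only [fun i => (hc i).1 ω ω'],
    fun ω => RDiff.comp_pi hφ fun i => (hc i).2 ω⟩

/-- Eventual boundedness. -/
def EvBdd (h : ℝ → ℝ) : Prop := ∃ B : ℝ, ∀ᶠ t in atTop, |h t| ≤ B

lemma EvBdd.congr {h₁ h₂ : ℝ → ℝ} (hh : EvBdd h₁) (he : Set.EqOn h₁ h₂ (Set.Ici 0)) :
    EvBdd h₂ := by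
  obtain ⟨B, hB⟩ := hh
  refine ⟨B, ?_⟩
  filter_upwards [hB, eventually_ge_atTop 0] with t ht h0
  rwa [← he h0]

lemma EvBdd.comp {ι : Type} [Fintype ι] {φ : (ι → ℝ) → ℝ} {c : ι → ℝ → ℝ} (hφ : Continuous φ)
    (hc : ∀ i, EvBdd (c i)) : EvBdd (fun t => φ (fun i => c i t)) := by
  choose B hB using hc
  have hK : IsCompact (Set.pi Set.univ fun i => Set.Icc (-B i) (B i)) :=
    isCompact_univ_pi fun i => isCompact_Icc
  obtain ⟨C, hC⟩ := hK.exists_bound_of_continuousOn hφ.continuousOn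
  refine ⟨C, ?_⟩
  filter_upwards [eventually_all.2 hB] with t ht
  exact hC _ fun i _ => abs_le.1 (ht i)

lemma EvBdd.of_tendsto {h : ℝ → ℝ} {b : ℝ} (hh : Tendsto h atTop (𝓝 b)) : EvBdd h := by
  refine ⟨|b| + 1, ?_⟩
  filter_upwards [(hh.abs).eventually (gt_mem_nhds (lt_add_one |b|))] with t ht using ht.le

lemma EvBdd.mul_tendsto {h₁ h₂ : ℝ → ℝ} (hh₁ : EvBdd h₁) (hh₂ : Tendsto h₂ atTop (𝓝 0)) :
    Tendsto (fun t => h₁ t * h₂ t) atTop (𝓝 0) := by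
  obtain ⟨B, hB⟩ := hh₁
  exact bdd_le_mul_tendsto_zero' B hB hh₂

/-- Boundedness, with all derivatives tending to `0`. -/
def settleClass (Ω : Type) : RegClass Ω where
  P h := ∀ ω, EvBdd (h ω)
  Q h := ∀ ω, EvBdd (h ω) ∧ RDiff (h ω) ∧ Tendsto (rightDeriv (h ω)) atTop (𝓝 0)
  P_of_Q hh ω := (hh ω).1
  rdiff hh ω := (hh ω).2.1
  P_congr hh he ω := (hh ω).congr (he ω)
  Q_congr hh he ω := ⟨(hh ω).1.congr (he ω), (hh ω).2.1.congr (he ω), (hh ω).2.2.congr' (by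
    filter_upwards [eventually_ge_atTop 0] with t ht using rightDeriv_congr (he ω) ht)⟩
  P_comp hφ hc ω := EvBdd.comp hφ fun i => hc i ω
  Q_comp := by
    classical
    intro ι _ φ c hφ hc ω
    refine ⟨EvBdd.comp hφ.continuous fun i => (hc i ω).1, RDiff.comp_pi hφ fun i => (hc i ω).2.1, ?_⟩
    have h1 : Tendsto (fun t => ∑ i, fderiv ℝ φ (fun i => c i ω t) (Pi.single i 1) *
        rightDeriv (c i ω) t) atTop (𝓝 0) := by
      rw [show (0 : ℝ) = ∑ _i : ι, 0 by simp]
      refine tendsto_finsetSum _ fun i _ => EvBdd.mul_tendsto ?_ (hc i ω).2.2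
      refine EvBdd.comp (φ := fun p => fderiv ℝ φ p (Pi.single i 1)) ?_ fun i => (hc i ω).1
      exact (hφ.continuous_fderiv one_ne_zero).clm_apply continuous_const
    refine h1.congr' ?_
    filter_upwards [eventually_ge_atTop 0] with t ht
    exact ((hasDerivWithinAt_comp_pi hφ (fun i => (hc i ω).2.1) ht).rightDeriv_eq).symm

end RegClass

/-! ### The algebra of the coordinate change -/

lemma sum_sym_insert {α : Type*} [DecidableEq α] {s : Finset α} {b : α} (hb : b ∉ s)
    (κ : α → ℝ) (a : ℕ) :
    ∑ m ∈ (insert b s).sym (a + 1), ((m : Multiset α).map κ).prod =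
      ∑ m ∈ s.sym (a + 1), ((m : Multiset α).map κ).prod +
        κ b * ∑ m ∈ (insert b s).sym a, ((m : Multiset α).map κ).prod := by
  rw [← Finset.sum_filter_add_sum_filter_not _ (fun m => b ∉ m)]
  congr 1
  · refine Finset.sum_congr ?_ fun _ _ => rfl
    ext m
    simp only [Finset.mem_filter, Finset.mem_sym_iff, Finset.mem_insert]
    constructor
    · rintro ⟨h1, h2⟩ c hc
      rcases h1 c hc with rfl | h
      · exact absurd hc h2
      · exact h
    · exact fun h => ⟨fun c hc => Or.inr (h c hc), fun hm => hb (h b hm)⟩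
  · rw [Finset.mul_sum]
    symm
    refine Finset.sum_bij (fun m _ => Sym.cons b m) ?_ ?_ ?_ ?_
    · intro m hm
      rw [Finset.mem_sym_iff] at hm
      rw [Finset.mem_filter, Finset.mem_sym_iff, not_not]
      refine ⟨fun c hc => ?_, Sym.mem_cons_self b m⟩
      rcases Sym.mem_cons.1 hc with rfl | hc
      · simp
      · exact hm c hc
    · intro m _ m' _ h
      exact Sym.cons_inj_right b m m' |>.1 h
    · intro m hm
      simp only [Finset.mem_filter, not_not] at hm
      obtain ⟨m', rfl⟩ := Sym.exists_cons_of_mem hm.2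
      refine ⟨m', ?_, rfl⟩
      rw [Finset.mem_sym_iff] at hm ⊢
      exact fun c hc => hm.1 c (Sym.mem_cons.2 (Or.inr hc))
    · intro m _
      simp [Sym.coe_cons]

section symProd

variable {n : ℕ} (κ : Fin n → ℝ)

lemma symProd_zero (β : ℕ) : symProd κ 0 β = 1 := by
  rw [symProd, Finset.sym_zero, Finset.sum_singleton]
  rfl

lemma symProd_succ_zero (α : ℕ) : symProd κ (α + 1) 0 = 0 := by
  have : (Finset.univ.filter (fun p : Fin n => 1 ≤ p.val ∧ p.val ≤ 0)) = ∅ := by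
    ext p; simp; omega
  rw [symProd, this, Finset.sym_empty]
  simp

lemma symProd_succ_succ (α β : ℕ) (hβ : β + 1 < n) :
    symProd κ (α + 1) (β + 1) =
      symProd κ (α + 1) β + κ ⟨β + 1, hβ⟩ * symProd κ α (β + 1) := by
  have : (Finset.univ.filter (fun p : Fin n => 1 ≤ p.val ∧ p.val ≤ β + 1)) =
      insert ⟨β + 1, hβ⟩ (Finset.univ.filter (fun p : Fin n => 1 ≤ p.val ∧ p.val ≤ β)) := by
    ext p; simp [Fin.ext_iff]; omega
  simp only [symProd, this]
  exact sum_sym_insert (by simp) κ α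

end symProd

/-- Sum over the indices in `Fin n` with values in `[1, ℓ)`, as a sum over a range. -/
lemma sum_fin_filter_eq {n : ℕ} (c : ℕ → ℝ) (w : Fin n → ℝ) {ℓ : ℕ} (hℓ : ℓ ≤ n) :
    ∑ p : Fin n with 1 ≤ p.val ∧ p.val < ℓ, c p.val * w p =
      ∑ p ∈ Finset.Ico 1 ℓ, c p * (if h : p < n then w ⟨p, h⟩ else 0) := by
  refine Finset.sum_bij (fun p _ => p.val) ?_ ?_ ?_ ?_
  · intro p hp; simpa using hp
  · intro p _ q _ h; exact Fin.ext h
  · intro p hp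
    rw [Finset.mem_Ico] at hp
    exact ⟨⟨p, by omega⟩, by simpa using hp, rfl⟩
  · intro p _; simp

/-- The combination of lower coordinates in the coordinate change absorbs the linear dynamics. -/
lemma symProd_telescope {n : ℕ} (κ : Fin n → ℝ) (w : ℕ → ℝ) (ℓ : ℕ) (hℓ : 1 ≤ ℓ) (hn : ℓ < n) :
    ∑ p ∈ Finset.Ico 1 ℓ, (-1) ^ (ℓ - p + 1) * symProd κ (ℓ - p) p *
        (-(if h : p < n then κ ⟨p, h⟩ else 0) * w p + w (p + 1)) =
      ∑ p ∈ Finset.Ico 1 (ℓ + 1), (-1) ^ (ℓ + 1 - p + 1) * symProd κ (ℓ + 1 - p) p * w p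
        - κ ⟨ℓ, hn⟩ * w ℓ := by
  set κ' : ℕ → ℝ := fun p => if h : p < n then κ ⟨p, h⟩ else 0 with hκ'
  have hrec : ∀ α β, β + 1 < n → symProd κ (α + 1) (β + 1) =
      symProd κ (α + 1) β + κ' (β + 1) * symProd κ α (β + 1) := fun α β h => by
    rw [symProd_succ_succ κ α β h, hκ']; simp [h]
  have key : ∀ j, j + 1 ≤ ℓ →
      ∑ p ∈ Finset.Ico 1 (j + 1), (-1) ^ (ℓ - p + 1) * symProd κ (ℓ - p) p *
        (-κ' p * w p + w (p + 1)) =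
      ∑ p ∈ Finset.Ico 1 (j + 1), (-1) ^ (ℓ + 1 - p + 1) * symProd κ (ℓ + 1 - p) p * w p
        + (-1) ^ (ℓ - j + 1) * symProd κ (ℓ - j) j * w (j + 1) := by
    intro j hj
    induction j with
    | zero =>
      obtain ⟨a, rfl⟩ : ∃ a, ℓ = a + 1 := ⟨ℓ - 1, by omega⟩
      simp [symProd_succ_zero]
    | succ j ih =>
      rw [Finset.sum_Ico_succ_top (by omega : 1 ≤ j + 1),
        Finset.sum_Ico_succ_top (by omega : 1 ≤ j + 1), ih (by omega)]
      obtain ⟨a, rfl⟩ : ∃ a, ℓ = j + 2 + a := ⟨ℓ - (j + 2), by omega⟩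
      have e1 : j + 2 + a - j = a + 2 := by omega
      have e2 : j + 2 + a - (j + 1) = a + 1 := by omega
      have e3 : j + 2 + a + 1 - (j + 1) = a + 2 := by omega
      rw [e1, e2, e3, hrec (a + 1) j (by omega)]
      ring
  obtain ⟨j, rfl⟩ : ∃ j, ℓ = j + 1 := ⟨ℓ - 1, by omega⟩
  rw [key j le_rfl, Finset.sum_Ico_succ_top (by omega : 1 ≤ j + 1)]
  have e1 : j + 1 - j = 1 := by omega
  have e2 : j + 1 + 1 - (j + 1) = 1 := by omega
  rw [e1, e2, hrec 0 j hn, symProd_zero]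
  simp only [hκ', hn, dif_pos]
  ring

namespace StrictFeedback

variable {N n : ℕ} (S : StrictFeedback N n)

lemma gainProd_zero (x : Fin n → Fin N → ℝ) (i : Fin N) : S.gainProd x 0 i = 1 := by
  simp [gainProd]

lemma gainProd_succ (x : Fin n → Fin N → ℝ) (ℓ : Fin n) (i : Fin N) :
    S.gainProd x (ℓ.val + 1) i = S.gainProd x ℓ.val i * S.Θ ℓ i (firstBlocks x ℓ) := by
  have : (Finset.univ.filter fun r : Fin n => r.val < ℓ.val + 1) =
      insert ℓ (Finset.univ.filter fun r : Fin n => r.val < ℓ.val) := by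
    ext r; simp [Fin.ext_iff]; omega
  rw [gainProd, this, Finset.prod_insert (by simp), mul_comm]
  rfl

lemma gainProd_ne_zero {S : StrictFeedback N n} (hS : S.Regular) (x : Fin n → Fin N → ℝ) (q : ℕ)
    (i : Fin N) : S.gainProd x q i ≠ 0 :=
  Finset.prod_ne_zero_iff.2 fun r _ => hS.ne_zero r i _

end StrictFeedback

section Coordinates

variable {N m l n : ℕ} [NeZero n] (S : StrictFeedback N n) (g : SharedGame N m l)
  (k₁ : ℝ) (k : Fin N → Fin n → ℝ)

/-- The coordinate change and the control law hold along the curves, and the right derivatives in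
them exist. -/
structure IsCoordChange (x : ℝ → Fin n → Fin N → ℝ) (u : ℝ → Fin N → ℝ)
    (z : ℝ → Fin n → Fin N → ℝ) (lam : ℝ → Fin m → ℝ) (mu : ℝ → Fin l → ℝ) : Prop where
  diff_lead : ∀ i, RightDifferentiable (n - 1) (leadTerm S g k₁ x lam mu i)
  diff_gain : ∀ (q : Fin n) i, RightDifferentiable 1 (fun t => S.gainProd (x t) q.val i)
  diff_inner : ∀ (q : Fin n) i, 1 ≤ q.val →
    RightDifferentiable (n - 1 - q.val) (innerTerm S x q i)
  coord_zero : ∀ t, 0 ≤ t → z t 0 = x t 0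
  coord : ∀ t, 0 ≤ t → ∀ (ℓ : Fin n) i, 1 ≤ ℓ.val →
    z t ℓ i = bracket S g k₁ k x z lam mu ℓ.val i t + S.gainProd (x t) ℓ.val i * x t ℓ i
  control : ∀ t, 0 ≤ t → ∀ i,
    u t i = -(1 / S.gainProd (x t) n i) * bracket S g k₁ k x z lam mu n i t

variable {S g k₁ k} {x z : ℝ → Fin n → Fin N → ℝ} {u : ℝ → Fin N → ℝ} {lam : ℝ → Fin m → ℝ}
  {mu : ℝ → Fin l → ℝ}

lemma bracket_one (i : Fin N) (t : ℝ) :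
    bracket S g k₁ k x z lam mu 1 i t = leadTerm S g k₁ x lam mu i t := by
  have h1 : (Finset.univ.filter fun p : Fin n => 1 ≤ p.val ∧ p.val < 1) = ∅ :=
    Finset.filter_eq_empty_iff.2 fun p _ h => by omega
  rw [bracket, h1, Finset.sum_empty, Finset.sum_empty]
  simp

/-- The relation of the coordinate change one level up, with the control as the last state. -/
lemma IsCoordChange.next (hS : S.Regular) (hc : IsCoordChange S g k₁ k x u z lam mu) {t : ℝ}
    (ht : 0 ≤ t) (ℓ : Fin n) (i : Fin N) :
    (if h : ℓ.val + 1 < n then z t ⟨ℓ.val + 1, h⟩ i else 0) =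
      bracket S g k₁ k x z lam mu (ℓ.val + 1) i t + S.gainProd (x t) (ℓ.val + 1) i *
        (if h : ℓ.val + 1 < n then x t ⟨ℓ.val + 1, h⟩ i else u t i) := by
  by_cases h : ℓ.val + 1 < n
  · simp only [h, dif_pos]
    exact hc.coord t ht ⟨ℓ.val + 1, h⟩ i (by simp)
  · have hn : ℓ.val + 1 = n := by omega
    simp only [h, dif_neg, not_false_eq_true]
    rw [hn, hc.control t ht i]
    have := StrictFeedback.gainProd_ne_zero hS (x t) n i
    field_simp
    ring

/-- The defects of the transformed equations are combinations of the defects of the plant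
equations. -/
lemma IsCoordChange.defect (hS : S.Regular) (hc : IsCoordChange S g k₁ k x u z lam mu) {t : ℝ}
    (ht : 0 ≤ t) {dx dz : Fin n → Fin N → ℝ}
    (hx : ∀ ℓ i, HasDerivWithinAt (fun s => x s ℓ i) (dx ℓ i) (Set.Ici t) t)
    (hz : ∀ ℓ i, HasDerivWithinAt (fun s => z s ℓ i) (dz ℓ i) (Set.Ici t) t)
    (ℓ : Fin n) (i : Fin N) :
    dz ℓ i - transformedRhs g k₁ k (z t) (lam t) (mu t) ℓ i =
      (∑ p : Fin n with 1 ≤ p.val ∧ p.val < ℓ.val,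
        (-1) ^ (ℓ.val - p.val + 1) * symProd (k i) (ℓ.val - p.val) p.val *
          (dz p i - transformedRhs g k₁ k (z t) (lam t) (mu t) p i)) +
      S.gainProd (x t) ℓ.val i * (dx ℓ i - S.rhs (x t) (u t) ℓ i) := by
  have hnext := hc.next hS ht ℓ i
  rcases Nat.eq_zero_or_pos ℓ.val with h0 | hpos
  · have hℓ : ℓ = 0 := Fin.ext (by simpa using h0)
    subst hℓ
    have hd : dz 0 i = dx 0 i := by
      refine (uniqueDiffWithinAt_Ici t).eq_deriv _ (hz 0 i) ((hx 0 i).congr (fun s hs => ?_) ?_)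
      · rw [hc.coord_zero s (le_trans ht hs)]
      · rw [hc.coord_zero t ht]
    have hsum : (Finset.univ.filter fun p : Fin n => 1 ≤ p.val ∧ p.val < (0 : Fin n).val) = ∅ := by
      ext p; simp
    rw [hsum, Finset.sum_empty, zero_add, hd, transformedRhs, if_pos rfl, hnext,
      StrictFeedback.rhs, StrictFeedback.gainProd_succ]
    simp only [Fin.val_zero, StrictFeedback.gainProd_zero, one_mul, zero_add] at *
    rw [bracket_one, leadTerm, hc.coord_zero t ht]
    ring
  · have hℓn := ℓ.isLt
    set c : ℕ → ℕ → ℝ := fun ℓ p => (-1) ^ (ℓ - p + 1) * symProd (k i) (ℓ - p) p with hcdef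
    have hlead : HasDerivWithinAt (rightDeriv^[ℓ.val - 1] (leadTerm S g k₁ x lam mu i))
        (rightDeriv^[ℓ.val] (leadTerm S g k₁ x lam mu i) t) (Set.Ici t) t := by
      have h1 := (hc.diff_lead i (ℓ.val - 1) (by omega) t ht).hasDerivWithinAt
      have h2 : rightDeriv^[ℓ.val] (leadTerm S g k₁ x lam mu i) =
          rightDeriv (rightDeriv^[ℓ.val - 1] (leadTerm S g k₁ x lam mu i)) := by
        rw [← Function.iterate_succ_apply' rightDeriv, Nat.succ_eq_add_one,
          Nat.sub_add_cancel hpos]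
      rw [h2]
      exact h1
    have hinner : ∀ q : Fin n, 1 ≤ q.val ∧ q.val < ℓ.val →
        HasDerivWithinAt (rightDeriv^[ℓ.val - 1 - q.val] (innerTerm S x q i))
          (rightDeriv^[ℓ.val - q.val] (innerTerm S x q i) t) (Set.Ici t) t := by
      intro q hq
      have h1 := (hc.diff_inner q i hq.1 (ℓ.val - 1 - q.val) (by omega) t ht).hasDerivWithinAt
      have h2 : rightDeriv^[ℓ.val - q.val] (innerTerm S x q i) =
          rightDeriv (rightDeriv^[ℓ.val - 1 - q.val] (innerTerm S x q i)) := by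
        rw [← Function.iterate_succ_apply' rightDeriv]
        congr 1
        omega
      rw [h2]
      exact h1
    have hgain : HasDerivWithinAt (fun s => S.gainProd (x s) ℓ.val i)
        (rightDeriv (fun s => S.gainProd (x s) ℓ.val i) t) (Set.Ici t) t :=
      (hc.diff_gain ℓ i 0 one_pos t ht).hasDerivWithinAt
    have hbr : HasDerivWithinAt (bracket S g k₁ k x z lam mu ℓ.val i)
        ((∑ p : Fin n with 1 ≤ p.val ∧ p.val < ℓ.val, c ℓ.val p.val * dz p i) +
          rightDeriv^[ℓ.val] (leadTerm S g k₁ x lam mu i) t +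
          ∑ q : Fin n with 1 ≤ q.val ∧ q.val < ℓ.val,
            rightDeriv^[ℓ.val - q.val] (innerTerm S x q i) t) (Set.Ici t) t := by
      refine ((HasDerivWithinAt.fun_sum fun p _ => (hz p i).const_mul _).add hlead).add ?_
      exact HasDerivWithinAt.fun_sum fun q hq => hinner q (by simpa using hq)
    have hdz : dz ℓ i = ((∑ p : Fin n with 1 ≤ p.val ∧ p.val < ℓ.val, c ℓ.val p.val * dz p i) +
          rightDeriv^[ℓ.val] (leadTerm S g k₁ x lam mu i) t +
          ∑ q : Fin n with 1 ≤ q.val ∧ q.val < ℓ.val,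
            rightDeriv^[ℓ.val - q.val] (innerTerm S x q i) t) +
        (rightDeriv (fun s => S.gainProd (x s) ℓ.val i) t * x t ℓ i +
          S.gainProd (x t) ℓ.val i * dx ℓ i) := by
      refine (uniqueDiffWithinAt_Ici t).eq_deriv _ (hz ℓ i)
        ((hbr.add (hgain.mul (hx ℓ i))).congr (fun s hs => ?_) ?_)
      · exact hc.coord s (le_trans ht hs) ℓ i hpos
      · exact hc.coord t ht ℓ i hpos
    have hb1 : bracket S g k₁ k x z lam mu (ℓ.val + 1) i t =
        (∑ p : Fin n with 1 ≤ p.val ∧ p.val < ℓ.val + 1, c (ℓ.val + 1) p.val * z t p i) +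
        rightDeriv^[ℓ.val] (leadTerm S g k₁ x lam mu i) t +
        ((∑ q : Fin n with 1 ≤ q.val ∧ q.val < ℓ.val,
            rightDeriv^[ℓ.val - q.val] (innerTerm S x q i) t) + innerTerm S x ℓ i t) := by
      have hset : (Finset.univ.filter fun q : Fin n => 1 ≤ q.val ∧ q.val < ℓ.val + 1) =
          insert ℓ (Finset.univ.filter fun q : Fin n => 1 ≤ q.val ∧ q.val < ℓ.val) := by
        ext q; simp [Fin.ext_iff]; omega
      rw [bracket]
      congr 1
      rw [hset, Finset.sum_insert (by simp), add_comm]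
      simp
    set w : ℕ → ℝ := fun p => if h : p < n then z t ⟨p, h⟩ i else 0 with hw
    have htr : ∀ p : Fin n, 1 ≤ p.val → transformedRhs g k₁ k (z t) (lam t) (mu t) p i =
        -(if h : p.val < n then k i ⟨p.val, h⟩ else 0) * w p.val + w (p.val + 1) := by
      intro p hp
      have hp0 : p ≠ 0 := by rintro rfl; simp at hp
      simp [transformedRhs, hp0, hw]
    have e1 : ∑ p : Fin n with 1 ≤ p.val ∧ p.val < ℓ.val, c ℓ.val p.val *
        transformedRhs g k₁ k (z t) (lam t) (mu t) p i =
        ∑ p ∈ Finset.Ico 1 ℓ.val, c ℓ.val p *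
          (-(if h : p < n then k i ⟨p, h⟩ else 0) * w p + w (p + 1)) := by
      rw [sum_fin_filter_eq (c ℓ.val) _ hℓn.le]
      refine Finset.sum_congr rfl fun p hp => ?_
      rw [Finset.mem_Ico] at hp
      have hpn : p < n := by omega
      rw [dif_pos hpn, htr ⟨p, hpn⟩ hp.1]
    have e2 : ∑ p : Fin n with 1 ≤ p.val ∧ p.val < ℓ.val + 1, c (ℓ.val + 1) p.val * z t p i =
        ∑ p ∈ Finset.Ico 1 (ℓ.val + 1), c (ℓ.val + 1) p * w p :=
      sum_fin_filter_eq (c (ℓ.val + 1)) _ hℓn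
    have htel := symProd_telescope (k i) w ℓ.val hpos hℓn
    have hℓ0 : ℓ ≠ 0 := by rintro rfl; simp at hpos
    have hwℓ : w ℓ.val = z t ℓ i := by simp [hw]
    have hT : transformedRhs g k₁ k (z t) (lam t) (mu t) ℓ i = -k i ℓ * z t ℓ i +
        (if h : ℓ.val + 1 < n then z t ⟨ℓ.val + 1, h⟩ i else 0) := by
      rw [transformedRhs, if_neg hℓ0]
    rw [hT, hnext, hb1, hdz, StrictFeedback.gainProd_succ, StrictFeedback.rhs, innerTerm]
    simp only [mul_sub, Finset.sum_sub_distrib]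
    rw [e1, e2, htel, hwℓ]
    simp only [Fin.eta]
    ring

end Coordinates

/-! ### The game -/

namespace SharedGame

variable {N m l n : ℕ} {g : SharedGame N m l}

/-- The constant partial derivatives of the affine constraints. -/
noncomputable def slopeH (g : SharedGame N m l) (j : Fin m) (i : Fin N) : ℝ := partialAt (g.H j) i 0

lemma Regular.hasFDerivAt_H (hg : g.Regular n) (j : Fin m) :
    ∃ A : (Fin N → ℝ) →L[ℝ] ℝ, (∀ y, HasFDerivAt (g.H j) A y) ∧
      ∀ w y, g.H j w - g.H j y = A (w - y) := by
  obtain ⟨a, ha⟩ := hg.affine_H j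
  refine ⟨LinearMap.toContinuousLinearMap a.linear, fun y => ?_, fun w y => ?_⟩
  · have h1 : g.H j = fun y => a.linear y + a 0 := by
      ext y
      rw [ha]
      have := a.map_vadd 0 y
      simpa using this
    rw [h1]
    exact (LinearMap.toContinuousLinearMap a.linear).hasFDerivAt.add_const _
  · rw [ha, ha]
    have := a.linearMap_vsub w y
    simpa using this.symm

lemma Regular.H_sub (hg : g.Regular n) (j : Fin m) (w y : Fin N → ℝ) :
    g.H j w - g.H j y = ∑ i, g.slopeH j i * (w i - y i) := by
  obtain ⟨A, h1, h2⟩ := hg.hasFDerivAt_H j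
  rw [h2, clm_apply_eq_sum]
  simp only [slopeH, partialAt, (h1 0).fderiv, Pi.sub_apply]

lemma Regular.partialAt_H (hg : g.Regular n) (j : Fin m) (i : Fin N) (y : Fin N → ℝ) :
    partialAt (g.H j) i y = g.slopeH j i := by
  obtain ⟨A, h1, -⟩ := hg.hasFDerivAt_H j
  rw [slopeH, partialAt, partialAt, (h1 0).fderiv, (h1 y).fderiv]

lemma Regular.contDiff_H (hg : g.Regular n) (j : Fin m) {r : WithTop ℕ∞} :
    ContDiff ℝ r (g.H j) := by
  have h1 : g.H j = fun w => g.H j 0 + ∑ i, g.slopeH j i * w i := by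
    ext w
    have := hg.H_sub j w 0
    simp only [Pi.zero_apply, sub_zero] at this
    linarith
  rw [h1]
  exact contDiff_const.add (ContDiff.sum fun i _ => contDiff_const.mul (contDiff_apply ℝ ℝ i))

lemma Regular.continuous_G (hg : g.Regular n) (j : Fin l) : Continuous (g.G j) :=
  (hg.smooth_G j).continuous

/-- Under Slater's condition, a solution of the variational inequality has multipliers for the
inequality constraints. -/
lemma SolvesVI.exists_inequality_multiplier (hg : g.Regular n) (hSlater : g.Slater)
    {ys : Fin N → ℝ} (hys : g.SolvesVI ys) :
    ∃ mus : Fin l → ℝ, (∀ j, 0 ≤ mus j) ∧ ∀ w, (∀ j, g.H j w = 0) →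
      0 ≤ ∑ i, (w i - ys i) * g.pseudoGrad ys i + ∑ j, mus j * g.G j w := by
  set φ : (Fin N → ℝ) → ℝ := fun w => ∑ i, (w i - ys i) * g.pseudoGrad ys i with hφ
  set C : Set (ℝ × (Fin l → ℝ)) :=
    {p | ∃ w, (∀ j, g.H j w = 0) ∧ φ w < p.1 ∧ ∀ j, g.G j w < p.2 j} with hC
  have hopen : IsOpen C := by
    have : C = ⋃ w ∈ {w | ∀ j, g.H j w = 0},
        (Set.Ioi (φ w)) ×ˢ (Set.pi Set.univ fun j => Set.Ioi (g.G j w)) := by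
      ext p; simp [hC, and_left_comm]
    rw [this]
    exact isOpen_biUnion fun w _ =>
      isOpen_Ioi.prod (isOpen_set_pi Set.finite_univ fun j _ => isOpen_Ioi)
  have hconv : Convex ℝ C := by
    rintro p ⟨w, hw0, hw1, hw2⟩ p' ⟨w', hw0', hw1', hw2'⟩ a b ha hb hab
    refine ⟨a • w + b • w', fun j => ?_, ?_, fun j => ?_⟩
    · obtain ⟨f, hf⟩ := hg.affine_H j
      rw [hf, Convex.combo_affine_apply hab, ← hf, ← hf, hw0, hw0']
      simp
    · have e : φ (a • w + b • w') = a * φ w + b * φ w' := by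
        simp only [hφ, Finset.mul_sum, ← Finset.sum_add_distrib, Pi.add_apply, Pi.smul_apply,
          smul_eq_mul]
        refine Finset.sum_congr rfl fun i _ => ?_
        have : ys i = (a + b) * ys i := by rw [hab, one_mul]
        linear_combination (-g.pseudoGrad ys i) * this
      rw [e]
      simp only [Prod.fst_add, Prod.smul_fst, smul_eq_mul]
      rcases eq_or_lt_of_le ha with rfl | ha'
      · have : b = 1 := by linarith
        subst this; linarith
      · have h1 := mul_lt_mul_of_pos_left hw1 ha'
        have h2 := mul_le_mul_of_nonneg_left hw1'.le hb
        linarith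
    · have h0 := (hg.convex_G j).2 (Set.mem_univ w) (Set.mem_univ w') ha hb hab
      simp only [smul_eq_mul] at h0
      refine h0.trans_lt ?_
      simp only [Prod.snd_add, Prod.smul_snd, Pi.add_apply, Pi.smul_apply, smul_eq_mul]
      rcases eq_or_lt_of_le ha with rfl | ha'
      · have : b = 1 := by linarith
        subst this; linarith [hw2' j]
      · have h1 := mul_lt_mul_of_pos_left (hw2 j) ha'
        have h2 := mul_le_mul_of_nonneg_left (hw2' j).le hb
        linarith
  have hnot : (0 : ℝ × (Fin l → ℝ)) ∉ C := by
    rintro ⟨w, hw0, hw1, hw2⟩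
    exact absurd (hys.2 w ⟨hw0, fun j => (hw2 j).le⟩) (not_le.2 hw1)
  obtain ⟨f, hf⟩ := geometric_hahn_banach_point_open hconv hopen hnot
  rw [map_zero] at hf
  set a : ℝ := f (1, 0) with ha
  set ν : Fin l → ℝ := fun j => f (0, Pi.single j 1) with hν
  have hfe : ∀ c s, f (c, s) = a * c + ∑ j, ν j * s j := by
    intro c s
    have h1 : f (0, s) = ∑ j, ν j * s j :=
      clm_apply_eq_sum (f.comp (ContinuousLinearMap.inr ℝ ℝ (Fin l → ℝ))) s
    have h2 : (c, s) = c • ((1 : ℝ), (0 : Fin l → ℝ)) + (0, s) := by simp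
    rw [h2, map_add, map_smul, h1, smul_eq_mul, mul_comm]
  obtain ⟨yb, hyb0, hyb1⟩ := hSlater
  have hray : ∀ v : ℝ × (Fin l → ℝ), 0 ≤ v.1 → (∀ j, 0 ≤ v.2 j) → 0 ≤ f v := by
    intro v hv1 hv2
    by_contra hneg
    push Not at hneg
    have hmem : ∀ s : ℝ, 0 ≤ s → ((φ yb + 1, 0) : ℝ × (Fin l → ℝ)) + s • v ∈ C := by
      intro s hs
      refine ⟨yb, hyb0, ?_, fun j => ?_⟩
      · simp only [Prod.fst_add, Prod.smul_fst, smul_eq_mul]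
        nlinarith [mul_nonneg hs hv1]
      · simp only [Prod.snd_add, Prod.smul_snd, Pi.add_apply, Pi.smul_apply, smul_eq_mul,
          Pi.zero_apply]
        nlinarith [mul_nonneg hs (hv2 j), hyb1 j]
    have h0 := hf _ (hmem 0 le_rfl)
    rw [zero_smul, add_zero] at h0
    have h1 := hf _ (hmem (f (φ yb + 1, 0) / -f v) (div_nonneg h0.le (by linarith)))
    rw [map_add, map_smul, smul_eq_mul, div_mul_eq_mul_div, mul_div_assoc] at h1
    have h2 : f v / -f v = -1 := by rw [div_neg, div_self hneg.ne]
    rw [h2] at h1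
    linarith
  have ha0 : 0 ≤ a := hray _ zero_le_one fun j => le_rfl
  have hν0 : ∀ j, 0 ≤ ν j := fun j => hray _ le_rfl fun j' => by
    by_cases h : j' = j
    · subst h; simp
    · simp [h]
  have hapos : 0 < a := by
    have h1 := hf (φ yb + 1, 0) ⟨yb, hyb0, by simp, fun j => by simpa using hyb1 j⟩
    rw [hfe] at h1
    simp only [Pi.zero_apply, mul_zero, Finset.sum_const_zero, add_zero] at h1
    rcases eq_or_lt_of_le ha0 with h | h
    · rw [← h] at h1; simp at h1
    · exact h
  have hmain : ∀ w, (∀ j, g.H j w = 0) → 0 ≤ a * φ w + ∑ j, ν j * g.G j w := by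
    intro w hw
    have h1 : ∀ ε : ℝ, 0 < ε → 0 ≤ (a * φ w + ∑ j, ν j * g.G j w) + ε * (a + ∑ j, ν j) := by
      intro ε hε
      have h2 := hf (φ w + ε, fun j => g.G j w + ε) ⟨w, hw, by simpa using hε, fun j => by
        simpa using hε⟩
      rw [hfe] at h2
      simp only [mul_add, Finset.sum_add_distrib, ← Finset.sum_mul] at h2
      linarith
    have hlim : Tendsto (fun ε : ℝ => (a * φ w + ∑ j, ν j * g.G j w) + ε * (a + ∑ j, ν j))
        (𝓝[>] 0) (𝓝 ((a * φ w + ∑ j, ν j * g.G j w) + 0 * (a + ∑ j, ν j))) :=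
      (tendsto_nhdsWithin_of_tendsto_nhds
        (by exact (continuous_const.add (continuous_id.mul continuous_const)).tendsto 0))
    have := ge_of_tendsto hlim (by filter_upwards [self_mem_nhdsWithin] with ε hε using h1 ε hε)
    simpa using this
  refine ⟨fun j => ν j / a, fun j => div_nonneg (hν0 j) ha0, fun w hw => ?_⟩
  have h1 := div_nonneg (hmain w hw) ha0
  rw [add_div, mul_div_cancel_left₀ _ hapos.ne', Finset.sum_div] at h1
  simpa only [div_mul_eq_mul_div] using h1

section

variable [NeZero n]

lemma one_le_cast : (1 : WithTop ℕ∞) ≤ (n : WithTop ℕ∞) := by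
  exact_mod_cast Nat.one_le_iff_ne_zero.2 (NeZero.ne n)

lemma Regular.differentiable_f (hg : g.Regular n) (i : Fin N) : Differentiable ℝ (g.f i) :=
  ((hg.smooth_f i).of_le one_le_cast).differentiable one_ne_zero

lemma Regular.differentiable_G (hg : g.Regular n) (j : Fin l) : Differentiable ℝ (g.G j) :=
  ((hg.smooth_G j).of_le one_le_cast).differentiable one_ne_zero

lemma Regular.gradL_eq (hg : g.Regular n) (i : Fin N) (lam : Fin m → ℝ) (mu : Fin l → ℝ)
    (y : Fin N → ℝ) :
    g.gradL i lam mu y = g.pseudoGrad y i + ∑ j, lam j * g.slopeH j i +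
      ∑ j, mu j * partialAt (g.G j) i y := by
  have h1 : HasFDerivAt (g.lagrangian i lam mu)
      (fderiv ℝ (g.f i) y + ∑ j, lam j • fderiv ℝ (g.H j) y + ∑ j, mu j • fderiv ℝ (g.G j) y) y := by
    refine ((hg.differentiable_f i y).hasFDerivAt.add (HasFDerivAt.fun_sum fun j _ => ?_)).add
      (HasFDerivAt.fun_sum fun j _ => ?_)
    · have : DifferentiableAt ℝ (g.H j) y := (hg.contDiff_H j (r := 1)).differentiable one_ne_zero y
      exact this.hasFDerivAt.const_mul (lam j)
    · exact (hg.differentiable_G j y).hasFDerivAt.const_mul (mu j)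
  rw [gradL, partialAt, h1.fderiv]
  simp only [add_apply, sum_apply,
    smul_apply, smul_eq_mul, pseudoGrad, ← hg.partialAt_H _ i y, partialAt]

/-- The gradient inequality for the convex constraints. -/
lemma Regular.gradient_ineq (hg : g.Regular n) (j : Fin l) (w y : Fin N → ℝ) :
    ∑ i, partialAt (g.G j) i y * (w i - y i) ≤ g.G j w - g.G j y := by
  have hconv : ConvexOn ℝ Set.univ (fun s : ℝ => g.G j (AffineMap.lineMap y w s)) := by
    have := (hg.convex_G j).comp_affineMap (AffineMap.lineMap y w)
    exact this
  have hline : HasDerivAt (fun s : ℝ => AffineMap.lineMap y w s) (w - y) (0 : ℝ) := by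
    simpa using (AffineMap.hasDerivAt_lineMap (a := y) (b := w) (x := (0 : ℝ)))
  have hd : HasDerivAt (fun s : ℝ => g.G j (AffineMap.lineMap y w s))
      (fderiv ℝ (g.G j) y (w - y)) 0 := by
    have h1 : HasFDerivAt (g.G j) (fderiv ℝ (g.G j) y) (AffineMap.lineMap y w (0 : ℝ)) := by
      simpa using (hg.differentiable_G j y).hasFDerivAt
    exact h1.comp_hasDerivAt (0 : ℝ) hline
  have h2 := hconv.le_slope_of_hasDerivAt (Set.mem_univ 0) (Set.mem_univ 1) one_pos hd
  rw [clm_apply_eq_sum] at h2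
  simpa [slope_def_field, partialAt] using h2

/-- Karush–Kuhn–Tucker multipliers for a point `ys`. -/
structure IsKKT (g : SharedGame N m l) (ys : Fin N → ℝ) (lams : Fin m → ℝ) (mus : Fin l → ℝ) :
    Prop where
  eq_zero : ∀ j, g.H j ys = 0
  le_zero : ∀ j, g.G j ys ≤ 0
  nonneg : ∀ j, 0 ≤ mus j
  slack : ∀ j, mus j * g.G j ys = 0
  stationary : ∀ i, g.gradL i lams mus ys = 0

/-- Under Slater's condition, a solution of the variational inequality is a
Karush–Kuhn–Tucker point. -/
lemma SolvesVI.exists_isKKT (hg : g.Regular n) (hSlater : g.Slater)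
    {ys : Fin N → ℝ} (hys : g.SolvesVI ys) : ∃ lams mus, g.IsKKT ys lams mus := by
  obtain ⟨mus, hmus, hmin⟩ := hys.exists_inequality_multiplier hg hSlater
  have hslack : ∀ j, mus j * g.G j ys = 0 := by
    have h1 := hmin ys hys.1.1
    simp only [sub_self, zero_mul, Finset.sum_const_zero, zero_add] at h1
    have h2 : ∀ j ∈ Finset.univ, mus j * g.G j ys ≤ 0 := fun j _ =>
      mul_nonpos_of_nonneg_of_nonpos (hmus j) (hys.1.2 j)
    have h3 := (Finset.sum_eq_zero_iff_of_nonpos h2).1 (le_antisymm (Finset.sum_nonpos h2) h1)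
    exact fun j => h3 j (Finset.mem_univ j)
  set K : (Fin N → ℝ) →ₗ[ℝ] ℝ := ∑ i, (g.pseudoGrad ys i + ∑ j, mus j * partialAt (g.G j) i ys) •
    LinearMap.proj i with hK
  set L : Fin m → (Fin N → ℝ) →ₗ[ℝ] ℝ := fun j => ∑ i, g.slopeH j i • LinearMap.proj i with hL
  have hKa : ∀ v, K v = ∑ i, (g.pseudoGrad ys i + ∑ j, mus j * partialAt (g.G j) i ys) * v i := by
    intro v; simp [hK]
  have hLa : ∀ j v, L j v = ∑ i, g.slopeH j i * v i := by
    intro j v; simp [hL]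
  have hker : ⨅ j, LinearMap.ker (L j) ≤ LinearMap.ker K := by
    intro v hv
    rw [Submodule.mem_iInf] at hv
    rw [LinearMap.mem_ker]
    have hfeas : ∀ s : ℝ, ∀ j, g.H j (ys + s • v) = 0 := by
      intro s j
      have h1 := hg.H_sub j (ys + s • v) ys
      have h2 : L j v = 0 := hv j
      rw [hLa] at h2
      simp only [Pi.add_apply, Pi.smul_apply, smul_eq_mul, add_sub_cancel_left] at h1
      have h3 : ∑ i, g.slopeH j i * (s * v i) = s * ∑ i, g.slopeH j i * v i := by
        rw [Finset.mul_sum]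
        exact Finset.sum_congr rfl fun i _ => by ring
      rw [h3, h2, hys.1.1 j] at h1
      linarith
    set ψ : ℝ → ℝ := fun s => ∑ i, ((ys + s • v) i - ys i) * g.pseudoGrad ys i +
      ∑ j, mus j * g.G j (ys + s • v) with hψ
    have hψ0 : ψ 0 = 0 := by simp [hψ, hslack]
    have hlm : IsLocalMin ψ 0 := Eventually.of_forall fun s => by
      rw [hψ0]; exact hmin _ (hfeas s)
    have hline : HasDerivAt (fun s : ℝ => ys + s • v) v 0 := by
      simpa using ((hasDerivAt_id (0 : ℝ)).smul_const v).const_add ys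
    have hd : HasDerivAt ψ (∑ i, v i * g.pseudoGrad ys i +
        ∑ j, mus j * fderiv ℝ (g.G j) ys v) 0 := by
      refine (HasDerivAt.fun_sum fun i _ => ?_).add (HasDerivAt.fun_sum fun j _ => ?_)
      · exact (((hasDerivAt_pi.1 hline) i).sub_const _).mul_const _
      · have h1 : HasFDerivAt (g.G j) (fderiv ℝ (g.G j) ys) (ys + (0 : ℝ) • v) := by
          simpa using (hg.differentiable_G j ys).hasFDerivAt
        exact (h1.comp_hasDerivAt (0 : ℝ) hline).const_mul _
    have h0 := hlm.hasDerivAt_eq_zero hd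
    rw [hKa, ← h0]
    simp only [add_mul, Finset.sum_add_distrib, clm_apply_eq_sum (fderiv ℝ _ ys) v]
    congr 1
    · exact Finset.sum_congr rfl fun i _ => mul_comm _ _
    · simp only [Finset.sum_mul, Finset.mul_sum]
      rw [Finset.sum_comm]
      exact Finset.sum_congr rfl fun j _ => Finset.sum_congr rfl fun i _ => by
        rw [partialAt]; ring
  obtain ⟨c, hc⟩ := (Submodule.mem_span_range_iff_exists_fun ℝ).1 (mem_span_of_iInf_ker_le_ker hker)
  refine ⟨fun j => -c j, mus, hys.1.1, hys.1.2, hmus, hslack, fun i => ?_⟩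
  have h1 : (∑ j, c j • L j) (Pi.single i 1) = K (Pi.single i 1) := by rw [hc]
  rw [hKa, LinearMap.sum_apply] at h1
  simp only [LinearMap.smul_apply, hLa, smul_eq_mul, Pi.single_apply, mul_ite, mul_one, mul_zero,
    Finset.sum_ite_eq', Finset.mem_univ, if_true] at h1
  rw [hg.gradL_eq]
  simp only [neg_mul, Finset.sum_neg_distrib]
  linarith

end

end SharedGame

/-- The rate of change of a multiplier `μ ≥ 0` that is driven by `v` and kept nonnegative. -/
noncomputable def projRate (μ v : ℝ) : ℝ := if 0 < μ then v else max v 0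

lemma projRate_mul_le {μ μs v : ℝ} (hμ : 0 ≤ μ) (hs : 0 ≤ μs) :
    (μ - μs) * projRate μ v ≤ (μ - μs) * v := by
  unfold projRate
  split_ifs with h
  · exact le_rfl
  · have h0 : μ = 0 := le_antisymm (not_lt.1 h) hμ
    subst h0
    nlinarith [le_max_left v 0]

lemma abs_projRate_le (μ v : ℝ) : |projRate μ v| ≤ |v| := by
  unfold projRate
  split_ifs
  · exact le_rfl
  · rw [abs_of_nonneg (le_max_right v 0)]
    exact max_le (le_abs_self v) (abs_nonneg v)

lemma projRate_mul {θ : ℝ} (hθ : 0 ≤ θ) (μ v : ℝ) : projRate μ (θ * v) = θ * projRate μ v := by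
  unfold projRate
  split_ifs
  · rfl
  · rw [mul_max_of_nonneg _ _ hθ, mul_zero]

namespace SharedGame

variable {N m l n : ℕ} [NeZero n] {g : SharedGame N m l}

/-- Dissipation of the primal-dual flow. -/
lemma IsKKT.dissipation (hg : g.Regular n) {M : ℝ} (hmono : g.StronglyMonotone M)
    {ys : Fin N → ℝ} {lams : Fin m → ℝ} {mus : Fin l → ℝ} (hK : g.IsKKT ys lams mus)
    (y : Fin N → ℝ) (lam : Fin m → ℝ) (mu : Fin l → ℝ) (hmu : ∀ j, 0 ≤ mu j) :
    -∑ i, (y i - ys i) * g.gradL i lam mu y + ∑ j, (lam j - lams j) * g.H j y +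
      ∑ j, (mu j - mus j) * projRate (mu j) (g.G j y) ≤ -(M * ∑ i, (y i - ys i) ^ 2) := by
  have h1 : ∑ j, (mu j - mus j) * projRate (mu j) (g.G j y) ≤
      ∑ j, (mu j - mus j) * g.G j y :=
    Finset.sum_le_sum fun j _ => projRate_mul_le (hmu j) (hK.nonneg j)
  have h2 := hmono y ys
  have h3 : ∀ j, g.H j y = ∑ i, g.slopeH j i * (y i - ys i) := fun j => by
    rw [← hg.H_sub, hK.eq_zero, sub_zero]
  have hst : ∑ i, (y i - ys i) * g.gradL i lams mus ys = 0 :=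
    Finset.sum_eq_zero fun i _ => by rw [hK.stationary, mul_zero]
  have hexp : ∀ (la : Fin m → ℝ) (mm : Fin l → ℝ) (p : Fin N → ℝ),
      ∑ i, (y i - ys i) * g.gradL i la mm p = ∑ i, (y i - ys i) * g.pseudoGrad p i +
        ∑ j, la j * g.H j y + ∑ j, mm j * ∑ i, partialAt (g.G j) i p * (y i - ys i) := by
    intro la mm p
    simp only [hg.gradL_eq, mul_add, Finset.sum_add_distrib, h3]
    congr 1
    · congr 1
      simp only [Finset.mul_sum]
      rw [Finset.sum_comm]
      exact Finset.sum_congr rfl fun j _ => Finset.sum_congr rfl fun i _ => by ring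
    · simp only [Finset.mul_sum]
      rw [Finset.sum_comm]
      exact Finset.sum_congr rfl fun j _ => Finset.sum_congr rfl fun i _ => by ring
  rw [hexp] at hst
  rw [hexp]
  have h4 : ∑ j, mus j * ∑ i, partialAt (g.G j) i ys * (y i - ys i) ≤ ∑ j, mus j * g.G j y := by
    refine Finset.sum_le_sum fun j _ => ?_
    have e1 := mul_le_mul_of_nonneg_left (hg.gradient_ineq j y ys) (hK.nonneg j)
    rw [mul_sub, hK.slack, sub_zero] at e1
    exact e1
  have h5 : ∑ j, mu j * g.G j y ≤ ∑ j, mu j * ∑ i, partialAt (g.G j) i y * (y i - ys i) := by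
    refine Finset.sum_le_sum fun j _ => ?_
    have e1 := mul_le_mul_of_nonneg_left (hg.gradient_ineq j ys y) (hmu j)
    have e2 : ∑ i, partialAt (g.G j) i y * (ys i - y i) =
        -∑ i, partialAt (g.G j) i y * (y i - ys i) := by
      rw [← Finset.sum_neg_distrib]
      exact Finset.sum_congr rfl fun i _ => by ring
    rw [e2] at e1
    have e3 := mul_nonpos_of_nonneg_of_nonpos (hmu j) (hK.le_zero j)
    nlinarith
  simp only [mul_sub, sub_mul, Finset.sum_sub_distrib] at h1 h2 h4 h5 hst ⊢
  linarith

end SharedGame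

lemma sum_mul_shift_le {n : ℕ} (e : Fin n → ℝ) :
    ∑ ℓ, e ℓ * (if h : ℓ.val + 1 < n then e ⟨ℓ.val + 1, h⟩ else 0) ≤ ∑ ℓ, e ℓ ^ 2 := by
  set E : ℕ → ℝ := fun p => if h : p < n then e ⟨p, h⟩ else 0 with hE
  have h1 : ∀ F : ℕ → ℝ → ℝ, ∑ ℓ : Fin n, F ℓ.val (e ℓ) = ∑ p ∈ Finset.range n, F p (E p) := by
    intro F
    rw [Finset.sum_range]
    exact Finset.sum_congr rfl fun p _ => by simp [hE]
  have h2 : ∑ ℓ, e ℓ * (if h : ℓ.val + 1 < n then e ⟨ℓ.val + 1, h⟩ else 0) =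
      ∑ p ∈ Finset.range n, E p * E (p + 1) := h1 fun p v => v * E (p + 1)
  have h3 := h1 fun _ v => v ^ 2
  rw [h2, h3]
  have h4 : ∑ p ∈ Finset.range n, E p * E (p + 1) ≤
      ∑ p ∈ Finset.range n, (E p ^ 2 / 2 + E (p + 1) ^ 2 / 2) :=
    Finset.sum_le_sum fun p _ => by nlinarith [sq_nonneg (E p - E (p + 1))]
  have h5 : ∑ p ∈ Finset.range n, E (p + 1) ^ 2 + E 0 ^ 2 =
      ∑ p ∈ Finset.range n, E p ^ 2 + E n ^ 2 := by
    rw [← Finset.sum_range_succ' (fun p => E p ^ 2) n, Finset.sum_range_succ]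
  have h6 : E n = 0 := by simp [hE]
  rw [Finset.sum_add_distrib, ← Finset.sum_div, ← Finset.sum_div] at h4
  rw [h6] at h5
  nlinarith [sq_nonneg (E 0)]

/-- The equilibrium of the transformed state. -/
noncomputable def zeq {N n : ℕ} [NeZero n] (ys : Fin N → ℝ) : Fin n → Fin N → ℝ := fun ℓ => if ℓ = 0 then ys else 0

/-- The squared distance to an equilibrium decreases along the transformed flow at least at the
rate `2 c` times the squared distance of the state `z`. -/
def Dissipative {N m l n : ℕ} [NeZero n] (g : SharedGame N m l) (k₁ : ℝ) (k : Fin N → Fin n → ℝ)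
    (c : ℝ) (ys : Fin N → ℝ) (lams : Fin m → ℝ) (mus : Fin l → ℝ) : Prop :=
  ∀ (z : Fin n → Fin N → ℝ) (lam : Fin m → ℝ) (mu : Fin l → ℝ), (∀ j, 0 ≤ mu j) →
    ∑ ℓ, ∑ i, (z ℓ i - zeq ys ℓ i) * transformedRhs g k₁ k z lam mu ℓ i +
      ∑ j, (lam j - lams j) * (k₁ * g.H j (z 0)) +
      ∑ j, (mu j - mus j) * projRate (mu j) (k₁ * g.G j (z 0)) ≤
    -(c * ∑ ℓ, ∑ i, (z ℓ i - zeq ys ℓ i) ^ 2)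

lemma SharedGame.IsKKT.dissipative {N m l n : ℕ} [NeZero n] {g : SharedGame N m l} {M k₁ c : ℝ}
    {k : Fin N → Fin n → ℝ} (hg : g.Regular n) (hmono : g.StronglyMonotone M) (hk0 : 0 ≤ k₁)
    (hc1 : 1 + c ≤ k₁ * M) (hc : ∀ i (ℓ : Fin n), 1 ≤ ℓ.val → 1 + c ≤ k i ℓ)
    {ys : Fin N → ℝ} {lams : Fin m → ℝ} {mus : Fin l → ℝ} (hK : g.IsKKT ys lams mus) :
    Dissipative g k₁ k c ys lams mus := by
  intro z lam mu hmu
  set e : Fin n → Fin N → ℝ := fun ℓ i => z ℓ i - zeq ys ℓ i with he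
  have hd := mul_le_mul_of_nonneg_left (hK.dissipation hg hmono (z 0) lam mu hmu) hk0
  have hshift : ∀ (ℓ : Fin n) i, (if h : ℓ.val + 1 < n then z ⟨ℓ.val + 1, h⟩ i else 0) =
      (if h : ℓ.val + 1 < n then e ⟨ℓ.val + 1, h⟩ i else 0) := by
    intro ℓ i
    split_ifs with h
    · have : (⟨ℓ.val + 1, h⟩ : Fin n) ≠ 0 := by
        intro h0
        have := congrArg Fin.val h0
        simp at this
      simp [he, zeq, this]
    · rfl
  have h1 : ∀ i, ∑ ℓ, e ℓ i * (if h : ℓ.val + 1 < n then e ⟨ℓ.val + 1, h⟩ i else 0) ≤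
      ∑ ℓ, e ℓ i ^ 2 := fun i => sum_mul_shift_le fun ℓ => e ℓ i
  have hsplit : ∑ ℓ, ∑ i, e ℓ i * transformedRhs g k₁ k z lam mu ℓ i =
      ∑ ℓ, ∑ i, e ℓ i * (if ℓ = 0 then -k₁ * g.gradL i lam mu (z 0) else -k i ℓ * z ℓ i) +
      ∑ i, ∑ ℓ, e ℓ i * (if h : ℓ.val + 1 < n then e ⟨ℓ.val + 1, h⟩ i else 0) := by
    rw [Finset.sum_comm (s := (Finset.univ : Finset (Fin N))), ← Finset.sum_add_distrib]
    refine Finset.sum_congr rfl fun ℓ _ => ?_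
    rw [← Finset.sum_add_distrib]
    refine Finset.sum_congr rfl fun i _ => ?_
    rw [transformedRhs, hshift, mul_add]
  have h2 : ∑ i, ∑ ℓ, e ℓ i * (if h : ℓ.val + 1 < n then e ⟨ℓ.val + 1, h⟩ i else 0) ≤
      ∑ ℓ, ∑ i, e ℓ i ^ 2 := by
    rw [Finset.sum_comm (f := fun ℓ i => e ℓ i ^ 2)]
    exact Finset.sum_le_sum fun i _ => h1 i
  have hsep : ∀ F : Fin n → ℝ, ∑ ℓ, F ℓ = F 0 + ∑ ℓ ∈ Finset.univ.erase 0, F ℓ := fun F =>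
    (Finset.add_sum_erase _ _ (Finset.mem_univ 0)).symm
  have e0 : ∀ i, e 0 i = z 0 i - ys i := fun i => by simp [he, zeq]
  have h3 : ∑ ℓ, ∑ i, e ℓ i * (if ℓ = 0 then -k₁ * g.gradL i lam mu (z 0) else -k i ℓ * z ℓ i) ≤
      k₁ * -∑ i, (z 0 i - ys i) * g.gradL i lam mu (z 0) +
        -((1 + c) * ∑ ℓ ∈ Finset.univ.erase 0, ∑ i, e ℓ i ^ 2) := by
    rw [hsep]
    refine add_le_add (le_of_eq ?_) ?_
    · rw [← Finset.sum_neg_distrib, Finset.mul_sum]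
      exact Finset.sum_congr rfl fun i _ => by rw [if_pos rfl, e0]; ring
    · rw [Finset.mul_sum, ← Finset.sum_neg_distrib]
      refine Finset.sum_le_sum fun ℓ hℓ => ?_
      have hne : ℓ ≠ 0 := Finset.ne_of_mem_erase hℓ
      have hpos : 1 ≤ ℓ.val := Nat.one_le_iff_ne_zero.2 fun h => hne (Fin.ext (by simpa using h))
      rw [Finset.mul_sum, ← Finset.sum_neg_distrib]
      refine Finset.sum_le_sum fun i _ => ?_
      have e1 : e ℓ i = z ℓ i := by simp [he, zeq, hne]
      rw [if_neg hne, e1]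
      nlinarith [mul_le_mul_of_nonneg_right (hc i ℓ hpos) (sq_nonneg (z ℓ i))]
  have h4 := hsep fun ℓ => ∑ i, e ℓ i ^ 2
  simp only [e0] at h4
  have h5 : (1 + c) * ∑ i, (z 0 i - ys i) ^ 2 ≤ k₁ * M * ∑ i, (z 0 i - ys i) ^ 2 :=
    mul_le_mul_of_nonneg_right hc1 (Finset.sum_nonneg fun i _ => sq_nonneg _)
  have h6 : ∑ j, (lam j - lams j) * (k₁ * g.H j (z 0)) =
      k₁ * ∑ j, (lam j - lams j) * g.H j (z 0) := by
    rw [Finset.mul_sum]; exact Finset.sum_congr rfl fun j _ => by ring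
  have h7 : ∑ j, (mu j - mus j) * projRate (mu j) (k₁ * g.G j (z 0)) =
      k₁ * ∑ j, (mu j - mus j) * projRate (mu j) (g.G j (z 0)) := by
    rw [Finset.mul_sum]
    exact Finset.sum_congr rfl fun j _ => by rw [projRate_mul hk0]; ring
  rw [hsplit, h6, h7]
  rw [h4] at h2 ⊢
  nlinarith

/-! ### Projection onto the nonnegative orthant -/

lemma isPointProjection_nonnegOrthant {l : ℕ} {y p : Fin l → ℝ}
    (hp : IsPointProjection (nonnegOrthant l) y p) (j : Fin l) : p j = max (y j) 0 := by
  have hle : ∀ j, (max (y j) 0 - y j) ^ 2 ≤ (p j - y j) ^ 2 := by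
    intro j
    have := hp.1 j
    rcases le_total 0 (y j) with h | h
    · rw [max_eq_left h]; nlinarith [sq_nonneg (p j - y j)]
    · rw [max_eq_right h]; nlinarith
  have hq := hp.2 (fun j => max (y j) 0) fun j => le_max_right _ _
  have heq : ∑ j, (max (y j) 0 - y j) ^ 2 = ∑ j, (p j - y j) ^ 2 :=
    le_antisymm (Finset.sum_le_sum fun j _ => hle j) hq
  have h1 := (Finset.sum_eq_sum_iff_of_le fun j _ => hle j).1 heq j (Finset.mem_univ j)
  have h2 := hp.1 j
  rcases le_total 0 (y j) with h | h
  · rw [max_eq_left h] at h1 ⊢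
    have : (p j - y j) ^ 2 = 0 := by rw [← h1]; ring
    have := pow_eq_zero_iff (two_ne_zero) |>.1 this
    linarith
  · rw [max_eq_right h] at h1 ⊢
    have : p j * (p j - 2 * y j) = 0 := by nlinarith
    rcases mul_eq_zero.1 this with h3 | h3
    · exact h3
    · linarith

lemma tendsto_projRate {μ : ℝ} (hμ : 0 ≤ μ) (v : ℝ) :
    Tendsto (fun δ : ℝ => δ⁻¹ * (max (μ + δ * v) 0 - μ)) (𝓝[>] 0) (𝓝 (projRate μ v)) := by
  refine tendsto_const_nhds.congr' ?_
  unfold projRate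
  split_ifs with h
  · have h1 : ∀ᶠ δ : ℝ in 𝓝[>] 0, 0 < μ + δ * v := by
      have : Tendsto (fun δ : ℝ => μ + δ * v) (𝓝[>] 0) (𝓝 (μ + 0 * v)) :=
        tendsto_nhdsWithin_of_tendsto_nhds
          ((continuous_const.add (continuous_id.mul continuous_const)).tendsto 0)
      exact this.eventually (lt_mem_nhds (by simpa using h))
    filter_upwards [h1, self_mem_nhdsWithin] with δ h2 (h3 : 0 < δ)
    rw [max_eq_left h2.le]
    field_simp
    ring
  · have h0 : μ = 0 := le_antisymm (not_lt.1 h) hμ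
    subst h0
    filter_upwards [self_mem_nhdsWithin] with δ (h3 : 0 < δ)
    have : max (0 + δ * v) 0 = δ * max v 0 := by
      rw [mul_max_of_nonneg _ _ h3.le, mul_zero, zero_add]
    rw [this]
    field_simp
    ring

lemma IsVectorProjection.eq_projRate {l : ℕ} {μ v w : Fin l → ℝ} (hμ : μ ∈ nonnegOrthant l)
    (hw : IsVectorProjection (nonnegOrthant l) μ v w) (j : Fin l) :
    w j = projRate (μ j) (v j) := by
  obtain ⟨P, hP, hlim⟩ := hw
  refine tendsto_nhds_unique ((tendsto_pi_nhds.1 hlim) j) ((tendsto_projRate (hμ j) (v j)).congr' ?_)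
  filter_upwards [self_mem_nhdsWithin] with δ hδ
  simp [isPointProjection_nonnegOrthant (hP δ hδ) j]

lemma isVectorProjection_projRate {l : ℕ} {μ : Fin l → ℝ} (hμ : μ ∈ nonnegOrthant l)
    (v : Fin l → ℝ) :
    IsVectorProjection (nonnegOrthant l) μ v (fun j => projRate (μ j) (v j)) := by
  refine ⟨fun δ j => max (μ j + δ * v j) 0, fun δ _ => ⟨fun j => le_max_right _ _, fun q hq => ?_⟩,
    tendsto_pi_nhds.2 fun j => ?_⟩
  · refine Finset.sum_le_sum fun j _ => ?_
    have := hq j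
    simp only [Pi.add_apply, Pi.smul_apply, smul_eq_mul]
    rcases le_total 0 (μ j + δ * v j) with h | h
    · rw [max_eq_left h]; nlinarith [sq_nonneg (q j - (μ j + δ * v j))]
    · rw [max_eq_right h]; nlinarith
  · simpa using tendsto_projRate (hμ j) (v j)

/-! ### Local Lipschitz continuity -/

namespace LocallyLipschitz

variable {α : Type*} [PseudoEMetricSpace α] {f₁ f₂ : α → ℝ}

lemma mul_real (h₁ : LocallyLipschitz f₁) (h₂ : LocallyLipschitz f₂) :
    LocallyLipschitz (fun p => f₁ p * f₂ p) := by
  have h : LocallyLipschitz (fun p : ℝ × ℝ => p.1 * p.2) :=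
    (contDiff_fst.mul contDiff_snd : ContDiff ℝ 1 _).locallyLipschitz
  exact h.comp (h₁.prodMk h₂)

lemma add_real (h₁ : LocallyLipschitz f₁) (h₂ : LocallyLipschitz f₂) :
    LocallyLipschitz (fun p => f₁ p + f₂ p) := by
  have h : LocallyLipschitz (fun p : ℝ × ℝ => p.1 + p.2) :=
    (contDiff_fst.add contDiff_snd : ContDiff ℝ 1 _).locallyLipschitz
  exact h.comp (h₁.prodMk h₂)

lemma sum_real {ι : Type*} (s : Finset ι) {f : ι → α → ℝ} (hf : ∀ i ∈ s, LocallyLipschitz (f i)) :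
    LocallyLipschitz (fun p => ∑ i ∈ s, f i p) := by
  classical
  induction s using Finset.induction_on with
  | empty => simpa using LocallyLipschitz.const (0 : ℝ)
  | insert i s hi ih =>
    simp only [Finset.sum_insert hi]
    exact (hf i (by simp)).add_real (ih fun j hj => hf j (by simp [hj]))

end LocallyLipschitz

/-- States of the transformed system. -/
abbrev State (N m l n : ℕ) := (Fin n → Fin N → ℝ) × (Fin m → ℝ) × (Fin l → ℝ)

lemma norm_state_le {N m l n : ℕ} {p : State N m l n} {B : ℝ} (hB : 0 ≤ B) (h1 : ∀ ℓ i, |p.1 ℓ i| ≤ B)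
    (h2 : ∀ j, |p.2.1 j| ≤ B) (h3 : ∀ j, |p.2.2 j| ≤ B) : ‖p‖ ≤ B := by
  refine max_le ?_ (max_le ?_ ?_)
  · exact (pi_norm_le_iff_of_nonneg hB).2 fun ℓ => (pi_norm_le_iff_of_nonneg hB).2 fun i => h1 ℓ i
  · exact (pi_norm_le_iff_of_nonneg hB).2 fun j => h2 j
  · exact (pi_norm_le_iff_of_nonneg hB).2 fun j => h3 j

section Fields

variable {N m l n : ℕ}

lemma locallyLipschitz_eval (ℓ : Fin n) (i : Fin N) :
    LocallyLipschitz (fun p : State N m l n => p.1 ℓ i) :=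
  ((LipschitzWith.eval i).comp ((LipschitzWith.eval ℓ).comp LipschitzWith.prod_fst)).locallyLipschitz

lemma locallyLipschitz_block (ℓ : Fin n) :
    LocallyLipschitz (fun p : State N m l n => p.1 ℓ) :=
  ((LipschitzWith.eval ℓ).comp LipschitzWith.prod_fst).locallyLipschitz

lemma locallyLipschitz_lam (j : Fin m) :
    LocallyLipschitz (fun p : State N m l n => p.2.1 j) :=
  ((LipschitzWith.eval j).comp (LipschitzWith.prod_fst.comp LipschitzWith.prod_snd)).locallyLipschitz

lemma locallyLipschitz_mu (j : Fin l) :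
    LocallyLipschitz (fun p : State N m l n => p.2.2 j) :=
  ((LipschitzWith.eval j).comp (LipschitzWith.prod_snd.comp LipschitzWith.prod_snd)).locallyLipschitz

variable [NeZero n] {g : SharedGame N m l} {k₁ : ℝ} {k : Fin N → Fin n → ℝ}

lemma locallyLipschitz_gradL (hg : g.Regular n) (i : Fin N) :
    LocallyLipschitz (fun p : State N m l n => g.gradL i p.2.1 p.2.2 (p.1 0)) := by
  simp only [hg.gradL_eq]
  refine LocallyLipschitz.add_real (LocallyLipschitz.add_real ?_
    (LocallyLipschitz.sum_real _ fun j _ => ?_)) (LocallyLipschitz.sum_real _ fun j _ => ?_)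
  · exact (LipschitzWith.eval i).locallyLipschitz.comp
      (hg.lipschitz_f.comp (locallyLipschitz_block 0))
  · exact (locallyLipschitz_lam j).mul_real (LocallyLipschitz.const _)
  · exact (locallyLipschitz_mu j).mul_real ((LipschitzWith.eval i).locallyLipschitz.comp
      ((hg.lipschitz_G j).comp (locallyLipschitz_block 0)))

lemma locallyLipschitz_transformedRhs (hg : g.Regular n) (ℓ : Fin n) (i : Fin N) :
    LocallyLipschitz (fun p : State N m l n => transformedRhs g k₁ k p.1 p.2.1 p.2.2 ℓ i) := by
  unfold transformedRhs
  refine LocallyLipschitz.add_real ?_ ?_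
  · by_cases h : ℓ = 0
    · simp only [h, if_true]
      exact (LocallyLipschitz.const _).mul_real (locallyLipschitz_gradL hg i)
    · simp only [h, if_false]
      exact (LocallyLipschitz.const _).mul_real (locallyLipschitz_eval ℓ i)
  · by_cases h : ℓ.val + 1 < n
    · simp only [h, dif_pos]
      exact locallyLipschitz_eval _ i
    · simp only [h, dif_neg, not_false_eq_true]
      exact LocallyLipschitz.const _

lemma locallyLipschitz_H (hg : g.Regular n) (j : Fin m) :
    LocallyLipschitz (fun p : State N m l n => k₁ * g.H j (p.1 0)) :=
  (LocallyLipschitz.const _).mul_real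
    ((hg.contDiff_H j (r := 1)).locallyLipschitz.comp (locallyLipschitz_block 0))

lemma locallyLipschitz_G (hg : g.Regular n) (j : Fin l) :
    LocallyLipschitz (fun p : State N m l n => k₁ * g.G j (p.1 0)) :=
  (LocallyLipschitz.const _).mul_real
    (((hg.smooth_G j).of_le SharedGame.one_le_cast).locallyLipschitz.comp
      (locallyLipschitz_block 0))

end Fields

/-! ### Solutions of the transformed system -/

section Solutions

variable {N m l n : ℕ} [NeZero n] (g : SharedGame N m l) (k₁ : ℝ) (k : Fin N → Fin n → ℝ)

/-- Solutions of the transformed system with time scaled by the factor `θ`. -/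
structure IsScaledSolution (θ : ℝ → ℝ) (z : ℝ → Fin n → Fin N → ℝ) (lam : ℝ → Fin m → ℝ)
    (mu : ℝ → Fin l → ℝ) : Prop where
  nonneg : ∀ t, 0 ≤ t → 0 ≤ θ t
  z_ac : ∀ ℓ i, LocallyAC (fun t => z t ℓ i)
  lam_ac : ∀ j, LocallyAC (fun t => lam t j)
  mu_ac : ∀ j, LocallyAC (fun t => mu t j)
  mu_nonneg : ∀ t, 0 ≤ t → ∀ j, 0 ≤ mu t j
  z_ode : ∀ᵐ t ∂(volume.restrict (Set.Ioi (0 : ℝ))), ∀ ℓ i,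
    HasDerivAt (fun s => z s ℓ i) (θ t * transformedRhs g k₁ k (z t) (lam t) (mu t) ℓ i) t
  lam_ode : ∀ᵐ t ∂(volume.restrict (Set.Ioi (0 : ℝ))), ∀ j,
    HasDerivAt (fun s => lam s j) (θ t * (k₁ * g.H j (z t 0))) t
  mu_ode : ∀ᵐ t ∂(volume.restrict (Set.Ioi (0 : ℝ))), ∀ j,
    HasDerivAt (fun s => mu s j) (θ t * projRate (mu t j) (k₁ * g.G j (z t 0))) t

variable {g k₁ k} {θ : ℝ → ℝ} {z : ℝ → Fin n → Fin N → ℝ} {lam : ℝ → Fin m → ℝ}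
  {mu : ℝ → Fin l → ℝ}

lemma IsTransformedSolution.scaled (h : IsTransformedSolution g k₁ k z lam mu) :
    IsScaledSolution g k₁ k (fun _ => 1) z lam mu where
  nonneg _ _ := zero_le_one
  z_ac := h.z_ac
  lam_ac := h.dual.lam_ac
  mu_ac := h.dual.mu_ac
  mu_nonneg := h.dual.mu_mem
  z_ode := by simpa only [one_mul] using h.z_ode
  lam_ode := by simpa only [one_mul] using h.dual.lam_ode
  mu_ode := by
    filter_upwards [h.dual.mu_ode, ae_restrict_mem measurableSet_Ioi] with t ht (h0 : 0 < t) j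
    obtain ⟨w, hw, hd⟩ := ht
    rw [one_mul, ← hw.eq_projRate (h.dual.mu_mem t h0.le) j]
    exact hasDerivAt_pi.1 hd j

lemma IsScaledSolution.transformed (h : IsScaledSolution g k₁ k θ z lam mu)
    (hθ : ∀ t, 0 ≤ t → θ t = 1) : IsTransformedSolution g k₁ k z lam mu where
  z_ac := h.z_ac
  z_ode := by
    filter_upwards [h.z_ode, ae_restrict_mem measurableSet_Ioi] with t ht (h0 : 0 < t)
    simpa only [hθ t h0.le, one_mul] using ht
  dual :=
    { lam_ac := h.lam_ac
      mu_ac := h.mu_ac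
      mu_mem := h.mu_nonneg
      lam_ode := by
        filter_upwards [h.lam_ode, ae_restrict_mem measurableSet_Ioi] with t ht (h0 : 0 < t)
        simpa only [hθ t h0.le, one_mul] using ht
      mu_ode := by
        filter_upwards [h.mu_ode, ae_restrict_mem measurableSet_Ioi] with t ht (h0 : 0 < t)
        refine ⟨_, isVectorProjection_projRate (h.mu_nonneg t h0.le) _, hasDerivAt_pi.2 fun j => ?_⟩
        simpa only [hθ t h0.le, one_mul] using ht j }

/-- Squared distance to the equilibrium of the state `z`. -/
noncomputable def zdist (ys : Fin N → ℝ) (z : Fin n → Fin N → ℝ) : ℝ :=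
  ∑ ℓ, ∑ i, (z ℓ i - zeq ys ℓ i) ^ 2

/-- Squared distance to the equilibrium. -/
noncomputable def energy (ys : Fin N → ℝ) (lams : Fin m → ℝ) (mus : Fin l → ℝ)
    (p : State N m l n) : ℝ :=
  zdist ys p.1 + ∑ j, (p.2.1 j - lams j) ^ 2 + ∑ j, (p.2.2 j - mus j) ^ 2

lemma zdist_nonneg (ys : Fin N → ℝ) (z : Fin n → Fin N → ℝ) : 0 ≤ zdist ys z :=
  Finset.sum_nonneg fun _ _ => Finset.sum_nonneg fun _ _ => sq_nonneg _

variable {ys : Fin N → ℝ} {lams : Fin m → ℝ} {mus : Fin l → ℝ}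

lemma zdist_le_energy (p : State N m l n) : zdist ys p.1 ≤ energy ys lams mus p := by
  have h1 : 0 ≤ ∑ j, (p.2.1 j - lams j) ^ 2 := Finset.sum_nonneg fun _ _ => sq_nonneg _
  have h2 : 0 ≤ ∑ j, (p.2.2 j - mus j) ^ 2 := Finset.sum_nonneg fun _ _ => sq_nonneg _
  unfold energy
  linarith

lemma energy_nonneg (p : State N m l n) : 0 ≤ energy ys lams mus p :=
  (zdist_nonneg ys p.1).trans (zdist_le_energy p)

lemma sq_le_zdist (z : Fin n → Fin N → ℝ) (ℓ : Fin n) (i : Fin N) :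
    (z ℓ i - zeq ys ℓ i) ^ 2 ≤ zdist ys z :=
  (Finset.single_le_sum (f := fun i => (z ℓ i - zeq ys ℓ i) ^ 2) (fun _ _ => sq_nonneg _)
    (Finset.mem_univ i)).trans
  (Finset.single_le_sum (f := fun ℓ => ∑ i, (z ℓ i - zeq ys ℓ i) ^ 2)
    (fun _ _ => Finset.sum_nonneg fun _ _ => sq_nonneg _) (Finset.mem_univ ℓ))

lemma LocallyAC.sub_const_sq {h : ℝ → ℝ} (hh : LocallyAC h) (b : ℝ) :
    LocallyAC (fun t => (h t - b) ^ 2) := by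
  have h1 : LocallyAC (fun t => h t + -b) := hh.add (LocallyAC.const _)
  exact (h1.mul h1).congr fun t _ => by ring

lemma IsScaledSolution.energy_ac (h : IsScaledSolution g k₁ k θ z lam mu) :
    LocallyAC (fun t => energy ys lams mus (z t, lam t, mu t)) := by
  unfold energy zdist
  refine LocallyAC.add (LocallyAC.add (LocallyAC.sum _ fun ℓ _ => LocallyAC.sum _ fun i _ => ?_)
    (LocallyAC.sum _ fun j _ => ?_)) (LocallyAC.sum _ fun j _ => ?_)
  · exact (h.z_ac ℓ i).sub_const_sq _
  · exact (h.lam_ac j).sub_const_sq _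
  · exact (h.mu_ac j).sub_const_sq _

lemma IsScaledSolution.deriv_energy_le {c : ℝ} (h : IsScaledSolution g k₁ k θ z lam mu)
    (hD : Dissipative g k₁ k c ys lams mus) :
    ∀ᵐ t ∂(volume.restrict (Set.Ioi (0 : ℝ))),
      deriv (fun t => energy ys lams mus (z t, lam t, mu t)) t ≤
        -(2 * c * θ t * zdist ys (z t)) := by
  filter_upwards [h.z_ode, h.lam_ode, h.mu_ode, ae_restrict_mem measurableSet_Ioi]
    with t hz hl hm (h0 : 0 < t)
  have hsq : ∀ {f : ℝ → ℝ} {d b : ℝ}, HasDerivAt f (θ t * d) t →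
      HasDerivAt (fun s => (f s - b) ^ 2) (2 * θ t * ((f t - b) * d)) t := by
    intro f d b hf
    refine ((hf.sub_const b).fun_pow 2).congr_deriv ?_
    norm_num
    ring
  have hd : HasDerivAt (fun t => energy ys lams mus (z t, lam t, mu t))
      (∑ ℓ, ∑ i, 2 * θ t * ((z t ℓ i - zeq ys ℓ i) *
          transformedRhs g k₁ k (z t) (lam t) (mu t) ℓ i) +
        ∑ j, 2 * θ t * ((lam t j - lams j) * (k₁ * g.H j (z t 0))) +
        ∑ j, 2 * θ t * ((mu t j - mus j) * projRate (mu t j) (k₁ * g.G j (z t 0)))) t := by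
    unfold energy zdist
    refine HasDerivAt.add (HasDerivAt.add (HasDerivAt.fun_sum fun ℓ _ => HasDerivAt.fun_sum
      fun i _ => ?_) (HasDerivAt.fun_sum fun j _ => ?_)) (HasDerivAt.fun_sum fun j _ => ?_)
    · exact hsq (hz ℓ i)
    · exact hsq (hl j)
    · exact hsq (hm j)
  rw [hd.deriv]
  have h1 := mul_le_mul_of_nonneg_left (hD (z t) (lam t) (mu t) (h.mu_nonneg t h0.le))
    (mul_nonneg zero_le_two (h.nonneg t h0.le))
  simp only [← Finset.mul_sum]
  unfold zdist
  nlinarith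

lemma IsScaledSolution.energy_antitone {c : ℝ} (hc : 0 ≤ c)
    (h : IsScaledSolution g k₁ k θ z lam mu) (hD : Dissipative g k₁ k c ys lams mus) {a b : ℝ}
    (ha : 0 ≤ a) (hab : a ≤ b) :
    energy ys lams mus (z b, lam b, mu b) ≤ energy ys lams mus (z a, lam a, mu a) := by
  have := (h.energy_ac (ys := ys) (lams := lams) (mus := mus)).sub_le_of_ae_deriv_le ha hab
    (C := 0) (by
      filter_upwards [h.deriv_energy_le hD, ae_restrict_mem measurableSet_Ioi] with t ht (h0 : 0 < t) _
      refine ht.trans (neg_nonpos.2 ?_)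
      have := h.nonneg t h0.le
      have := zdist_nonneg ys (z t)
      positivity)
  linarith

/-- A Lipschitz function is small eventually if its lower bounds force the decrease of a
nonnegative function. -/
lemma tendsto_zero_of_decrease {W φ : ℝ → ℝ} {c : ℝ} {K : NNReal} (hc : 0 < c)
    (hW0 : ∀ t, 0 ≤ t → 0 ≤ W t) (hW : ∀ a b, 0 ≤ a → a ≤ b → W b ≤ W a)
    (hφ0 : ∀ t, 0 ≤ φ t) (hφ : LipschitzOnWith K φ (Set.Ici 0))
    (hdec : ∀ a b ε, 0 ≤ a → a ≤ b → (∀ t ∈ Set.Ioo a b, ε ≤ φ t) → W b ≤ W a - c * ε * (b - a)) :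
    Tendsto φ atTop (𝓝 0) := by
  have hanti : Antitone fun t => W (max t 0) := fun a b hab =>
    hW _ _ (le_max_right _ _) (max_le_max_right 0 hab)
  have hlim := tendsto_atTop_ciInf hanti ⟨0, by
    rintro _ ⟨t, rfl⟩
    exact hW0 _ (le_max_right _ _)⟩
  set L := ⨅ t, W (max t 0)
  rw [Metric.tendsto_atTop]
  intro ε hε
  set δ : ℝ := ε / (2 * (K + 1)) with hδ
  have hδ0 : 0 < δ := by positivity
  have hη : 0 < c * (ε / 2) * δ := by positivity
  have hev := hlim.eventually (gt_mem_nhds (show L < L + c * (ε / 2) * δ by linarith))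
  obtain ⟨T, hT⟩ := eventually_atTop.1 hev
  refine ⟨max T 0, fun t ht => ?_⟩
  have ht0 : 0 ≤ t := (le_max_right T 0).trans ht
  rw [Real.dist_eq, sub_zero, abs_of_nonneg (hφ0 t)]
  by_contra hcon
  push Not at hcon
  have hlow : ∀ s ∈ Set.Ioo t (t + δ), ε / 2 ≤ φ s := by
    intro s hs
    have h1 := hφ.dist_le_mul t ht0 s (ht0.trans hs.1.le)
    rw [Real.dist_eq, Real.dist_eq, abs_sub_comm t s,
      abs_of_nonneg (by linarith [hs.1] : (0 : ℝ) ≤ s - t)] at h1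
    have h2 : (K : ℝ) * (s - t) ≤ ε / 2 := by
      calc (K : ℝ) * (s - t) ≤ (K + 1) * δ := by
            have := hs.2
            have := hs.1
            exact mul_le_mul (by linarith) (by linarith) (by linarith) (by positivity)
        _ = ε / 2 := by rw [hδ]; field_simp
    have h3 := (abs_le.1 h1).2
    linarith
  have h1 := hdec t (t + δ) (ε / 2) ht0 (by linarith) hlow
  have h2 := hT t ((le_max_left T 0).trans ht)
  have h3 : L ≤ W (max (t + δ) 0) := ciInf_le ⟨0, by
    rintro _ ⟨t, rfl⟩
    exact hW0 _ (le_max_right _ _)⟩ (t + δ)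
  rw [max_eq_left ht0] at h2
  rw [max_eq_left (by linarith)] at h3
  have h4 : c * (ε / 2) * (t + δ - t) = c * (ε / 2) * δ := by ring
  linarith

/-- The derivative of a convergent function tends to zero if it is Lipschitz. -/
lemma tendsto_deriv_zero {y h : ℝ → ℝ} {b : ℝ} {K : NNReal} (hy : LocallyAC y)
    (hd : ∀ᵐ t ∂(volume.restrict (Set.Ioi (0 : ℝ))), HasDerivAt y (h t) t)
    (hh : LipschitzOnWith K h (Set.Ici 0)) (hlim : Tendsto y atTop (𝓝 b)) :
    Tendsto h atTop (𝓝 0) := by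
  rw [Metric.tendsto_atTop]
  intro ε hε
  set δ : ℝ := ε / (2 * (K + 1)) with hδ
  have hδ0 : 0 < δ := by positivity
  have hη : 0 < δ * ε / 8 := by positivity
  obtain ⟨T, hT⟩ := Metric.tendsto_atTop.1 hlim _ hη
  refine ⟨max T 0, fun t ht => ?_⟩
  have ht0 : 0 ≤ t := (le_max_right T 0).trans ht
  have htT : T ≤ t := (le_max_left T 0).trans ht
  rw [Real.dist_eq, sub_zero]
  have hac : LocallyAC (fun u => y u + (-h t) * u) :=
    hy.add ((LocallyAC.const (-h t)).mul
      (LocallyAC.of_lipschitz (K := 1) LipschitzWith.id.lipschitzOnWith))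
  have h3 := hac.abs_sub_le_of_ae (C := ε / 2) (b := t + δ) ht0 (by linarith) (by
    filter_upwards [hd] with s hs hs2
    have h4 : HasDerivAt (fun u => y u + (-h t) * u) (h s + (-h t) * 1) s :=
      hs.add ((hasDerivAt_id s).const_mul (-h t))
    rw [h4.deriv]
    have h1 := hh.dist_le_mul s (ht0.trans hs2.1.le) t ht0
    rw [Real.dist_eq, Real.dist_eq, abs_of_nonneg (by linarith [hs2.1] : (0 : ℝ) ≤ s - t)] at h1
    have h5 : h s + -h t * 1 = h s - h t := by ring
    rw [h5]
    refine h1.trans ?_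
    calc (K : ℝ) * (s - t) ≤ (K + 1) * δ := by
          have := hs2.2
          have := hs2.1
          exact mul_le_mul (by linarith) (by linarith) (by linarith) (by positivity)
      _ = ε / 2 := by rw [hδ]; field_simp)
  have h1 := hT t htT
  have h2 := hT (t + δ) (by linarith)
  rw [Real.dist_eq] at h1 h2
  have h4 : y (t + δ) + -h t * (t + δ) - (y t + -h t * t) = y (t + δ) - y t - δ * h t := by ring
  rw [h4, add_sub_cancel_left] at h3
  have h5 : |δ * h t| < δ * ε := by
    rw [abs_lt]
    rw [abs_lt] at h1 h2
    rw [abs_le] at h3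
    constructor <;> nlinarith
  rw [abs_mul, abs_of_pos hδ0] at h5
  exact lt_of_mul_lt_mul_left h5 hδ0.le

lemma LipschitzOnWith.comp_locallyLipschitz {E : Type*} [NormedAddCommGroup E] [ProperSpace E]
    {w : ℝ → E} {K : NNReal} {B : ℝ} (hw : LipschitzOnWith K w (Set.Ici 0))
    (hB : ∀ t, 0 ≤ t → ‖w t‖ ≤ B) {f : E → ℝ} (hf : LocallyLipschitz f) :
    ∃ K' : NNReal, LipschitzOnWith K' (fun t => f (w t)) (Set.Ici 0) := by
  obtain ⟨C, hC⟩ := hf.locallyLipschitzOn.exists_lipschitzOnWith_of_compact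
    (isCompact_closedBall (0 : E) B)
  refine ⟨C * K, hC.comp hw fun t ht => ?_⟩
  simpa using hB t ht

/-- A bound for the states with given energy. -/
lemma exists_norm_bound (ys : Fin N → ℝ) (lams : Fin m → ℝ) (mus : Fin l → ℝ) (e : ℝ) :
    ∃ B : ℝ, ∀ p : State N m l n, energy ys lams mus p ≤ e → ‖p‖ ≤ B := by
  set p₀ : State N m l n := (zeq ys, lams, mus) with hp₀
  refine ⟨‖p₀‖ + Real.sqrt e, fun p hp => ?_⟩
  have hs : ∀ a b : ℝ, (a - b) ^ 2 ≤ e → |a - b| ≤ Real.sqrt e := fun a b h => Real.abs_le_sqrt h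
  have hd : ‖p - p₀‖ ≤ Real.sqrt e := by
    refine norm_state_le (Real.sqrt_nonneg e) (fun ℓ i => hs _ _ ?_) (fun j => hs _ _ ?_)
      (fun j => hs _ _ ?_)
    · exact (sq_le_zdist p.1 ℓ i).trans ((zdist_le_energy p).trans hp)
    · have h1 : (p.2.1 j - lams j) ^ 2 ≤ ∑ j, (p.2.1 j - lams j) ^ 2 :=
        Finset.single_le_sum (f := fun j => (p.2.1 j - lams j) ^ 2) (fun _ _ => sq_nonneg _)
          (Finset.mem_univ j)
      have h2 : 0 ≤ ∑ j, (p.2.2 j - mus j) ^ 2 := Finset.sum_nonneg fun _ _ => sq_nonneg _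
      have h3 := zdist_nonneg ys p.1
      unfold energy at hp
      exact h1.trans (by linarith)
    · have h1 : (p.2.2 j - mus j) ^ 2 ≤ ∑ j, (p.2.2 j - mus j) ^ 2 :=
        Finset.single_le_sum (f := fun j => (p.2.2 j - mus j) ^ 2) (fun _ _ => sq_nonneg _)
          (Finset.mem_univ j)
      have h2 : 0 ≤ ∑ j, (p.2.1 j - lams j) ^ 2 := Finset.sum_nonneg fun _ _ => sq_nonneg _
      have h3 := zdist_nonneg ys p.1
      unfold energy at hp
      exact h1.trans (by linarith)
  calc ‖p‖ = ‖p₀ + (p - p₀)‖ := by rw [add_sub_cancel]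
    _ ≤ ‖p₀‖ + ‖p - p₀‖ := norm_add_le _ _
    _ ≤ _ := by linarith

end Solutions

/-! ### Scalar multipliers -/

/-- A nonnegative function that is driven by `v` and kept nonnegative. -/
structure IsReflected (μ v : ℝ → ℝ) : Prop where
  ac : LocallyAC μ
  nonneg : ∀ t, 0 ≤ t → 0 ≤ μ t
  cont : ContinuousOn v (Set.Ici 0)
  ode : ∀ᵐ t ∂(volume.restrict (Set.Ioi (0 : ℝ))), HasDerivAt μ (projRate (μ t) (v t)) t

namespace IsReflected

variable {μ v : ℝ → ℝ}

lemma eq_zero_of_nonpos (h : IsReflected μ v) {a b : ℝ} (ha : 0 ≤ a) (h0 : μ a = 0)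
    (hv : ∀ t ∈ Set.Ioo a b, v t ≤ 0) {t : ℝ} (hat : a ≤ t) (htb : t ≤ b) : μ t = 0 := by
  have h1 := h.ac.sub_le_of_ae_deriv_le ha hat (C := 0) (by
    filter_upwards [h.ode] with s hs hs2
    rw [hs.deriv]
    have hvs := hv s ⟨hs2.1, hs2.2.trans_le htb⟩
    unfold projRate
    split_ifs
    · exact hvs
    · exact max_le hvs le_rfl)
  have h2 := h.nonneg t (ha.trans hat)
  linarith

lemma tendsto_rate (h : IsReflected μ v) {t : ℝ} (ht : 0 ≤ t) :
    Tendsto (fun s => projRate (μ s) (v s)) (𝓝[>] t) (𝓝 (projRate (μ t) (v t))) := by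
  have hv : Tendsto v (𝓝[>] t) (𝓝 (v t)) :=
    (h.cont t ht).mono fun _ (hs : t < _) => le_trans ht hs.le
  have hμ : Tendsto μ (𝓝[>] t) (𝓝 (μ t)) :=
    (h.ac.continuousOn t ht).mono fun _ (hs : t < _) => le_trans ht hs.le
  rcases (h.nonneg t ht).lt_or_eq with hpos | hzero
  · have e : projRate (μ t) (v t) = v t := by simp [projRate, hpos]
    rw [e]
    refine hv.congr' ?_
    filter_upwards [hμ.eventually (lt_mem_nhds hpos)] with s hs
    simp [projRate, hs]
  · have e : projRate (μ t) (v t) = max (v t) 0 := by simp [projRate, ← hzero]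
    rcases lt_trichotomy (v t) 0 with hneg | hv0 | hpos
    · rw [e, max_eq_right hneg.le]
      obtain ⟨b, hb, hsub⟩ := mem_nhdsGT_iff_exists_Ioo_subset.1 (hv.eventually (gt_mem_nhds hneg))
      refine tendsto_const_nhds.congr' ?_
      filter_upwards [Ioo_mem_nhdsGT hb] with s hs
      have h1 := h.eq_zero_of_nonpos ht hzero.symm (fun s hs => (hsub hs).le) hs.1.le hs.2.le
      have h2 : v s < 0 := hsub hs
      simp [projRate, h1, h2.le]
    · rw [e, hv0, max_self]
      have h1 : Tendsto (fun s => |v s|) (𝓝[>] t) (𝓝 0) := by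
        have := hv.abs
        rwa [hv0, abs_zero] at this
      exact squeeze_zero_norm (fun s => abs_projRate_le _ _) h1
    · rw [e, max_eq_left hpos.le]
      refine hv.congr' ?_
      filter_upwards [hv.eventually (lt_mem_nhds hpos)] with s hs
      simp [projRate, hs.le]

lemma hasDeriv (h : IsReflected μ v) {t : ℝ} (ht : 0 ≤ t) :
    HasDerivWithinAt μ (projRate (μ t) (v t)) (Set.Ici t) t :=
  h.ac.hasDerivWithinAt_of_tendsto ht h.ode (h.tendsto_rate ht)

lemma rdiff (h : IsReflected μ v) : RDiff μ := fun _ ht => (h.hasDeriv ht).differentiableWithinAt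

/-- If the drive tends to a nonpositive limit, the rate tends to zero. -/
lemma tendsto_rate_zero (h : IsReflected μ v) {b : ℝ} (hb : b ≤ 0) (hv : Tendsto v atTop (𝓝 b)) :
    Tendsto (fun t => projRate (μ t) (v t)) atTop (𝓝 0) := by
  rcases hb.lt_or_eq with hneg | rfl
  · obtain ⟨T, hT⟩ := eventually_atTop.1
      ((hv.eventually (gt_mem_nhds (show b < b / 2 by linarith))).and (eventually_ge_atTop 0))
    have hT0 : 0 ≤ T := (hT T le_rfl).2
    obtain ⟨t₀, ht₀, hz⟩ : ∃ t₀, T ≤ t₀ ∧ μ t₀ = 0 := by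
      by_contra hcon
      push Not at hcon
      have hpos : ∀ t, T ≤ t → 0 < μ t := fun t ht =>
        lt_of_le_of_ne (h.nonneg t (hT0.trans ht)) (Ne.symm (hcon t ht))
      set t₁ := T + (μ T + 1) / (-(b / 2)) with ht₁
      have hle : T ≤ t₁ := by
        have : 0 ≤ (μ T + 1) / (-(b / 2)) :=
          div_nonneg (by linarith [hpos T le_rfl]) (by linarith)
        linarith
      have h1 := h.ac.sub_le_of_ae_deriv_le hT0 hle (C := b / 2) (by
        filter_upwards [h.ode] with s hs hs2
        rw [hs.deriv, projRate, if_pos (hpos s hs2.1.le)]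
        exact (hT s hs2.1.le).1.le)
      have h2 : b / 2 * (t₁ - T) = -(μ T + 1) := by
        rw [ht₁, add_sub_cancel_left]
        have := hneg.ne
        field_simp
      have h3 := hpos t₁ hle
      linarith
    refine tendsto_const_nhds.congr' ?_
    filter_upwards [eventually_ge_atTop t₀] with t ht
    have h1 := h.eq_zero_of_nonpos (b := t) (hT0.trans ht₀) hz
      (fun s hs => by linarith [(hT s (ht₀.trans hs.1.le)).1]) ht le_rfl
    have h2 : v t ≤ 0 := by linarith [(hT t (ht₀.trans ht)).1]
    simp [projRate, h1, h2]
  · have h1 : Tendsto (fun s => |v s|) atTop (𝓝 0) := by simpa using hv.abs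
    exact squeeze_zero_norm (fun s => abs_projRate_le _ _) h1

end IsReflected

/-! ### Asymptotics of transformed solutions -/

section Asymptotics

variable {N m l n : ℕ} [NeZero n] {g : SharedGame N m l} {k₁ : ℝ} {k : Fin N → Fin n → ℝ}

/-- The vector field of the transformed system, without the projection. -/
noncomputable def flowField (g : SharedGame N m l) (k₁ : ℝ) (k : Fin N → Fin n → ℝ) (p : State N m l n) :
    State N m l n :=
  (fun ℓ i => transformedRhs g k₁ k p.1 p.2.1 p.2.2 ℓ i, fun j => k₁ * g.H j (p.1 0),
    fun j => k₁ * g.G j (p.1 0))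

lemma continuous_flowField (hg : g.Regular n) : Continuous (flowField g k₁ k) := by
  refine (continuous_pi fun ℓ => continuous_pi fun i => ?_).prodMk
    ((continuous_pi fun j => ?_).prodMk (continuous_pi fun j => ?_))
  · exact (locallyLipschitz_transformedRhs hg ℓ i).continuous
  · exact (locallyLipschitz_H hg j).continuous
  · exact (locallyLipschitz_G hg j).continuous

variable {z : ℝ → Fin n → Fin N → ℝ} {lam : ℝ → Fin m → ℝ} {mu : ℝ → Fin l → ℝ}
  {ys : Fin N → ℝ} {lams : Fin m → ℝ} {mus : Fin l → ℝ} {c : ℝ}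

namespace IsTransformedSolution

lemma continuousOn (h : IsTransformedSolution g k₁ k z lam mu) :
    ContinuousOn (fun t => ((z t, lam t, mu t) : State N m l n)) (Set.Ici 0) := by
  refine (continuousOn_pi.2 fun ℓ => continuousOn_pi.2 fun i => ?_).prodMk
    ((continuousOn_pi.2 fun j => ?_).prodMk (continuousOn_pi.2 fun j => ?_))
  · exact (h.z_ac ℓ i).continuousOn
  · exact (h.dual.lam_ac j).continuousOn
  · exact (h.dual.mu_ac j).continuousOn

lemma comp_continuousOn (h : IsTransformedSolution g k₁ k z lam mu) {f : State N m l n → ℝ}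
    (hf : Continuous f) : ContinuousOn (fun t => f (z t, lam t, mu t)) (Set.Ici 0) :=
  hf.comp_continuousOn h.continuousOn

lemma hasDeriv_z (hg : g.Regular n) (h : IsTransformedSolution g k₁ k z lam mu) {t : ℝ}
    (ht : 0 ≤ t) (ℓ : Fin n) (i : Fin N) : HasDerivWithinAt (fun s => z s ℓ i)
      (transformedRhs g k₁ k (z t) (lam t) (mu t) ℓ i) (Set.Ici t) t := by
  have hode : ∀ᵐ s ∂(volume.restrict (Set.Ioi (0 : ℝ))), HasDerivAt (fun s => z s ℓ i)
      (transformedRhs g k₁ k (z s) (lam s) (mu s) ℓ i) s := by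
    filter_upwards [h.z_ode] with s hs using hs ℓ i
  have hcont := h.comp_continuousOn
    (locallyLipschitz_transformedRhs (k₁ := k₁) (k := k) hg ℓ i).continuous
  exact (h.z_ac ℓ i).hasDerivWithinAt_of_continuousOn hode hcont ht

lemma hasDeriv_lam (hg : g.Regular n) (h : IsTransformedSolution g k₁ k z lam mu) {t : ℝ}
    (ht : 0 ≤ t) (j : Fin m) : HasDerivWithinAt (fun s => lam s j)
      (k₁ * g.H j (z t 0)) (Set.Ici t) t := by
  have hode : ∀ᵐ s ∂(volume.restrict (Set.Ioi (0 : ℝ))), HasDerivAt (fun s => lam s j)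
      (k₁ * g.H j (z s 0)) s := by
    filter_upwards [h.dual.lam_ode] with s hs using hs j
  have hcont := h.comp_continuousOn (locallyLipschitz_H (k₁ := k₁) hg j).continuous
  exact (h.dual.lam_ac j).hasDerivWithinAt_of_continuousOn hode hcont ht

lemma isReflected (hg : g.Regular n) (h : IsTransformedSolution g k₁ k z lam mu) (j : Fin l) :
    IsReflected (fun t => mu t j) (fun t => k₁ * g.G j (z t 0)) where
  ac := h.dual.mu_ac j
  nonneg t ht := h.dual.mu_mem t ht j
  cont := h.comp_continuousOn (locallyLipschitz_G (k₁ := k₁) hg j).continuous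
  ode := by
    filter_upwards [h.scaled.mu_ode] with t ht
    simpa only [one_mul] using ht j

lemma exists_bound (hc : 0 ≤ c) (hD : Dissipative g k₁ k c ys lams mus)
    (h : IsTransformedSolution g k₁ k z lam mu) :
    ∃ B : ℝ, ∀ t, 0 ≤ t → ‖((z t, lam t, mu t) : State N m l n)‖ ≤ B := by
  obtain ⟨B, hB⟩ := exists_norm_bound (n := n) ys lams mus (energy ys lams mus (z 0, lam 0, mu 0))
  exact ⟨B, fun t ht => hB _ (h.scaled.energy_antitone hc hD le_rfl ht)⟩

lemma exists_lipschitz (hg : g.Regular n) (hc : 0 ≤ c) (hD : Dissipative g k₁ k c ys lams mus)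
    (h : IsTransformedSolution g k₁ k z lam mu) :
    ∃ K : NNReal, LipschitzOnWith K (fun t => ((z t, lam t, mu t) : State N m l n))
      (Set.Ici 0) := by
  obtain ⟨B, hB⟩ := h.exists_bound hc hD
  obtain ⟨C, hC⟩ := (isCompact_closedBall (0 : State N m l n) B).exists_bound_of_continuousOn
    (continuous_flowField (k₁ := k₁) (k := k) hg).continuousOn
  have hX : ∀ t, 0 ≤ t → ‖flowField g k₁ k (z t, lam t, mu t)‖ ≤ C := fun t ht =>
    hC _ (by simpa using hB t ht)
  have hC0 : 0 ≤ C := (norm_nonneg _).trans (hX 0 le_rfl)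
  have hz : ∀ ℓ i, LipschitzOnWith C.toNNReal (fun t => z t ℓ i) (Set.Ici 0) := fun ℓ i => by
    refine (h.z_ac ℓ i).lipschitz_of_ae hC0 ?_
    filter_upwards [h.z_ode, ae_restrict_mem measurableSet_Ioi] with t ht (h0 : 0 < t)
    rw [(ht ℓ i).deriv]
    exact (norm_le_pi_norm _ i).trans ((norm_le_pi_norm (flowField g k₁ k (z t, lam t, mu t)).1 ℓ).trans
      ((norm_fst_le _).trans (hX t h0.le)))
  have hl : ∀ j, LipschitzOnWith C.toNNReal (fun t => lam t j) (Set.Ici 0) := fun j => by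
    refine (h.dual.lam_ac j).lipschitz_of_ae hC0 ?_
    filter_upwards [h.dual.lam_ode, ae_restrict_mem measurableSet_Ioi] with t ht (h0 : 0 < t)
    rw [(ht j).deriv]
    exact (norm_le_pi_norm (flowField g k₁ k (z t, lam t, mu t)).2.1 j).trans
      ((norm_fst_le _).trans ((norm_snd_le _).trans (hX t h0.le)))
  have hm : ∀ j, LipschitzOnWith C.toNNReal (fun t => mu t j) (Set.Ici 0) := fun j => by
    refine (h.dual.mu_ac j).lipschitz_of_ae hC0 ?_
    filter_upwards [(h.isReflected hg j).ode, ae_restrict_mem measurableSet_Ioi] with t ht (h0 : 0 < t)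
    rw [ht.deriv]
    exact (abs_projRate_le _ _).trans ((norm_le_pi_norm (flowField g k₁ k (z t, lam t, mu t)).2.2 j).trans
      ((norm_snd_le _).trans ((norm_snd_le _).trans (hX t h0.le))))
  refine ⟨C.toNNReal, LipschitzOnWith.of_dist_le_mul fun s hs t ht => ?_⟩
  have hnn : 0 ≤ (C.toNNReal : ℝ) * dist s t := by positivity
  rw [Prod.dist_eq, Prod.dist_eq]
  refine max_le ?_ (max_le ?_ ?_)
  · exact (dist_pi_le_iff hnn).2 fun ℓ => (dist_pi_le_iff hnn).2 fun i =>
      (hz ℓ i).dist_le_mul s hs t ht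
  · exact (dist_pi_le_iff hnn).2 fun j => (hl j).dist_le_mul s hs t ht
  · exact (dist_pi_le_iff hnn).2 fun j => (hm j).dist_le_mul s hs t ht

lemma exists_lipschitz_comp (hg : g.Regular n) (hc : 0 ≤ c)
    (hD : Dissipative g k₁ k c ys lams mus) (h : IsTransformedSolution g k₁ k z lam mu)
    {f : State N m l n → ℝ} (hf : LocallyLipschitz f) :
    ∃ K : NNReal, LipschitzOnWith K (fun t => f (z t, lam t, mu t)) (Set.Ici 0) := by
  obtain ⟨B, hB⟩ := h.exists_bound hc hD
  obtain ⟨K, hK⟩ := h.exists_lipschitz hg hc hD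
  exact hK.comp_locallyLipschitz hB hf

/-- The states of the transformed system converge. -/
theorem tendsto_z (hg : g.Regular n) (hc : 0 < c) (hD : Dissipative g k₁ k c ys lams mus)
    (h : IsTransformedSolution g k₁ k z lam mu) (ℓ : Fin n) (i : Fin N) :
    Tendsto (fun t => z t ℓ i) atTop (𝓝 (zeq ys ℓ i)) := by
  have hLL : LocallyLipschitz (fun p : State N m l n => zdist ys p.1) := by
    unfold zdist
    refine LocallyLipschitz.sum_real _ fun ℓ _ => LocallyLipschitz.sum_real _ fun i _ => ?_
    have h1 : LocallyLipschitz (fun p : State N m l n => p.1 ℓ i + -zeq ys ℓ i) :=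
      (locallyLipschitz_eval ℓ i).add_real (LocallyLipschitz.const _)
    have h2 := h1.mul_real h1
    convert h2 using 2 with p
    ring
  obtain ⟨K, hK⟩ := h.exists_lipschitz_comp hg hc.le hD hLL
  have h0 : Tendsto (fun t => zdist ys (z t)) atTop (𝓝 0) := by
    refine tendsto_zero_of_decrease (c := 2 * c)
      (W := fun t => energy ys lams mus (z t, lam t, mu t)) (by linarith)
      (fun t _ => energy_nonneg _) (fun a b ha hab => h.scaled.energy_antitone hc.le hD ha hab)
      (fun t => zdist_nonneg _ _) hK ?_
    intro a b ε ha hab hε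
    have h1 := (h.scaled.energy_ac (ys := ys) (lams := lams) (mus := mus)).sub_le_of_ae_deriv_le
      ha hab (C := -(2 * c * ε)) (by
        filter_upwards [h.scaled.deriv_energy_le hD] with t ht ht2
        refine ht.trans (neg_le_neg ?_)
        have := hε t ht2
        rw [mul_one]
        exact mul_le_mul_of_nonneg_left this (by linarith))
    linarith
  have h1 : Tendsto (fun t => Real.sqrt (zdist ys (z t))) atTop (𝓝 0) := by
    simpa using h0.sqrt
  refine tendsto_iff_norm_sub_tendsto_zero.2 (squeeze_zero (fun t => norm_nonneg _) (fun t => ?_) h1)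
  exact Real.abs_le_sqrt (sq_le_zdist (z t) ℓ i)

lemma tendsto_transformedRhs (hg : g.Regular n) (hc : 0 < c)
    (hD : Dissipative g k₁ k c ys lams mus) (h : IsTransformedSolution g k₁ k z lam mu)
    (ℓ : Fin n) (i : Fin N) :
    Tendsto (fun t => transformedRhs g k₁ k (z t) (lam t) (mu t) ℓ i) atTop (𝓝 0) := by
  obtain ⟨K, hK⟩ := h.exists_lipschitz_comp hg hc.le hD
    (locallyLipschitz_transformedRhs (k₁ := k₁) (k := k) hg ℓ i)
  refine tendsto_deriv_zero (h.z_ac ℓ i) ?_ hK (h.tendsto_z hg hc hD ℓ i)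
  filter_upwards [h.z_ode] with t ht using ht ℓ i

/-- The gradients of the Lagrangians tend to zero. -/
lemma tendsto_gradL (hg : g.Regular n) (hc : 0 < c) (hk0 : k₁ ≠ 0)
    (hD : Dissipative g k₁ k c ys lams mus) (h : IsTransformedSolution g k₁ k z lam mu)
    (i : Fin N) : Tendsto (fun t => g.gradL i (lam t) (mu t) (z t 0)) atTop (𝓝 0) := by
  have h1 := h.tendsto_transformedRhs hg hc hD 0 i
  have h2 : Tendsto (fun t => if hn : (0 : Fin n).val + 1 < n then z t ⟨(0 : Fin n).val + 1, hn⟩ i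
      else 0) atTop (𝓝 0) := by
    split_ifs with hn
    · have := h.tendsto_z hg hc hD ⟨(0 : Fin n).val + 1, hn⟩ i
      have hne : (⟨(0 : Fin n).val + 1, hn⟩ : Fin n) ≠ 0 := by
        intro h0
        have := congrArg Fin.val h0
        simp at this
      simpa [zeq, hne] using this
    · exact tendsto_const_nhds
  have h3 := (h2.sub h1).const_mul k₁⁻¹
  simp only [sub_zero, mul_zero] at h3
  refine h3.congr fun t => ?_
  simp only [transformedRhs, if_true]
  field_simp
  ring

lemma tendsto_y (hg : g.Regular n) (hc : 0 < c) (hD : Dissipative g k₁ k c ys lams mus)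
    (h : IsTransformedSolution g k₁ k z lam mu) : Tendsto (fun t => z t 0) atTop (𝓝 ys) :=
  tendsto_pi_nhds.2 fun i => by simpa [zeq] using h.tendsto_z hg hc hD 0 i

end IsTransformedSolution

end Asymptotics

open scoped BoundedContinuousFunction

/-! ### The reflection map -/

/-- Running maximum of the negative part of `f` on `[0, t]`. -/
noncomputable def runMax (f : ℝ → ℝ) (t : ℝ) : ℝ :=
  sSup ((fun τ => max (-f (τ * max t 0)) 0) '' Set.Icc 0 1)

section runMax

variable {f f' : ℝ → ℝ}

lemma continuous_runMax (hf : Continuous f) : Continuous (runMax f) := by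
  refine isCompact_Icc.continuous_sSup (f := fun t τ => max (-f (τ * max t 0)) 0) ?_
  exact ((hf.comp (continuous_snd.mul (continuous_fst.max continuous_const))).neg).max
    continuous_const

lemma bddAbove_runMax (hf : Continuous f) (t : ℝ) :
    BddAbove ((fun τ => max (-f (τ * max t 0)) 0) '' Set.Icc (0 : ℝ) 1) :=
  (isCompact_Icc.image (((hf.comp (continuous_id.mul continuous_const)).neg).max
    continuous_const)).bddAbove

lemma le_runMax (hf : Continuous f) {s t : ℝ} (hs : 0 ≤ s) (hst : s ≤ t) :
    max (-f s) 0 ≤ runMax f t := by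
  refine le_csSup (bddAbove_runMax hf t) ?_
  rcases (hs.trans hst).eq_or_lt with h0 | hpos
  · refine ⟨0, ⟨le_rfl, zero_le_one⟩, ?_⟩
    have : s = 0 := le_antisymm (h0 ▸ hst) hs
    simp [this]
  · refine ⟨s / t, ⟨by positivity, (div_le_one hpos).2 hst⟩, ?_⟩
    simp only [max_eq_left hpos.le, div_mul_cancel₀ s hpos.ne']

lemma runMax_le {t C : ℝ} (ht : 0 ≤ t) (h : ∀ s, 0 ≤ s → s ≤ t → max (-f s) 0 ≤ C) :
    runMax f t ≤ C := by
  refine csSup_le ⟨_, ⟨0, ⟨le_rfl, zero_le_one⟩, rfl⟩⟩ ?_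
  rintro _ ⟨τ, hτ, rfl⟩
  refine h _ (mul_nonneg hτ.1 (le_max_right _ _)) ?_
  rw [max_eq_left ht]
  exact mul_le_of_le_one_left ht hτ.2

lemma exists_eq_runMax (hf : Continuous f) {t : ℝ} (ht : 0 ≤ t) :
    ∃ s, 0 ≤ s ∧ s ≤ t ∧ max (-f s) 0 = runMax f t := by
  have hc : Continuous fun τ => max (-f (τ * max t 0)) 0 :=
    ((hf.comp (continuous_id.mul continuous_const)).neg).max continuous_const
  obtain ⟨τ, hτ, he⟩ := (isCompact_Icc.image hc).sSup_mem
    ⟨_, ⟨0, Set.left_mem_Icc.2 zero_le_one, rfl⟩⟩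
  refine ⟨τ * max t 0, mul_nonneg hτ.1 (le_max_right _ _), ?_, he⟩
  rw [max_eq_left ht]
  exact mul_le_of_le_one_left ht hτ.2

lemma runMax_nonneg (hf : Continuous f) {t : ℝ} (ht : 0 ≤ t) : 0 ≤ runMax f t :=
  (le_max_right _ _).trans (le_runMax hf ht le_rfl)

lemma runMax_mono (hf : Continuous f) {s t : ℝ} (hs : 0 ≤ s) (hst : s ≤ t) :
    runMax f s ≤ runMax f t :=
  runMax_le hs fun _ h0 h1 => le_runMax hf h0 (h1.trans hst)

lemma abs_runMax_sub_le (hf : Continuous f) (hf' : Continuous f') {t D : ℝ} (ht : 0 ≤ t)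
    (h : ∀ s, 0 ≤ s → s ≤ t → |f s - f' s| ≤ D) : |runMax f t - runMax f' t| ≤ D := by
  have key : ∀ {f f' : ℝ → ℝ}, Continuous f' → (∀ s, 0 ≤ s → s ≤ t → |f s - f' s| ≤ D) →
      runMax f t ≤ runMax f' t + D := by
    intro f f' hf' h
    refine runMax_le ht fun s h0 h1 => ?_
    have h2 := le_runMax hf' h0 h1
    have h3 := abs_le.1 (h s h0 h1)
    have h4 := (le_max_left _ _).trans h2
    have h5 := (le_max_right _ _).trans h2
    have hD : 0 ≤ D := (abs_nonneg _).trans (h s h0 h1)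
    exact max_le (by linarith) (by linarith)
  have h1 := key hf' h
  have h2 := key hf (f := f') (f' := f) fun s h0 h1 => by rw [abs_sub_comm]; exact h s h0 h1
  rw [abs_le]
  constructor <;> linarith

lemma runMax_lipschitz (hf : Continuous f) {C : NNReal} (hC : LipschitzOnWith C f (Set.Ici 0)) :
    LipschitzOnWith C (runMax f) (Set.Ici 0) := by
  have key : ∀ s t, 0 ≤ s → s ≤ t → |runMax f t - runMax f s| ≤ C * (t - s) := by
    intro s t hs hst
    have h0 : 0 ≤ (C : ℝ) * (t - s) := mul_nonneg C.2 (sub_nonneg.2 hst)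
    rw [abs_of_nonneg (sub_nonneg.2 (runMax_mono hf hs hst)), sub_le_iff_le_add]
    refine runMax_le (hs.trans hst) fun σ hσ0 hσt => ?_
    rcases le_total σ s with h | h
    · linarith [le_runMax hf hσ0 h]
    · have h1 := hC.dist_le_mul s hs σ hσ0
      rw [Real.dist_eq, Real.dist_eq, abs_sub_comm s σ, abs_of_nonneg (sub_nonneg.2 h)] at h1
      have h2 := (abs_le.1 h1).2
      have h3 := (le_max_left _ _).trans (le_runMax hf hs le_rfl)
      have h4 : (C : ℝ) * (σ - s) ≤ C * (t - s) :=
        mul_le_mul_of_nonneg_left (by linarith) C.2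
      exact max_le (by linarith) (by linarith [runMax_nonneg hf hs])
  refine LipschitzOnWith.of_dist_le_mul fun s hs t ht => ?_
  rcases le_total s t with h | h
  · rw [dist_comm, dist_comm s t, Real.dist_eq, Real.dist_eq, abs_of_nonneg (sub_nonneg.2 h)]
    exact key s t hs h
  · rw [Real.dist_eq, Real.dist_eq, abs_of_nonneg (sub_nonneg.2 h)]
    exact key t s ht h

/-- The reflection map solves the reflected equation. -/
lemma isReflected_runMax (hf : Continuous f) {C : NNReal} (hC : LipschitzOnWith C f (Set.Ici 0))
    {v : ℝ → ℝ} (hv : ∀ t, 0 < t → HasDerivAt f (v t) t) :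
    LocallyAC (fun t => f t + runMax f t) ∧ (∀ t, 0 ≤ t → 0 ≤ f t + runMax f t) ∧
      ∀ᵐ t ∂(volume.restrict (Set.Ioi (0 : ℝ))),
        HasDerivAt (fun t => f t + runMax f t) (projRate (f t + runMax f t) (v t)) t := by
  have hnn : ∀ t, 0 ≤ t → 0 ≤ f t + runMax f t := fun t ht => by
    have := (le_max_left _ _).trans (le_runMax hf ht le_rfl)
    linarith
  have hac : LocallyAC (fun t => f t + runMax f t) :=
    (LocallyAC.of_lipschitz hC).add (LocallyAC.of_lipschitz (runMax_lipschitz hf hC))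
  refine ⟨hac, hnn, ?_⟩
  filter_upwards [hac.ae_differentiableAt, ae_restrict_mem measurableSet_Ioi] with t hd (h0 : 0 < t)
  have hcont : Continuous fun t => f t + runMax f t := hf.add (continuous_runMax hf)
  rcases (hnn t h0.le).lt_or_eq with hpos | hzero
  · rw [projRate, if_pos hpos]
    have hconst : runMax f =ᶠ[𝓝 t] fun _ => runMax f t := by
      have hnb : {s | 0 < f s + runMax f s} ∩ Set.Ioi 0 ∈ 𝓝 t :=
        Filter.inter_mem (hcont.continuousAt.eventually (lt_mem_nhds hpos)) (Ioi_mem_nhds h0)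
      obtain ⟨a, b, hab, hsub⟩ := mem_nhds_iff_exists_Ioo_subset.1 hnb
      have key : ∀ s ∈ Set.Ioo a b, ∀ s' ∈ Set.Ioo a b, s ≤ s' → runMax f s = runMax f s' := by
        intro s hs s' hs' hss
        have hs0 : 0 < s := (hsub hs).2
        refine le_antisymm (runMax_mono hf hs0.le hss) ?_
        by_contra hlt
        push Not at hlt
        obtain ⟨σ, hσ0, hσ1, hσ⟩ := exists_eq_runMax hf (hs0.le.trans hss)
        have hsσ : s < σ := by
          by_contra hle
          push Not at hle
          have := le_runMax hf hσ0 hle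
          linarith
        have hp := (hsub ⟨hs.1.trans hsσ, hσ1.trans_lt hs'.2⟩).1
        have h1 : runMax f σ ≤ runMax f s' := runMax_mono hf hσ0 hσ1
        have h2 := runMax_nonneg hf hs0.le
        rcases le_total (-f σ) 0 with h3 | h3
        · rw [max_eq_right h3] at hσ
          linarith
        · rw [max_eq_left h3] at hσ
          have hp' : 0 < f σ + runMax f σ := hp
          linarith
      filter_upwards [Ioo_mem_nhds hab.1 hab.2] with s hs
      rcases le_total s t with h | h
      · exact key s hs t hab h
      · exact (key t hab s hs h).symm
    have h1 : HasDerivAt (fun s => f s + runMax f t) (v t) t := (hv t h0).add_const _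
    refine h1.congr_of_eventuallyEq ?_
    filter_upwards [hconst] with s hs
    rw [hs]
  · have hmin : IsLocalMin (fun t => f t + runMax f t) t := by
      filter_upwards [Ioi_mem_nhds h0] with s hs
      rw [← hzero]
      exact hnn s (le_of_lt hs)
    have hd0 : HasDerivAt (fun t => f t + runMax f t) 0 t := by
      have := hd.hasDerivAt
      rwa [hmin.deriv_eq_zero] at this
    have hrun : HasDerivAt (runMax f) (0 - v t) t := by
      have := hd0.sub (hv t h0)
      refine this.congr_of_eventuallyEq (Eventually.of_forall fun s => ?_)
      simp
    have hvneg : 0 ≤ 0 - v t := by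
      refine ge_of_tendsto ((hasDerivWithinAt_iff_tendsto_slope' (s := Set.Ioi t) (by simp)).1
        hrun.hasDerivWithinAt) ?_
      filter_upwards [self_mem_nhdsWithin] with s (hs : t < s)
      rw [slope_def_field]
      exact div_nonneg (sub_nonneg.2 (runMax_mono hf h0.le hs.le)) (sub_nonneg.2 hs.le)
    have e : projRate (f t + runMax f t) (v t) = 0 := by
      rw [← hzero, projRate, if_neg (lt_irrefl _), max_eq_right (by linarith)]
    rw [e]
    exact hd0

end runMax

/-! ### Reflected flows of globally Lipschitz fields -/

section ReflectedFlow

variable {N m l n : ℕ}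

/-- Reflection of the last component of a path. -/
noncomputable def reflect (q : ℝ → State N m l n) (t : ℝ) : State N m l n :=
  ((q t).1, (q t).2.1, fun j => (q t).2.2 j + runMax (fun s => (q s).2.2 j) t)

lemma continuous_reflect {q : ℝ → State N m l n} (hq : Continuous q) : Continuous (reflect q) := by
  have hj : ∀ j, Continuous fun s => (q s).2.2 j := fun j =>
    (continuous_apply j).comp hq.snd.snd
  exact hq.fst.prodMk (hq.snd.fst.prodMk
    (continuous_pi fun j => (hj j).add (continuous_runMax (hj j))))

lemma dist_reflect_le {q q' : ℝ → State N m l n} (hq : Continuous q) (hq' : Continuous q')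
    {t D : ℝ} (ht : 0 ≤ t) (hD : ∀ s, 0 ≤ s → s ≤ t → dist (q s) (q' s) ≤ D) :
    dist (reflect q t) (reflect q' t) ≤ 2 * D := by
  have hD0 : 0 ≤ D := dist_nonneg.trans (hD t ht le_rfl)
  have hj : ∀ j, Continuous fun s => (q s).2.2 j := fun j =>
    (continuous_apply j).comp hq.snd.snd
  have hj' : ∀ j, Continuous fun s => (q' s).2.2 j := fun j =>
    (continuous_apply j).comp hq'.snd.snd
  have h3 : ∀ j s, 0 ≤ s → s ≤ t → |(q s).2.2 j - (q' s).2.2 j| ≤ D := fun j s h0 h1 =>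
    (dist_le_pi_dist (q s).2.2 (q' s).2.2 j).trans
      ((le_max_right _ _).trans ((le_max_right _ _).trans (hD s h0 h1)))
  have ht' := hD t ht le_rfl
  refine max_le ?_ (max_le ?_ ?_)
  · exact ((le_max_left _ _).trans ht').trans (by linarith)
  · exact ((le_max_left _ _).trans ((le_max_right _ _).trans ht')).trans (by linarith)
  · refine (dist_pi_le_iff (by linarith)).2 fun j => ?_
    have h4 := abs_runMax_sub_le (hj j) (hj' j) ht (h3 j)
    have h5 := h3 j t ht le_rfl
    rw [Real.dist_eq]
    rw [abs_le] at h4 h5 ⊢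
    simp only [reflect]
    constructor <;> linarith

variable (Y : State N m l n → State N m l n) (α : ℝ) (q₀ : State N m l n)

/-- The path with the weight removed. -/
noncomputable def unweight (p : ℝ →ᵇ State N m l n) (t : ℝ) : State N m l n :=
  Real.exp (α * max t 0) • p t

lemma continuous_unweight (p : ℝ →ᵇ State N m l n) : Continuous (unweight α p) :=
  (Real.continuous_exp.comp (continuous_const.mul (continuous_id.max continuous_const))).smul
    p.continuous

/-- The integral operator whose fixed points are the reflected flow lines. -/
noncomputable def picard (p : ℝ →ᵇ State N m l n) (t : ℝ) : State N m l n :=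
  Real.exp (-(α * max t 0)) •
    (q₀ + ∫ s in (0 : ℝ)..(max t 0), Y (reflect (unweight α p) s))

variable {Y α q₀}

lemma continuous_picard (hY : Continuous Y) (p : ℝ →ᵇ State N m l n) :
    Continuous (picard Y α q₀ p) := by
  have h1 : Continuous fun s => Y (reflect (unweight α p) s) :=
    hY.comp (continuous_reflect (continuous_unweight α p))
  have h2 : Continuous fun t => ∫ s in (0 : ℝ)..t, Y (reflect (unweight α p) s) :=
    intervalIntegral.continuous_primitive (fun a b => h1.intervalIntegrable a b) 0
  have h3 : Continuous fun t : ℝ => Real.exp (-(α * max t 0)) :=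
    Real.continuous_exp.comp (continuous_const.mul (continuous_id.max continuous_const)).neg
  exact h3.smul (continuous_const.add (h2.comp (continuous_id.max continuous_const)))

lemma norm_picard_le {C : ℝ} (hC0 : 0 ≤ C) (hC : ∀ p, ‖Y p‖ ≤ C) (hα : 0 < α)
    (p : ℝ →ᵇ State N m l n) (t : ℝ) : ‖picard Y α q₀ p t‖ ≤ ‖q₀‖ + C / α := by
  set τ := max t 0 with hτ
  have hτ0 : 0 ≤ τ := le_max_right _ _
  have h1 : ‖∫ s in (0 : ℝ)..τ, Y (reflect (unweight α p) s)‖ ≤ C * |τ - 0| :=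
    intervalIntegral.norm_integral_le_of_norm_le_const fun s _ => hC _
  rw [sub_zero, abs_of_nonneg hτ0] at h1
  rw [picard, norm_smul, Real.norm_eq_abs, abs_of_pos (Real.exp_pos _), ← hτ]
  have h2 := norm_add_le q₀ (∫ s in (0 : ℝ)..τ, Y (reflect (unweight α p) s))
  have h3 : Real.exp (-(α * τ)) ≤ 1 := Real.exp_le_one_iff.2 (by nlinarith)
  have h4 : Real.exp (-(α * τ)) * (α * τ) ≤ 1 := by
    have h5 : α * τ ≤ Real.exp (α * τ) := by linarith [Real.add_one_le_exp (α * τ)]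
    calc Real.exp (-(α * τ)) * (α * τ) ≤ Real.exp (-(α * τ)) * Real.exp (α * τ) :=
          mul_le_mul_of_nonneg_left h5 (Real.exp_pos _).le
      _ = 1 := by rw [← Real.exp_add]; simp
  calc _ ≤ Real.exp (-(α * τ)) * (‖q₀‖ + C * τ) :=
        mul_le_mul_of_nonneg_left (by linarith) (Real.exp_pos _).le
    _ = Real.exp (-(α * τ)) * ‖q₀‖ + C / α * (Real.exp (-(α * τ)) * (α * τ)) := by
        field_simp
    _ ≤ 1 * ‖q₀‖ + C / α * 1 :=
        add_le_add (mul_le_mul_of_nonneg_right h3 (norm_nonneg _))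
          (mul_le_mul_of_nonneg_left h4 (by positivity))
    _ = _ := by ring

lemma dist_picard_le {K : NNReal} (hY : LipschitzWith K Y) (hα : 0 < α)
    (p p' : ℝ →ᵇ State N m l n) (t : ℝ) :
    dist (picard Y α q₀ p t) (picard Y α q₀ p' t) ≤ 2 * K / α * dist p p' := by
  set τ := max t 0 with hτ
  have hτ0 : 0 ≤ τ := le_max_right _ _
  have hc : ∀ p : ℝ →ᵇ State N m l n, Continuous fun s => Y (reflect (unweight α p) s) := fun p =>
    hY.continuous.comp (continuous_reflect (continuous_unweight α p))
  have hint : ∀ s ∈ Set.Ioc 0 τ, ‖Y (reflect (unweight α p) s) - Y (reflect (unweight α p') s)‖ ≤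
      2 * K * dist p p' * Real.exp (α * s) := by
    intro s hs
    rw [← dist_eq_norm]
    refine (hY.dist_le_mul _ _).trans ?_
    have h1 : dist (reflect (unweight α p) s) (reflect (unweight α p') s) ≤
        2 * (Real.exp (α * s) * dist p p') := by
      refine dist_reflect_le (continuous_unweight α p) (continuous_unweight α p') hs.1.le
        fun r h0 h1 => ?_
      rw [unweight, unweight, dist_smul₀, Real.norm_eq_abs, abs_of_pos (Real.exp_pos _)]
      refine mul_le_mul ?_ (BoundedContinuousFunction.dist_coe_le_dist r) dist_nonneg
        (Real.exp_pos _).le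
      rw [max_eq_left h0]
      exact Real.exp_le_exp.2 (mul_le_mul_of_nonneg_left h1 hα.le)
    calc (K : ℝ) * _ ≤ K * (2 * (Real.exp (α * s) * dist p p')) :=
          mul_le_mul_of_nonneg_left h1 K.2
      _ = _ := by ring
  have hI : ‖(∫ s in (0 : ℝ)..τ, Y (reflect (unweight α p) s)) -
      ∫ s in (0 : ℝ)..τ, Y (reflect (unweight α p') s)‖ ≤
      2 * K * dist p p' * (Real.exp (α * τ) / α) := by
    rw [← intervalIntegral.integral_sub ((hc p).intervalIntegrable _ _)
      ((hc p').intervalIntegrable _ _)]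
    have hexp : Continuous fun s => 2 * K * dist p p' * Real.exp (α * s) := by fun_prop
    refine (intervalIntegral.norm_integral_le_of_norm_le hτ0
      (Eventually.of_forall hint) (hexp.intervalIntegrable _ _)).trans ?_
    rw [intervalIntegral.integral_const_mul]
    refine mul_le_mul_of_nonneg_left ?_ (by positivity)
    have h1 : ∫ s in (0 : ℝ)..τ, Real.exp (α * s) = (Real.exp (α * τ) - Real.exp (α * 0)) / α := by
      have hd : ∀ s ∈ Set.uIcc 0 τ, HasDerivAt (fun s => Real.exp (α * s) / α) (Real.exp (α * s)) s := by
        intro s _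
        have h2 : HasDerivAt (fun s => α * s) α s := by
          simpa using (hasDerivAt_id s).const_mul α
        refine (h2.exp.div_const α).congr_deriv ?_
        field_simp
      rw [intervalIntegral.integral_eq_sub_of_hasDerivAt hd
        ((by fun_prop : Continuous fun s => Real.exp (α * s)).intervalIntegrable _ _)]
      ring
    rw [h1]
    refine div_le_div_of_nonneg_right ?_ hα.le
    linarith [Real.exp_pos (α * 0)]
  rw [picard, picard, dist_smul₀, Real.norm_eq_abs, abs_of_pos (Real.exp_pos _), ← hτ,
    dist_add_left, dist_eq_norm]
  calc _ ≤ Real.exp (-(α * τ)) * (2 * K * dist p p' * (Real.exp (α * τ) / α)) :=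
        mul_le_mul_of_nonneg_left hI (Real.exp_pos _).le
    _ = 2 * K / α * dist p p' * (Real.exp (-(α * τ)) * Real.exp (α * τ)) := by ring
    _ = _ := by rw [← Real.exp_add]; simp

/-- Reflected flow lines of bounded Lipschitz fields exist for all times. -/
theorem exists_reflected_path {K : NNReal} (hY : LipschitzWith K Y) {C : ℝ}
    (hC : ∀ p, ‖Y p‖ ≤ C) (q₀ : State N m l n) :
    ∃ q : ℝ → State N m l n, Continuous q ∧
      ∀ t, 0 ≤ t → q t = q₀ + ∫ s in (0 : ℝ)..t, Y (reflect q s) := by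
  set α : ℝ := 4 * K + 1 with hα
  have hα0 : 0 < α := by positivity
  have hC0 : 0 ≤ C := (norm_nonneg _).trans (hC 0)
  let T : (ℝ →ᵇ State N m l n) → (ℝ →ᵇ State N m l n) := fun p =>
    BoundedContinuousFunction.ofNormedAddCommGroup (picard Y α q₀ p)
      (continuous_picard hY.continuous p) _ (norm_picard_le hC0 hC hα0 p)
  have hT : ContractingWith (1 / 2 : NNReal) T := by
    refine ⟨by
      rw [← NNReal.coe_lt_coe]; norm_num, LipschitzWith.of_dist_le_mul fun p p' => ?_⟩
    refine (BoundedContinuousFunction.dist_le (by positivity)).2 fun t => ?_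
    refine (dist_picard_le hY hα0 p p' t).trans (mul_le_mul_of_nonneg_right ?_ dist_nonneg)
    rw [div_le_iff₀ hα0, hα]
    push_cast
    linarith [K.2]
  have : Nonempty (ℝ →ᵇ State N m l n) := ⟨0⟩
  set p := hT.fixedPoint T with hp
  have hfix : T p = p := hT.fixedPoint_isFixedPt
  refine ⟨unweight α p, continuous_unweight α p, fun t ht => ?_⟩
  have h1 : p t = picard Y α q₀ p t := by
    conv_lhs => rw [← hfix]
    rfl
  rw [unweight, h1, picard, max_eq_left ht, smul_smul, ← Real.exp_add]
  simp

/-- Existence of solutions of the projected equation for a bounded Lipschitz field. -/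
theorem exists_reflected_flow {K : NNReal} (hY : LipschitzWith K Y) {C : ℝ}
    (hC : ∀ p, ‖Y p‖ ≤ C) (q₀ : State N m l n) (hq₀ : ∀ j, 0 ≤ q₀.2.2 j) :
    ∃ w : ℝ → State N m l n, w 0 = q₀ ∧ (∀ ℓ i, LocallyAC fun t => (w t).1 ℓ i) ∧
      (∀ j, LocallyAC fun t => (w t).2.1 j) ∧ (∀ j, LocallyAC fun t => (w t).2.2 j) ∧
      (∀ t, 0 ≤ t → ∀ j, 0 ≤ (w t).2.2 j) ∧
      ∀ᵐ t ∂(volume.restrict (Set.Ioi (0 : ℝ))),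
        (∀ ℓ i, HasDerivAt (fun s => (w s).1 ℓ i) ((Y (w t)).1 ℓ i) t) ∧
        (∀ j, HasDerivAt (fun s => (w s).2.1 j) ((Y (w t)).2.1 j) t) ∧
        ∀ j, HasDerivAt (fun s => (w s).2.2 j) (projRate ((w t).2.2 j) ((Y (w t)).2.2 j)) t := by
  obtain ⟨q, hqc, hq⟩ := exists_reflected_path hY hC q₀
  have hC0 : 0 ≤ C := (norm_nonneg _).trans (hC 0)
  have hcont : Continuous fun s => Y (reflect q s) := hY.continuous.comp (continuous_reflect hqc)
  have hq0 : q 0 = q₀ := by rw [hq 0 le_rfl]; simp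
  have hderiv : ∀ t, 0 < t → HasDerivAt q (Y (reflect q t)) t := by
    intro t ht
    have h1 : HasDerivAt (fun t => q₀ + ∫ s in (0 : ℝ)..t, Y (reflect q s)) (Y (reflect q t)) t :=
      (intervalIntegral.integral_hasDerivAt_right (hcont.intervalIntegrable _ _)
        (hcont.stronglyMeasurableAtFilter _ _) hcont.continuousAt).const_add _
    refine h1.congr_of_eventuallyEq ?_
    filter_upwards [Ioi_mem_nhds ht] with s hs using hq s (le_of_lt hs)
  have hlip : LipschitzOnWith C.toNNReal q (Set.Ici 0) := by
    refine LipschitzOnWith.of_dist_le_mul fun s hs t ht => ?_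
    rw [hq s hs, hq t ht, dist_add_left, dist_eq_norm, intervalIntegral.integral_interval_sub_left
      (hcont.intervalIntegrable _ _) (hcont.intervalIntegrable _ _), Real.coe_toNNReal _ hC0,
      Real.dist_eq]
    exact intervalIntegral.norm_integral_le_of_norm_le_const fun s _ => hC _
  have hd1 : ∀ t, 0 < t → ∀ ℓ i, HasDerivAt (fun s => (q s).1 ℓ i) ((Y (reflect q t)).1 ℓ i) t :=
    fun t ht ℓ i => hasDerivAt_pi.1 (hasDerivAt_pi.1 (hderiv t ht).fst ℓ) i
  have hd2 : ∀ t, 0 < t → ∀ j, HasDerivAt (fun s => (q s).2.1 j) ((Y (reflect q t)).2.1 j) t :=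
    fun t ht j => hasDerivAt_pi.1 (hderiv t ht).snd.fst j
  have hd3 : ∀ t, 0 < t → ∀ j, HasDerivAt (fun s => (q s).2.2 j) ((Y (reflect q t)).2.2 j) t :=
    fun t ht j => hasDerivAt_pi.1 (hderiv t ht).snd.snd j
  have hl1 : ∀ ℓ i, LipschitzOnWith C.toNNReal (fun s => (q s).1 ℓ i) (Set.Ici 0) := fun ℓ i =>
    LipschitzOnWith.of_dist_le_mul fun s hs t ht =>
      (dist_le_pi_dist ((q s).1 ℓ) ((q t).1 ℓ) i).trans
        ((dist_le_pi_dist (q s).1 (q t).1 ℓ).trans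
          ((le_max_left _ _).trans (hlip.dist_le_mul s hs t ht)))
  have hl2 : ∀ j, LipschitzOnWith C.toNNReal (fun s => (q s).2.1 j) (Set.Ici 0) := fun j =>
    LipschitzOnWith.of_dist_le_mul fun s hs t ht =>
      (dist_le_pi_dist (q s).2.1 (q t).2.1 j).trans
        ((le_max_left _ _).trans ((le_max_right _ _).trans (hlip.dist_le_mul s hs t ht)))
  have hl3 : ∀ j, LipschitzOnWith C.toNNReal (fun s => (q s).2.2 j) (Set.Ici 0) := fun j =>
    LipschitzOnWith.of_dist_le_mul fun s hs t ht =>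
      (dist_le_pi_dist (q s).2.2 (q t).2.2 j).trans
        ((le_max_right _ _).trans ((le_max_right _ _).trans (hlip.dist_le_mul s hs t ht)))
  have hc3 : ∀ j, Continuous fun s => (q s).2.2 j := fun j =>
    (continuous_apply j).comp hqc.snd.snd
  have hR := fun j => isReflected_runMax (hc3 j) (hl3 j) fun t ht => hd3 t ht j
  refine ⟨reflect q, ?_, fun ℓ i => LocallyAC.of_lipschitz (hl1 ℓ i),
    fun j => LocallyAC.of_lipschitz (hl2 j), fun j => (hR j).1, fun t ht j => (hR j).2.1 t ht, ?_⟩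
  · rw [reflect, hq0]
    refine Prod.ext rfl (Prod.ext rfl (funext fun j => ?_))
    have h1 : runMax (fun s => (q s).2.2 j) 0 ≤ 0 := runMax_le le_rfl fun s h0 h1 => by
      have : s = 0 := le_antisymm h1 h0
      rw [this, hq0]
      exact max_le (neg_nonpos.2 (hq₀ j)) le_rfl
    have h2 := runMax_nonneg (hc3 j) (le_refl (0 : ℝ))
    simp [le_antisymm h1 h2]
  · filter_upwards [ae_all_iff.2 fun j => (hR j).2.2, ae_restrict_mem measurableSet_Ioi]
      with t ht (h0 : 0 < t)
    exact ⟨hd1 t h0, hd2 t h0, ht⟩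

end ReflectedFlow

/-! ### Global existence for the transformed system -/

lemma LocallyLipschitz.pi {α ι : Type*} [PseudoEMetricSpace α] [Fintype ι] {β : ι → Type*}
    [∀ i, PseudoEMetricSpace (β i)] {f : ∀ i, α → β i} (hf : ∀ i, LocallyLipschitz (f i)) :
    LocallyLipschitz (fun p i => f i p) := by
  intro x
  choose K t ht hK using fun i => hf i x
  refine ⟨∑ i, K i, ⋂ i, t i, Filter.iInter_mem.2 ht, fun p hp q hq => ?_⟩
  refine edist_pi_le_iff.2 fun i => ?_
  refine (hK i (Set.mem_iInter.1 hp i) (Set.mem_iInter.1 hq i)).trans ?_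
  gcongr
  exact Finset.single_le_sum (fun _ _ => zero_le) (Finset.mem_univ i)

section GlobalExistence

variable {N m l n : ℕ}

/-- Componentwise truncation to `[-R, R]`. -/
noncomputable def clampState (R : ℝ) (p : State N m l n) : State N m l n :=
  (fun ℓ i => max (-R) (min (p.1 ℓ i) R), fun j => max (-R) (min (p.2.1 j) R),
    fun j => max (-R) (min (p.2.2 j) R))

lemma dist_clamp_le (R a b : ℝ) :
    dist (max (-R) (min a R)) (max (-R) (min b R)) ≤ dist a b := by
  have h1 : LipschitzWith 1 fun a : ℝ => max (-R) (min a R) :=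
    (LipschitzWith.id.min_const R).const_max (-R)
  simpa using h1.dist_le_mul a b

lemma lipschitz_clampState (R : ℝ) : LipschitzWith 1 (clampState (N := N) (m := m) (l := l) (n := n) R) := by
  refine LipschitzWith.of_dist_le_mul fun p q => ?_
  rw [NNReal.coe_one, one_mul]
  have h1 : dist p.1 q.1 ≤ dist p q := le_max_left _ _
  have h2 : dist p.2.1 q.2.1 ≤ dist p q := (le_max_left _ _).trans (le_max_right _ _)
  have h3 : dist p.2.2 q.2.2 ≤ dist p q := (le_max_right _ _).trans (le_max_right _ _)
  refine max_le ?_ (max_le ?_ ?_)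
  · refine (dist_pi_le_iff dist_nonneg).2 fun ℓ => (dist_pi_le_iff dist_nonneg).2 fun i => ?_
    exact (dist_clamp_le R _ _).trans ((dist_le_pi_dist (p.1 ℓ) (q.1 ℓ) i).trans
      ((dist_le_pi_dist p.1 q.1 ℓ).trans h1))
  · exact (dist_pi_le_iff dist_nonneg).2 fun j =>
      (dist_clamp_le R _ _).trans ((dist_le_pi_dist p.2.1 q.2.1 j).trans h2)
  · exact (dist_pi_le_iff dist_nonneg).2 fun j =>
      (dist_clamp_le R _ _).trans ((dist_le_pi_dist p.2.2 q.2.2 j).trans h3)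

lemma norm_clampState_le {R : ℝ} (hR : 0 ≤ R) (p : State N m l n) : ‖clampState R p‖ ≤ R := by
  have h : ∀ a : ℝ, |max (-R) (min a R)| ≤ R := fun a =>
    abs_le.2 ⟨le_max_left _ _, max_le (by linarith) (min_le_right _ _)⟩
  exact norm_state_le hR (fun _ _ => h _) (fun _ => h _) (fun _ => h _)

lemma clampState_eq {R : ℝ} {p : State N m l n} (hp : ‖p‖ ≤ R) : clampState R p = p := by
  have h : ∀ a : ℝ, |a| ≤ R → max (-R) (min a R) = a := fun a ha => by
    rw [min_eq_left (abs_le.1 ha).2, max_eq_right (abs_le.1 ha).1]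
  refine Prod.ext (funext fun ℓ => funext fun i => h _ ?_)
    (Prod.ext (funext fun j => h _ ?_) (funext fun j => h _ ?_))
  · exact (norm_le_pi_norm (p.1 ℓ) i).trans
      ((norm_le_pi_norm p.1 ℓ).trans ((norm_fst_le p).trans hp))
  · exact (norm_le_pi_norm p.2.1 j).trans ((norm_fst_le p.2).trans ((norm_snd_le p).trans hp))
  · exact (norm_le_pi_norm p.2.2 j).trans ((norm_snd_le p.2).trans ((norm_snd_le p).trans hp))

/-- Scalar cutoff, equal to `1` for `‖p‖ ≤ R - 1` and to `0` for `‖p‖ ≥ R`. -/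
noncomputable def cutoff (R : ℝ) (p : State N m l n) : ℝ := max 0 (min 1 (R - ‖p‖))

lemma cutoff_nonneg (R : ℝ) (p : State N m l n) : 0 ≤ cutoff R p := le_max_left _ _

lemma cutoff_le_one (R : ℝ) (p : State N m l n) : cutoff R p ≤ 1 :=
  max_le zero_le_one (min_le_left _ _)

lemma cutoff_eq_one {R : ℝ} {p : State N m l n} (hp : ‖p‖ ≤ R - 1) : cutoff R p = 1 := by
  rw [cutoff, min_eq_left (by linarith), max_eq_right zero_le_one]

lemma lipschitz_cutoff (R : ℝ) : LipschitzWith 1 (cutoff (N := N) (m := m) (l := l) (n := n) R) := by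
  have h1 : LipschitzWith 1 fun p : State N m l n => R - ‖p‖ := by
    refine LipschitzWith.of_dist_le_mul fun p q => ?_
    rw [NNReal.coe_one, one_mul, Real.dist_eq, dist_eq_norm, sub_sub_sub_cancel_left,
      abs_sub_comm]
    exact abs_norm_sub_norm_le p q
  exact (h1.const_min 1).const_max 0

lemma cutoff_smul_clamp {R : ℝ} (X : State N m l n → State N m l n) (p : State N m l n) :
    cutoff R p • X (clampState R p) = cutoff R p • X p := by
  rcases le_total ‖p‖ R with h | h
  · rw [clampState_eq h]
  · have : cutoff R p = 0 := by
      rw [cutoff]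
      exact max_eq_left ((min_le_right _ _).trans (by linarith))
    rw [this, zero_smul, zero_smul]

variable [NeZero n] {g : SharedGame N m l} {k₁ : ℝ} {k : Fin N → Fin n → ℝ}

lemma locallyLipschitz_flowField (hg : g.Regular n) : LocallyLipschitz (flowField g k₁ k) :=
  (LocallyLipschitz.pi fun ℓ => LocallyLipschitz.pi fun i =>
    locallyLipschitz_transformedRhs hg ℓ i).prodMk
  ((LocallyLipschitz.pi fun j => locallyLipschitz_H hg j).prodMk
    (LocallyLipschitz.pi fun j => locallyLipschitz_G hg j))

/-- The transformed system is globally solvable. -/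
theorem exists_transformedSolution (hg : g.Regular n) {c : ℝ} (hc : 0 ≤ c) {ys : Fin N → ℝ}
    {lams : Fin m → ℝ} {mus : Fin l → ℝ} (hD : Dissipative g k₁ k c ys lams mus)
    (z₀ : Fin n → Fin N → ℝ) (lam₀ : Fin m → ℝ) {mu₀ : Fin l → ℝ} (hmu₀ : mu₀ ∈ nonnegOrthant l) :
    ∃ z lam mu, IsTransformedSolution g k₁ k z lam mu ∧ z 0 = z₀ ∧ lam 0 = lam₀ ∧ mu 0 = mu₀ := by
  obtain ⟨B, hB⟩ := exists_norm_bound (n := n) ys lams mus (energy ys lams mus (z₀, lam₀, mu₀))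
  have hB0 : 0 ≤ B := (norm_nonneg _).trans (hB _ le_rfl)
  set R := B + 1 with hR
  have hR0 : 0 ≤ R := by linarith
  have hball : ∀ p : State N m l n, clampState R p ∈ Metric.closedBall (0 : State N m l n) R :=
    fun p => by simpa using norm_clampState_le hR0 p
  set X : State N m l n → State N m l n := flowField g k₁ k with hX
  obtain ⟨K, hK⟩ := (locallyLipschitz_flowField (k₁ := k₁) (k := k) hg).locallyLipschitzOn
    |>.exists_lipschitzOnWith_of_compact (isCompact_closedBall (0 : State N m l n) R)
  obtain ⟨C, hC⟩ := (isCompact_closedBall (0 : State N m l n) R).exists_bound_of_continuousOn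
    (continuous_flowField (k₁ := k₁) (k := k) hg).continuousOn
  have hC' : ∀ p, ‖X (clampState R p)‖ ≤ C := fun p => hC _ (hball p)
  have hC0 : 0 ≤ C := (norm_nonneg _).trans (hC' 0)
  set Y : State N m l n → State N m l n := fun p => cutoff R p • X (clampState R p) with hY
  have hYb : ∀ p, ‖Y p‖ ≤ C := fun p => by
    rw [hY, norm_smul, Real.norm_eq_abs, abs_of_nonneg (cutoff_nonneg R p)]
    exact (mul_le_of_le_one_left (norm_nonneg _) (cutoff_le_one R p)).trans (hC' p)
  have hYl : LipschitzWith (C.toNNReal + K) Y := by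
    refine LipschitzWith.of_dist_le_mul fun p q => ?_
    have h1 : Y p - Y q = (cutoff R p - cutoff R q) • X (clampState R p) +
        cutoff R q • (X (clampState R p) - X (clampState R q)) := by
      rw [hY, sub_smul, smul_sub]; abel
    rw [dist_eq_norm, h1, NNReal.coe_add, Real.coe_toNNReal _ hC0, add_mul]
    refine (norm_add_le _ _).trans (add_le_add ?_ ?_)
    · rw [norm_smul, mul_comm]
      refine mul_le_mul (hC' p) ?_ (norm_nonneg _) hC0
      simpa [Real.dist_eq] using (lipschitz_cutoff R).dist_le_mul p q
    · rw [norm_smul, Real.norm_eq_abs, abs_of_nonneg (cutoff_nonneg R q)]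
      refine (mul_le_of_le_one_left (norm_nonneg _) (cutoff_le_one R q)).trans ?_
      rw [← dist_eq_norm]
      refine (hK.dist_le_mul _ (hball p) _ (hball q)).trans
        (mul_le_mul_of_nonneg_left ?_ K.2)
      simpa using (lipschitz_clampState R).dist_le_mul p q
  obtain ⟨w, hw0, hac1, hac2, hac3, hnn, hode⟩ :=
    exists_reflected_flow hYl hYb (z₀, lam₀, mu₀) hmu₀
  have hYe : ∀ p, Y p = cutoff R p • X p := fun p => cutoff_smul_clamp X p
  have hsol : IsScaledSolution g k₁ k (fun t => cutoff R (w t)) (fun t => (w t).1)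
      (fun t => (w t).2.1) (fun t => (w t).2.2) :=
    { nonneg := fun t _ => cutoff_nonneg R _
      z_ac := hac1
      lam_ac := hac2
      mu_ac := hac3
      mu_nonneg := hnn
      z_ode := by
        filter_upwards [hode] with t ht ℓ i
        have := ht.1 ℓ i
        rwa [hYe] at this
      lam_ode := by
        filter_upwards [hode] with t ht j
        have := ht.2.1 j
        rwa [hYe] at this
      mu_ode := by
        filter_upwards [hode] with t ht j
        have := ht.2.2 j
        rw [hYe] at this
        rw [← projRate_mul (cutoff_nonneg R _)]
        exact this }
  refine ⟨_, _, _, hsol.transformed fun t ht => cutoff_eq_one ?_, ?_, ?_, ?_⟩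
  · have h1 := hsol.energy_antitone hc hD le_rfl ht
    simp only [hw0] at h1
    have h2 := hB (w t) h1
    linarith
  · simp [hw0]
  · simp [hw0]
  · simp [hw0]

end GlobalExistence

/-! ### Regularity along transformed solutions -/

lemma contDiff_partialAt {N n : ℕ} {φ : (Fin N → ℝ) → ℝ} {a : ℕ} (hφ : ContDiff ℝ n φ) (ha : a + 1 ≤ n)
    (i : Fin N) : ContDiff ℝ a (partialAt φ i) := by
  have h1 : ContDiff ℝ a (fderiv ℝ φ) := hφ.fderiv_right (by exact_mod_cast ha)
  exact h1.clm_apply contDiff_const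

lemma tower_firstBlocks {N n : ℕ} {Ω : Type} {R : RegClass Ω} {x : Ω → ℝ → Fin n → Fin N → ℝ} {a : ℕ}
    (r : Fin n)
    (hx : ∀ (s : Fin n) i, s.val ≤ r.val → R.Tower a (fun ω t => x ω t s i))
    {φ : (Fin (r.val + 1) → Fin N → ℝ) → ℝ} (hφ : ContDiff ℝ a φ) :
    R.Tower a (fun ω t => φ (firstBlocks (x ω t) r)) :=
  RegClass.Tower.comp₂ (c := fun p i ω t => x ω t ⟨p.val, by omega⟩ i) hφ
    fun p i => hx ⟨p.val, by omega⟩ i (by simp; omega)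

lemma tower_gainProd {N n : ℕ} {Ω : Type} {R : RegClass Ω} {S : StrictFeedback N n}
    {x : Ω → ℝ → Fin n → Fin N → ℝ} (hS : S.Regular) {a q : ℕ}
    (ha : ∀ r : Fin n, r.val < q → a ≤ n - 1 - r.val)
    (hx : ∀ (s : Fin n) i, s.val < q → R.Tower a (fun ω t => x ω t s i)) (i : Fin N) :
    R.Tower a (fun ω t => S.gainProd (x ω t) q i) ∧
      R.Tower a (fun ω t => (S.gainProd (x ω t) q i)⁻¹) := by
  have hΘ : ∀ r : Fin n, r.val < q → ContDiff ℝ a (S.Θ r i) := fun r hr =>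
    (hS.smooth_Θ r i).of_le (by exact_mod_cast ha r hr)
  constructor
  · refine RegClass.Tower.prod _ fun r hr => ?_
    have hr' : r.val < q := by simpa using hr
    exact tower_firstBlocks r (fun s i hs => hx s i (by omega)) (hΘ r hr')
  · simp only [StrictFeedback.gainProd, ← Finset.prod_inv_distrib]
    refine RegClass.Tower.prod _ fun r hr => ?_
    have hr' : r.val < q := by simpa using hr
    exact tower_firstBlocks (φ := fun y => (S.Θ r i y)⁻¹) r (fun s i hs => hx s i (by omega))
      ((hΘ r hr').inv fun y => hS.ne_zero r i y)

section Towers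

variable {N m l n : ℕ} [NeZero n] {g : SharedGame N m l} {k₁ : ℝ} {k : Fin N → Fin n → ℝ}
  {Ω : Type}

/-- Families of curves that satisfy the transformed equations for right derivatives, with the
regularity that makes the gradients of the Lagrangians regular to the order `A` and the states
`z_p` to the order `B - p`. -/
structure TowerData (g : SharedGame N m l) (k₁ : ℝ) (k : Fin N → Fin n → ℝ) (R : RegClass Ω)
    (A B : ℕ) (z : Ω → ℝ → Fin n → Fin N → ℝ) (lam : Ω → ℝ → Fin m → ℝ)
    (mu : Ω → ℝ → Fin l → ℝ) : Prop where
  A_lt : A + 1 ≤ n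
  A_le : A ≤ B
  B_le : B ≤ A + 1
  z_ode : ∀ ω t, 0 ≤ t → ∀ ℓ i, rightDeriv (fun s => z ω s ℓ i) t =
    transformedRhs g k₁ k (z ω t) (lam ω t) (mu ω t) ℓ i
  lam_ode : ∀ ω t, 0 ≤ t → ∀ j, rightDeriv (fun s => lam ω s j) t = k₁ * g.H j (z ω t 0)
  zQ : ∀ (p : Fin n) i, p.val < B → R.Q (fun ω t => z ω t p i)
  zP : ∀ (p : Fin n) i, p.val ≤ B → R.P (fun ω t => z ω t p i)
  lamQ : ∀ j, R.Q (fun ω t => lam ω t j)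
  muP : ∀ j, R.P (fun ω t => mu ω t j)
  mu_step : ∀ a j, a + 1 ≤ A → R.Tower a (fun ω t => k₁ * g.G j (z ω t 0)) →
    R.Tower (a + 1) (fun ω t => mu ω t j)

variable {R : RegClass Ω} {A B : ℕ} {z : Ω → ℝ → Fin n → Fin N → ℝ} {lam : Ω → ℝ → Fin m → ℝ}
  {mu : Ω → ℝ → Fin l → ℝ}

namespace TowerData

lemma tower_z_pos (h : TowerData g k₁ k R A B z lam mu) (d : ℕ) (p : Fin n) (i : Fin N)
    (hp : 1 ≤ p.val) (hd : p.val + d ≤ B) : R.Tower d (fun ω t => z ω t p i) := by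
  induction d generalizing p with
  | zero => exact h.zP p i (by omega)
  | succ d ih =>
    have hp0 : p ≠ 0 := by rintro rfl; simp at hp
    have h1 : R.Tower d (fun ω t => -k i p * z ω t p i +
        (if hn : p.val + 1 < n then z ω t ⟨p.val + 1, hn⟩ i else 0)) := by
      refine RegClass.Tower.add (RegClass.Tower.const_mul _ (ih p hp (by omega))) ?_
      by_cases hn : p.val + 1 < n
      · simp only [hn, dif_pos]
        exact ih ⟨p.val + 1, hn⟩ (by simp) (by simp; omega)
      · simp only [hn, dif_neg, not_false_eq_true]
        exact RegClass.Tower.const _ _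
    refine RegClass.Tower.of_deriv (h.zQ p i (by omega)) h1 fun ω t ht => ?_
    rw [h.z_ode ω t ht, transformedRhs, if_neg hp0]

lemma tower_z_zero_succ (h : TowerData g k₁ k R A B z lam mu) {a : ℕ} (ha : a + 1 ≤ B)
    (hG : ∀ i, R.Tower a (fun ω t => g.gradL i (lam ω t) (mu ω t) (z ω t 0))) (i : Fin N) :
    R.Tower (a + 1) (fun ω t => z ω t 0 i) := by
  have h1 : R.Tower a (fun ω t => -k₁ * g.gradL i (lam ω t) (mu ω t) (z ω t 0) +
      (if hn : (0 : Fin n).val + 1 < n then z ω t ⟨(0 : Fin n).val + 1, hn⟩ i else 0)) := by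
    refine RegClass.Tower.add (RegClass.Tower.const_mul _ (hG i)) ?_
    by_cases hn : (0 : Fin n).val + 1 < n
    · simp only [hn, dif_pos]
      exact h.tower_z_pos a ⟨(0 : Fin n).val + 1, hn⟩ i (by simp) (by simp; omega)
    · simp only [hn, dif_neg, not_false_eq_true]
      exact RegClass.Tower.const _ _
  refine RegClass.Tower.of_deriv (h.zQ 0 i (by simp; omega)) h1 fun ω t ht => ?_
  rw [h.z_ode ω t ht, transformedRhs, if_pos rfl]

/-- Composition of a function of the decisions with the curves. -/
lemma tower_comp_y {a : ℕ} (hy : ∀ i, R.Tower a (fun ω t => z ω t 0 i))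
    {φ : (Fin N → ℝ) → ℝ} (hφ : ContDiff ℝ a φ) : R.Tower a (fun ω t => φ (z ω t 0)) :=
  RegClass.Tower.comp (c := fun i ω t => z ω t 0 i) hφ hy

lemma tower_gradL_of (hg : g.Regular n) {a : ℕ} (ha : a + 1 ≤ n)
    (hy : ∀ i, R.Tower a (fun ω t => z ω t 0 i)) (hl : ∀ j, R.Tower a (fun ω t => lam ω t j))
    (hm : ∀ j, R.Tower a (fun ω t => mu ω t j)) (i : Fin N) :
    R.Tower a (fun ω t => g.gradL i (lam ω t) (mu ω t) (z ω t 0)) := by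
  simp only [hg.gradL_eq]
  refine RegClass.Tower.add (RegClass.Tower.add ?_ (RegClass.Tower.sum _ fun j _ => ?_))
    (RegClass.Tower.sum _ fun j _ => ?_)
  · exact tower_comp_y hy (φ := fun y => g.pseudoGrad y i)
      (contDiff_partialAt (hg.smooth_f i) ha i)
  · exact (hl j).mul (RegClass.Tower.const _ _)
  · exact (hm j).mul (tower_comp_y hy (contDiff_partialAt (hg.smooth_G j) ha i))

lemma tower_gradL (hg : g.Regular n) (h : TowerData g k₁ k R A B z lam mu) (a : ℕ) (ha : a ≤ A)
    (i : Fin N) : R.Tower a (fun ω t => g.gradL i (lam ω t) (mu ω t) (z ω t 0)) := by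
  have hAn := h.A_lt
  have hAB := h.A_le
  induction a generalizing i with
  | zero =>
    refine tower_gradL_of hg (by omega) (fun i => ?_) (fun j => ?_) (fun j => ?_) i
    · exact h.zP 0 i (by simp)
    · exact R.P_of_Q (h.lamQ j)
    · exact h.muP j
  | succ a ih =>
    have hy := h.tower_z_zero_succ (show a + 1 ≤ B by omega) (ih (by omega))
    have hy' := fun i => (hy i).pred
    refine tower_gradL_of hg (by omega) hy (fun j => ?_) (fun j => ?_) i
    · refine RegClass.Tower.of_deriv (h.lamQ j) ?_ fun ω t ht => h.lam_ode ω t ht j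
      exact RegClass.Tower.const_mul _ (tower_comp_y hy' (hg.contDiff_H j))
    · refine h.mu_step a j ha (RegClass.Tower.const_mul _ (tower_comp_y hy' ?_))
      exact (hg.smooth_G j).of_le (by exact_mod_cast (by omega : a ≤ n))

lemma tower_z (hg : g.Regular n) (h : TowerData g k₁ k R A B z lam mu) (p : Fin n) (i : Fin N)
    (hp : p.val ≤ B) : R.Tower (B - p.val) (fun ω t => z ω t p i) := by
  have hBA := h.B_le
  rcases Nat.eq_zero_or_pos p.val with h0 | hpos
  · have hp0 : p = 0 := Fin.ext (by simpa using h0)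
    subst hp0
    rcases Nat.eq_zero_or_pos B with hB | hB
    · have := h.zP 0 i (by simp)
      rw [hB, Nat.zero_sub]
      exact this
    · obtain ⟨b, rfl⟩ : ∃ b, B = b + 1 := ⟨B - 1, by omega⟩
      simpa using h.tower_z_zero_succ le_rfl (fun i => h.tower_gradL hg b (by omega) i) i
  · exact h.tower_z_pos _ p i hpos (by omega)

end TowerData

/-! ### Regularity of the plant states -/

variable {S : StrictFeedback N n} {x : Ω → ℝ → Fin n → Fin N → ℝ}

/-- The coordinate change along families of curves. -/
def CoordRel (S : StrictFeedback N n) (g : SharedGame N m l) (k₁ : ℝ) (k : Fin N → Fin n → ℝ)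
    (x z : Ω → ℝ → Fin n → Fin N → ℝ) (lam : Ω → ℝ → Fin m → ℝ) (mu : Ω → ℝ → Fin l → ℝ) : Prop :=
  ∀ ω t, 0 ≤ t → z ω t 0 = x ω t 0 ∧ ∀ (ℓ : Fin n) i, 1 ≤ ℓ.val →
    z ω t ℓ i = bracket S g k₁ k (x ω) (z ω) (lam ω) (mu ω) ℓ.val i t +
      S.gainProd (x ω t) ℓ.val i * x ω t ℓ i

namespace TowerData

lemma tower_lead (hS : S.Regular) (hg : g.Regular n) (h : TowerData g k₁ k R A B z lam mu)
    (hc : CoordRel S g k₁ k x z lam mu) (i : Fin N) :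
    R.Tower A (fun ω => leadTerm S g k₁ (x ω) (lam ω) (mu ω) i) := by
  have hAn := h.A_lt
  have hx0 : ∀ i, R.Tower A (fun ω t => x ω t 0 i) := fun i => by
    have h1 : R.Tower (B - (0 : Fin n).val) (fun ω t => z ω t 0 i) := h.tower_z hg 0 i (by simp)
    refine (h1.mono (by simpa using h.A_le)).congr fun ω t ht => ?_
    show z ω t 0 i = x ω t 0 i
    rw [(hc ω t ht).1]
  have h1 : R.Tower A (fun ω t => k₁ * g.gradL i (lam ω t) (mu ω t) (x ω t 0)) := by
    refine (RegClass.Tower.const_mul k₁ (h.tower_gradL hg A le_rfl i)).congr fun ω t ht => ?_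
    show k₁ * g.gradL i (lam ω t) (mu ω t) (z ω t 0) = _
    rw [(hc ω t ht).1]
  refine RegClass.Tower.add h1 (tower_firstBlocks 0 (fun s i hs => ?_) ?_)
  · have : s = 0 := Fin.ext (by simpa using hs)
    rw [this]; exact hx0 i
  · exact (hS.smooth_Γ 0 i).of_le (by exact_mod_cast (by simp; omega))

lemma tower_inner (hS : S.Regular) (h : TowerData g k₁ k R A B z lam mu) {q : Fin n}
    (hqA : q.val ≤ A)
    (hx : ∀ (s : Fin n) i, s.val ≤ q.val → R.Tower (B - s.val) (fun ω t => x ω t s i))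
    (i : Fin N) : R.Tower (A - q.val) (fun ω => innerTerm S (x ω) q i) := by
  have hAn := h.A_lt
  have hAB := h.A_le
  have hgain := (tower_gainProd (R := R) (x := x) hS (a := A - q.val + 1) (q := q.val)
    (fun r hr => by omega) (fun s i hs => (hx s i (by omega)).mono (by omega)) i).1
  refine RegClass.Tower.add (RegClass.Tower.mul ((hx q i le_rfl).mono (by omega)) hgain.deriv)
    (RegClass.Tower.mul hgain.pred (tower_firstBlocks q (fun s i hs => ?_) ?_))
  · exact (hx s i hs).mono (by omega)
  · exact (hS.smooth_Γ q i).of_le (by exact_mod_cast (by omega))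

lemma tower_bracket (hS : S.Regular) (hg : g.Regular n) (h : TowerData g k₁ k R A B z lam mu)
    (hc : CoordRel S g k₁ k x z lam mu) {p : ℕ} (hp : 1 ≤ p) (hpA : p ≤ A + 1)
    (hx : ∀ (s : Fin n) i, s.val < p → R.Tower (B - s.val) (fun ω t => x ω t s i)) (i : Fin N) :
    R.Tower (A + 1 - p) (fun ω => bracket S g k₁ k (x ω) (z ω) (lam ω) (mu ω) p i) := by
  have hAB := h.A_le
  refine RegClass.Tower.add (RegClass.Tower.add (RegClass.Tower.sum _ fun q hq => ?_) ?_)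
    (RegClass.Tower.sum _ fun q hq => ?_)
  · have hq' : 1 ≤ q.val ∧ q.val < p := by simpa using hq
    exact RegClass.Tower.const_mul _ ((h.tower_z hg q i (by omega)).mono (by omega))
  · refine RegClass.Tower.iterate ((h.tower_lead hS hg hc i).mono (by omega))
  · have hq' : 1 ≤ q.val ∧ q.val < p := by simpa using hq
    refine RegClass.Tower.iterate ((h.tower_inner hS (q := q) (by omega)
      (fun s i hs => hx s i (by omega)) i).mono (by omega))

/-- Regularity of the plant states. -/
theorem tower_x (hS : S.Regular) (hg : g.Regular n) (h : TowerData g k₁ k R A B z lam mu)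
    (hc : CoordRel S g k₁ k x z lam mu) (p : Fin n) (i : Fin N) (hp : p.val ≤ B) :
    R.Tower (B - p.val) (fun ω t => x ω t p i) := by
  have hAn := h.A_lt
  have hBA := h.B_le
  have hAB := h.A_le
  obtain ⟨P, hP⟩ : ∃ P, p.val = P := ⟨_, rfl⟩
  induction P using Nat.strong_induction_on generalizing p i with
  | _ P ih =>
    have hx : ∀ (s : Fin n) i, s.val < p.val → R.Tower (B - s.val) (fun ω t => x ω t s i) :=
      fun s i hs => ih s.val (by omega) s i (by omega) rfl
    rcases Nat.eq_zero_or_pos p.val with h0 | hpos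
    · have hp0 : p = 0 := Fin.ext (by simpa using h0)
      subst hp0
      refine (h.tower_z hg 0 i hp).congr fun ω t ht => ?_
      show z ω t 0 i = x ω t 0 i
      rw [(hc ω t ht).1]
    · have hginv := (tower_gainProd (R := R) (x := x) hS (a := B - p.val) (q := p.val)
        (fun r hr => by omega) (fun s i hs => (hx s i hs).mono (by omega)) i).2
      have hbr := (h.tower_bracket hS hg hc hpos (by omega) hx i).mono
        (show B - p.val ≤ A + 1 - p.val by omega)
      refine (((h.tower_z hg p i hp).sub hbr).mul hginv).congr fun ω t ht => ?_
      show (z ω t p i - bracket S g k₁ k (x ω) (z ω) (lam ω) (mu ω) p.val i t) *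
        (S.gainProd (x ω t) p.val i)⁻¹ = x ω t p i
      rw [(hc ω t ht).2 p i hpos]
      have := StrictFeedback.gainProd_ne_zero hS (x ω t) p.val i
      field_simp
      ring

end TowerData

end Towers

/-! ### Signs and selections of derivatives -/

/-- A function whose first nonzero right derivative at `t` has the sign `σ` keeps this sign right
after `t`. -/
lemma RegClass.Tower.sign_after {b : ℕ} {v : ℝ → ℝ} {σ t : ℝ}
    (hv : (RegClass.contClass Unit).Tower b (fun _ => v)) (ht : 0 ≤ t)
    (h0 : ∀ s < b, rightDeriv^[s] v t = 0) (hb : 0 < σ * rightDeriv^[b] v t) :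
    ∃ ε > 0, ∀ s ∈ Set.Ico t (t + ε), 0 ≤ σ * v s := by
  induction b generalizing v with
  | zero =>
    have hc : ContinuousOn v (Set.Ici 0) := hv ()
    have h1 : Tendsto (fun s => σ * v s) (𝓝[≥] t) (𝓝 (σ * v t)) :=
      (((hc t ht).mono fun _ (hs : t ≤ _) => le_trans ht hs)).const_mul σ
    obtain ⟨d, hd, H⟩ := mem_nhdsGE_iff_exists_Ico_subset.1 (h1.eventually (lt_mem_nhds hb))
    refine ⟨d - t, sub_pos.2 hd, fun s hs => ?_⟩
    have hs' : s ∈ Set.Ico t d := ⟨hs.1, by linarith [hs.2]⟩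
    exact (show 0 < σ * v s from H hs').le
  | succ b ih =>
    obtain ⟨ε, hε, H⟩ := ih hv.deriv (fun s hs => h0 (s + 1) (by omega)) hb
    have hQ : ContinuousOn v (Set.Ici 0) ∧ RDiff v := hv.Q ()
    refine ⟨ε, hε, fun s hs => ?_⟩
    have hv0 : v t = 0 := h0 0 (by omega)
    refine image_le_of_deriv_right_le_deriv_boundary (f := fun _ => 0) (f' := fun _ => 0)
      (B := fun r => σ * v r) (B' := fun r => σ * rightDeriv v r) (a := t) (b := s)
      continuousOn_const (fun _ _ => hasDerivWithinAt_const _ _ _) (by simp [hv0])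
      (continuousOn_const.mul (hQ.1.mono fun r hr => ht.trans hr.1))
      (fun r hr => (hQ.2.hasDeriv (ht.trans hr.1)).const_mul σ)
      (fun r hr => H r ⟨hr.1, hr.2.trans hs.2⟩) ⟨hs.1, le_rfl⟩

namespace IsReflected

variable {μ v : ℝ → ℝ}

lemma projRate_eq_or (a b : ℝ) : projRate a b = b ∨ projRate a b = 0 := by
  unfold projRate
  split_ifs
  · exact Or.inl rfl
  · rcases le_total b 0 with h | h
    · exact Or.inr (max_eq_right h)
    · exact Or.inl (max_eq_left h)

/-- Right after any time, the rate either equals the drive or vanishes, unless all right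
derivatives of the drive vanish. -/
lemma rate_trichotomy (h : IsReflected μ v) {A : ℕ}
    (hv : (RegClass.contClass Unit).Tower A (fun _ => v)) {t : ℝ} (ht : 0 ≤ t) :
    (∃ ε > 0, Set.EqOn (fun s => projRate (μ s) (v s)) v (Set.Ico t (t + ε))) ∨
    (∃ ε > 0, Set.EqOn (fun s => projRate (μ s) (v s)) (fun _ => 0) (Set.Ico t (t + ε))) ∨
    ∀ b ≤ A, rightDeriv^[b] v t = 0 := by
  rcases (h.nonneg t ht).lt_or_eq with hpos | hzero
  · left
    have hμ : Tendsto μ (𝓝[≥] t) (𝓝 (μ t)) :=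
      (h.ac.continuousOn t ht).mono fun _ (hs : t ≤ _) => le_trans ht hs
    obtain ⟨d, hd, H⟩ := mem_nhdsGE_iff_exists_Ico_subset.1 (hμ.eventually (lt_mem_nhds hpos))
    refine ⟨d - t, sub_pos.2 hd, fun s hs => ?_⟩
    have hs' : s ∈ Set.Ico t d := ⟨hs.1, by linarith [hs.2]⟩
    have : 0 < μ s := H hs'
    simp [projRate, this]
  · by_cases hall : ∀ b ≤ A, rightDeriv^[b] v t = 0
    · exact Or.inr (Or.inr hall)
    · push Not at hall
      classical
      have hfind := Nat.find_spec hall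
      set b := Nat.find hall with hbdef
      have hmin : ∀ s < b, rightDeriv^[s] v t = 0 := fun s hs => by
        by_contra hne
        exact Nat.find_min hall hs ⟨by omega, hne⟩
      have hvb := hv.mono hfind.1
      rcases lt_or_gt_of_ne hfind.2 with hneg | hpos
      · right; left
        obtain ⟨ε, hε, H⟩ := hvb.sign_after (σ := -1) ht hmin (by linarith)
        refine ⟨ε, hε, fun s hs => ?_⟩
        have hμs : μ s = 0 := h.eq_zero_of_nonpos (b := t + ε) ht hzero.symm
          (fun r hr => by linarith [H r ⟨hr.1.le, hr.2⟩]) hs.1 hs.2.le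
        have hvs : v s ≤ 0 := by linarith [H s hs]
        simp [projRate, hμs, hvs]
      · left
        obtain ⟨ε, hε, H⟩ := hvb.sign_after (σ := 1) ht hmin (by linarith)
        refine ⟨ε, hε, fun s hs => ?_⟩
        have hvs : 0 ≤ v s := by linarith [H s hs]
        simp [projRate, hvs]

lemma iterate_rightDeriv_zero (b : ℕ) : rightDeriv^[b] (fun _ => (0 : ℝ)) = fun _ => 0 := by
  induction b with
  | zero => rfl
  | succ b ih =>
    rw [Function.iterate_succ_apply', ih]
    funext t
    simp [rightDeriv]

lemma hasDeriv_iterate_rate (h : IsReflected μ v) {A b : ℕ}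
    (hv : (RegClass.contClass Unit).Tower A (fun _ => v)) (hb : b < A)
    (hsel : ∀ t, 0 ≤ t → rightDeriv^[b] (fun s => projRate (μ s) (v s)) t = rightDeriv^[b] v t ∨
      rightDeriv^[b] (fun s => projRate (μ s) (v s)) t = 0) {t : ℝ} (ht : 0 ≤ t) :
    ∃ d, HasDerivWithinAt (rightDeriv^[b] (fun s => projRate (μ s) (v s))) d (Set.Ici t) t ∧
      (d = rightDeriv^[b + 1] v t ∨ d = 0) := by
  have hvd : HasDerivWithinAt (rightDeriv^[b] v) (rightDeriv^[b + 1] v t) (Set.Ici t) t := by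
    rw [Function.iterate_succ_apply']
    exact RDiff.hasDeriv (fun t ht => hv.rightDifferentiable () b hb t ht) ht
  have hmem : ∀ ε > 0, Set.Ico t (t + ε) ∈ 𝓝[≥] t := fun ε hε =>
    Ico_mem_nhdsGE (by linarith)
  rcases h.rate_trichotomy hv ht with ⟨ε, hε, H⟩ | ⟨ε, hε, H⟩ | H
  · have H' := iterate_rightDeriv_congr_Ico H b
    refine ⟨_, hvd.congr_of_eventuallyEq ?_ (H' ⟨le_rfl, by linarith⟩), Or.inl rfl⟩
    filter_upwards [hmem ε hε] with s hs using H' hs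
  · have H' := iterate_rightDeriv_congr_Ico H b
    rw [iterate_rightDeriv_zero] at H'
    refine ⟨0, (hasDerivWithinAt_const t (Set.Ici t) (0 : ℝ)).congr_of_eventuallyEq ?_
      (H' ⟨le_rfl, by linarith⟩), Or.inr rfl⟩
    filter_upwards [hmem ε hε] with s hs using H' hs
  · refine ⟨0, ?_, Or.inr rfl⟩
    rw [H (b + 1) hb, hasDerivWithinAt_iff_isLittleO] at hvd
    have hvt := H b hb.le
    have hrt : rightDeriv^[b] (fun s => projRate (μ s) (v s)) t = 0 := by
      rcases hsel t ht with e | e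
      · rw [e, hvt]
      · exact e
    rw [hasDerivWithinAt_iff_isLittleO]
    refine Asymptotics.IsBigO.trans_isLittleO (Asymptotics.IsBigO.of_bound 1 ?_) hvd
    filter_upwards [self_mem_nhdsWithin] with s hs
    rw [hrt, hvt]
    rcases hsel s (ht.trans hs) with e | e <;> rw [e] <;> simp

/-- Each right derivative of the rate equals that of the drive or vanishes, at every time. -/
lemma iterate_rate_eq_or (h : IsReflected μ v) {A : ℕ}
    (hv : (RegClass.contClass Unit).Tower A (fun _ => v)) (b : ℕ) (hb : b ≤ A) {t : ℝ}
    (ht : 0 ≤ t) :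
    rightDeriv^[b] (fun s => projRate (μ s) (v s)) t = rightDeriv^[b] v t ∨
      rightDeriv^[b] (fun s => projRate (μ s) (v s)) t = 0 := by
  induction b generalizing t with
  | zero => exact projRate_eq_or _ _
  | succ b ih =>
    obtain ⟨d, hd, hor⟩ := h.hasDeriv_iterate_rate hv hb (fun t ht => ih (by omega) ht) ht
    rw [Function.iterate_succ_apply' _ _ (fun s => projRate (μ s) (v s)), hd.rightDeriv_eq]
    exact hor

lemma rdiff_iterate_rate (h : IsReflected μ v) {A : ℕ}
    (hv : (RegClass.contClass Unit).Tower A (fun _ => v)) {b : ℕ} (hb : b < A) :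
    RDiff (rightDeriv^[b] (fun s => projRate (μ s) (v s))) := fun t ht => by
  obtain ⟨d, hd, -⟩ :=
    h.hasDeriv_iterate_rate hv hb (fun t ht => h.iterate_rate_eq_or hv b hb.le ht) ht
  exact hd.differentiableWithinAt

lemma abs_iterate_rate_le (h : IsReflected μ v) {A : ℕ}
    (hv : (RegClass.contClass Unit).Tower A (fun _ => v)) {b : ℕ} (hb : b ≤ A) {t : ℝ}
    (ht : 0 ≤ t) :
    |rightDeriv^[b] (fun s => projRate (μ s) (v s)) t| ≤ |rightDeriv^[b] v t| := by
  rcases h.iterate_rate_eq_or hv b hb ht with e | e <;> rw [e]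
  simp

/-- The rate inherits the settling of the drive. -/
lemma settle_rate (h : IsReflected μ v) {A a : ℕ} (haA : a ≤ A)
    (hv : (RegClass.contClass Unit).Tower A (fun _ => v))
    (hs : (RegClass.settleClass Unit).Tower a (fun _ => v)) :
    (RegClass.settleClass Unit).Tower a (fun _ t => projRate (μ t) (v t)) := by
  set r : ℝ → ℝ := fun s => projRate (μ s) (v s) with hr
  have hP : ∀ b ≤ a, RegClass.EvBdd (rightDeriv^[b] r) := fun b hb => by
    have h1 : (RegClass.settleClass Unit).Tower 0 (fun _ => rightDeriv^[b] v) :=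
      RegClass.Tower.iterate (hs.mono (by omega))
    obtain ⟨B, hB⟩ := h1 ()
    refine ⟨B, ?_⟩
    filter_upwards [hB, eventually_ge_atTop 0] with t ht h0
    exact (h.abs_iterate_rate_le hv (by omega) h0).trans ht
  have hT : ∀ b < a, Tendsto (rightDeriv^[b + 1] r) atTop (𝓝 0) := fun b hb => by
    have h1 : (RegClass.settleClass Unit).Tower 1 (fun _ => rightDeriv^[b] v) :=
      RegClass.Tower.iterate (hs.mono (by omega))
    have h2 : Tendsto (rightDeriv^[b + 1] v) atTop (𝓝 0) := by
      rw [Function.iterate_succ_apply']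
      exact (h1.Q ()).2.2
    refine squeeze_zero_norm' ?_ (tendsto_zero_iff_abs_tendsto_zero _ |>.1 h2)
    filter_upwards [eventually_ge_atTop 0] with t h0
    exact h.abs_iterate_rate_le hv (by omega) h0
  have key : ∀ d b, b + d = a → (RegClass.settleClass Unit).Tower d (fun _ => rightDeriv^[b] r) := by
    intro d
    induction d with
    | zero => exact fun b hb _ => hP b (by omega)
    | succ d ih =>
      intro b hb
      refine ⟨fun _ => ⟨hP b (by omega), h.rdiff_iterate_rate hv (by omega), ?_⟩, ?_⟩
      · have := hT b (by omega)
        rwa [Function.iterate_succ_apply'] at this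
      · have := ih (b + 1) (by omega)
        simpa only [Function.iterate_succ_apply'] using this
  exact key a 0 (by omega)

end IsReflected

lemma RegClass.Tower.tendsto_iterate {a b : ℕ} {h : ℝ → ℝ}
    (hh : (RegClass.settleClass Unit).Tower a (fun _ => h)) (h1 : 1 ≤ b) (hb : b ≤ a) :
    Tendsto (rightDeriv^[b] h) atTop (𝓝 0) := by
  obtain ⟨b, rfl⟩ : ∃ c, b = c + 1 := ⟨b - 1, by omega⟩
  have h1 : (RegClass.settleClass Unit).Tower 1 (fun _ => rightDeriv^[b] h) :=
    RegClass.Tower.iterate (hh.mono (by omega))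
  rw [Function.iterate_succ_apply']
  exact (h1.Q ()).2.2

/-! ### Trajectories -/

lemma StrictFeedback.tendsto_gainProd {N n : ℕ} {S : StrictFeedback N n} (hS : S.Regular)
    {x : ℝ → Fin n → Fin N → ℝ} {xs : Fin n → Fin N → ℝ} {q : ℕ}
    (hx : ∀ (s : Fin n) i, s.val < q → Tendsto (fun t => x t s i) atTop (𝓝 (xs s i)))
    (i : Fin N) : Tendsto (fun t => S.gainProd (x t) q i) atTop (𝓝 (S.gainProd xs q i)) := by
  refine tendsto_finsetProd _ fun r hr => ?_
  have hr' : r.val < q := by simpa using hr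
  refine ((hS.smooth_Θ r i).continuous.tendsto _).comp ?_
  exact tendsto_pi_nhds.2 fun p => tendsto_pi_nhds.2 fun i =>
    hx ⟨p.val, by omega⟩ i (by simp; omega)

section Trajectories

variable {N m l n : ℕ} [NeZero n] {S : StrictFeedback N n} {g : SharedGame N m l}
  {k₁ : ℝ} {k : Fin N → Fin n → ℝ} {x z : ℝ → Fin n → Fin N → ℝ} {u : ℝ → Fin N → ℝ}
  {lam : ℝ → Fin m → ℝ} {mu : ℝ → Fin l → ℝ}
  {ys : Fin N → ℝ} {lams : Fin m → ℝ} {mus : Fin l → ℝ} {c : ℝ}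

namespace IsTrajectory

lemma isCoordChange (h : IsTrajectory S g k₁ k x u z lam mu) :
    IsCoordChange S g k₁ k x u z lam mu :=
  ⟨h.diff_lead, h.diff_gain, h.diff_inner, h.coord_zero, h.coord, h.control⟩

lemma coordRel (h : IsTrajectory S g k₁ k x u z lam mu) :
    CoordRel S g k₁ k (fun _ : Unit => x) (fun _ => z) (fun _ => lam) (fun _ => mu) :=
  fun _ t ht => ⟨h.coord_zero t ht, h.coord t ht⟩

/-- In the new coordinates, trajectories solve the transformed system. -/
theorem isTransformedSolution (hS : S.Regular) (h : IsTrajectory S g k₁ k x u z lam mu) :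
    IsTransformedSolution g k₁ k z lam mu where
  z_ac := h.z_ac
  dual := h.dual
  z_ode := by
    have hz : ∀ᵐ t ∂(volume.restrict (Set.Ioi (0 : ℝ))), ∀ ℓ i,
        DifferentiableAt ℝ (fun s => z s ℓ i) t :=
      ae_all_iff.2 fun ℓ => ae_all_iff.2 fun i => (h.z_ac ℓ i).ae_differentiableAt
    filter_upwards [hz, h.plant, ae_restrict_mem measurableSet_Ioi] with t hzt hxt (ht : 0 < t) ℓ i
    have hdef := h.isCoordChange.defect hS ht.le
      (dx := fun ℓ i => S.rhs (x t) (u t) ℓ i) (dz := fun ℓ i => deriv (fun s => z s ℓ i) t)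
      (fun ℓ i => (hxt ℓ i).hasDerivWithinAt) (fun ℓ i => (hzt ℓ i).hasDerivAt.hasDerivWithinAt)
    have key : ∀ P : ℕ, ∀ ℓ : Fin n, ℓ.val = P → deriv (fun s => z s ℓ i) t =
        transformedRhs g k₁ k (z t) (lam t) (mu t) ℓ i := by
      intro P
      induction P using Nat.strong_induction_on with
      | _ P ih =>
        intro ℓ hℓ
        have h1 := hdef ℓ i
        rw [Finset.sum_eq_zero (fun p hp => by
          have hp' : 1 ≤ p.val ∧ p.val < ℓ.val := by simpa using hp
          rw [ih p.val (by omega) p rfl, sub_self, mul_zero])] at h1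
        simpa [sub_eq_zero] using h1
    rw [← key ℓ.val ℓ rfl]
    exact (hzt ℓ i).hasDerivAt

/-- The plant equations make the states continuously differentiable from the right. -/
lemma cont_x (hS : S.Regular) (h : IsTrajectory S g k₁ k x u z lam mu) (a : ℕ) (q : Fin n)
    (hq : a + q.val + 1 ≤ n) (i : Fin N) :
    (RegClass.contClass Unit).Tower a (fun _ t => x t q i) := by
  induction a generalizing q i with
  | zero => exact fun _ => (h.x_ac q i).continuousOn
  | succ a ih =>
    have hq1 : q.val + 1 < n := by omega
    have hrhs : (RegClass.contClass Unit).Tower a (fun _ t => S.Γ q i (firstBlocks (x t) q) +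
        S.Θ q i (firstBlocks (x t) q) * x t ⟨q.val + 1, hq1⟩ i) := by
      refine RegClass.Tower.add ?_ (RegClass.Tower.mul ?_ (ih ⟨q.val + 1, hq1⟩ (by simp; omega) i))
      · exact tower_firstBlocks (x := fun _ => x) q (fun s i hs => ih s (by omega) i)
          ((hS.smooth_Γ q i).of_le (by exact_mod_cast (by omega)))
      · exact tower_firstBlocks (x := fun _ => x) q (fun s i hs => ih s (by omega) i)
          ((hS.smooth_Θ q i).of_le (by exact_mod_cast (by omega)))
    have hd : ∀ t, 0 ≤ t → HasDerivWithinAt (fun s => x s q i) (S.Γ q i (firstBlocks (x t) q) +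
        S.Θ q i (firstBlocks (x t) q) * x t ⟨q.val + 1, hq1⟩ i) (Set.Ici t) t := fun t ht => by
      refine (h.x_ac q i).hasDerivWithinAt_of_continuousOn (r := fun t =>
        S.Γ q i (firstBlocks (x t) q) + S.Θ q i (firstBlocks (x t) q) * x t ⟨q.val + 1, hq1⟩ i)
        ?_ (hrhs.P ()) ht
      filter_upwards [h.plant] with s hs
      have := hs q i
      rwa [StrictFeedback.rhs, dif_pos hq1] at this
    exact RegClass.Tower.of_deriv (fun _ => ⟨(h.x_ac q i).continuousOn,
      fun t ht => (hd t ht).differentiableWithinAt⟩) hrhs fun _ t ht => (hd t ht).rightDeriv_eq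

lemma cont_drive (hS : S.Regular) (hg : g.Regular n) (h : IsTrajectory S g k₁ k x u z lam mu)
    (j : Fin l) : (RegClass.contClass Unit).Tower (n - 1) (fun _ t => k₁ * g.G j (z t 0)) := by
  have hn := NeZero.pos n
  have h1 : (RegClass.contClass Unit).Tower (n - 1) (fun _ t => k₁ * g.G j (x t 0)) := by
    refine RegClass.Tower.const_mul _ (RegClass.Tower.comp (c := fun i _ t => x t 0 i)
      (φ := g.G j) ?_ fun i => h.cont_x hS (n - 1) 0 (by simp; omega) i)
    exact (hg.smooth_G j).of_le (by exact_mod_cast (by omega))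
  refine h1.congr fun _ t ht => ?_
  show k₁ * g.G j (x t 0) = k₁ * g.G j (z t 0)
  rw [h.coord_zero t ht]

lemma towerData_settle (hS : S.Regular) (hg : g.Regular n) (hk0 : 0 ≤ k₁) (hc : 0 < c)
    (hys : ys ∈ g.feasible) (hD : Dissipative g k₁ k c ys lams mus)
    (h : IsTrajectory S g k₁ k x u z lam mu) :
    TowerData g k₁ k (RegClass.settleClass Unit) (n - 1) n (fun _ => z) (fun _ => lam)
      (fun _ => mu) := by
  have hn := NeZero.pos n
  have hz := h.isTransformedSolution hS
  obtain ⟨B, hB⟩ := hz.exists_bound hc.le hD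
  have hy := hz.tendsto_y hg hc hD
  have hzQ : ∀ ℓ i, (RegClass.settleClass Unit).Q (fun _ t => z t ℓ i) := fun ℓ i _ => by
    refine ⟨RegClass.EvBdd.of_tendsto (hz.tendsto_z hg hc hD ℓ i),
      fun t ht => (hz.hasDeriv_z hg ht ℓ i).differentiableWithinAt, ?_⟩
    refine (hz.tendsto_transformedRhs hg hc hD ℓ i).congr' ?_
    filter_upwards [eventually_ge_atTop 0] with t ht
    exact (hz.hasDeriv_z hg ht ℓ i).rightDeriv_eq.symm
  have hmu : ∀ j, RegClass.EvBdd (fun t => mu t j) := fun j => ⟨B, by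
    filter_upwards [eventually_ge_atTop 0] with t ht
    exact (norm_le_pi_norm (mu t) j).trans ((norm_snd_le (lam t, mu t)).trans
      ((norm_snd_le (z t, lam t, mu t)).trans (hB t ht)))⟩
  have hlam : ∀ j, RegClass.EvBdd (fun t => lam t j) := fun j => ⟨B, by
    filter_upwards [eventually_ge_atTop 0] with t ht
    exact (norm_le_pi_norm (lam t) j).trans ((norm_fst_le (lam t, mu t)).trans
      ((norm_snd_le (z t, lam t, mu t)).trans (hB t ht)))⟩
  refine ⟨by omega, by omega, by omega, fun _ t ht ℓ i => (hz.hasDeriv_z hg ht ℓ i).rightDeriv_eq,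
    fun _ t ht j => (hz.hasDeriv_lam hg ht j).rightDeriv_eq, fun p i _ => hzQ p i,
    fun p i _ => RegClass.P_of_Q _ (hzQ p i), fun j _ => ⟨hlam j,
      fun t ht => (hz.hasDeriv_lam hg ht j).differentiableWithinAt, ?_⟩, fun j _ => hmu j,
    fun a j ha hT => ?_⟩
  · have h1 : Tendsto (fun t => k₁ * g.H j (z t 0)) atTop (𝓝 (k₁ * g.H j ys)) :=
      (((hg.contDiff_H (r := 0) j).continuous.tendsto ys).comp hy).const_mul k₁
    rw [hys.1 j, mul_zero] at h1
    refine h1.congr' ?_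
    filter_upwards [eventually_ge_atTop 0] with t ht
    exact (hz.hasDeriv_lam hg ht j).rightDeriv_eq.symm
  · have href := hz.isReflected hg j
    have hde : ∀ t, 0 ≤ t → rightDeriv (fun s => mu s j) t =
        projRate (mu t j) (k₁ * g.G j (z t 0)) := fun t ht => (href.hasDeriv ht).rightDeriv_eq
    have hv : Tendsto (fun t => k₁ * g.G j (z t 0)) atTop (𝓝 (k₁ * g.G j ys)) :=
      (((hg.continuous_G j).tendsto ys).comp hy).const_mul k₁
    refine RegClass.Tower.of_deriv (fun _ => ⟨hmu j, href.rdiff, ?_⟩)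
      (href.settle_rate (by omega) (h.cont_drive hS hg j) hT) fun _ t ht => hde t ht
    refine (href.tendsto_rate_zero (mul_nonpos_of_nonneg_of_nonpos hk0 (hys.2 j)) hv).congr' ?_
    filter_upwards [eventually_ge_atTop 0] with t ht using (hde t ht).symm

lemma tendsto_bracket (hS : S.Regular) (hg : g.Regular n) (hk0 : 0 < k₁) (hc : 0 < c)
    (hys : ys ∈ g.feasible) (hD : Dissipative g k₁ k c ys lams mus)
    (h : IsTrajectory S g k₁ k x u z lam mu) {xs : Fin n → Fin N → ℝ} (ℓ : Fin n)
    (hx : ∀ (s : Fin n) i, s.val ≤ ℓ.val → Tendsto (fun t => x t s i) atTop (𝓝 (xs s i)))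
    (i : Fin N) :
    Tendsto (bracket S g k₁ k x z lam mu (ℓ.val + 1) i) atTop
      (𝓝 (S.gainProd xs ℓ.val i * S.Γ ℓ i (firstBlocks xs ℓ))) := by
  have hz := h.isTransformedSolution hS
  have hT := h.towerData_settle hS hg hk0.le hc hys hD
  have hΓ : Tendsto (fun t => S.Γ ℓ i (firstBlocks (x t) ℓ)) atTop
      (𝓝 (S.Γ ℓ i (firstBlocks xs ℓ))) :=
    ((hS.smooth_Γ ℓ i).continuous.tendsto _).comp (tendsto_pi_nhds.2 fun p =>
      tendsto_pi_nhds.2 fun i => hx ⟨p.val, by omega⟩ i (by simp; omega))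
  have htx : ∀ (s : Fin n) i, (RegClass.settleClass Unit).Tower (n - s.val)
      (fun _ t => x t s i) := fun s i => hT.tower_x hS hg h.coordRel s i (by omega)
  rcases Nat.eq_zero_or_pos ℓ.val with h0 | hpos
  · have hℓ : ℓ = 0 := Fin.ext (by simpa using h0)
    subst hℓ
    have h1 : Tendsto (leadTerm S g k₁ x lam mu i) atTop
        (𝓝 (k₁ * 0 + S.Γ 0 i (firstBlocks xs 0))) := by
      refine Tendsto.add (((hz.tendsto_gradL hg hc hk0.ne' hD i).const_mul k₁).congr' ?_) hΓ
      filter_upwards [eventually_ge_atTop 0] with t ht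
      rw [h.coord_zero t ht]
    have h2 : bracket S g k₁ k x z lam mu ((0 : Fin n).val + 1) i =
        leadTerm S g k₁ x lam mu i := by
      funext t
      exact bracket_one i t
    rw [h2]
    simpa [StrictFeedback.gainProd_zero] using h1
  · have hgain : Tendsto (rightDeriv (fun s => S.gainProd (x s) ℓ.val i)) atTop (𝓝 0) :=
      (tower_gainProd (R := RegClass.settleClass Unit) (x := fun _ => x) hS (a := 1)
        (q := ℓ.val) (fun r hr => by omega) (fun s i hs => (htx s i).mono (by omega)) i).1.tendsto_iterate
        (b := 1) le_rfl le_rfl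
    have hinner : Tendsto (innerTerm S x ℓ i) atTop
        (𝓝 (xs ℓ i * 0 + S.gainProd xs ℓ.val i * S.Γ ℓ i (firstBlocks xs ℓ))) :=
      ((hx ℓ i le_rfl).mul hgain).add
        ((StrictFeedback.tendsto_gainProd hS (fun s i hs => hx s i hs.le) i).mul hΓ)
    have hsum1 : Tendsto (fun t => ∑ p : Fin n with 1 ≤ p.val ∧ p.val < ℓ.val + 1,
        (-1) ^ (ℓ.val + 1 - p.val + 1) * symProd (k i) (ℓ.val + 1 - p.val) p.val * z t p i) atTop
        (𝓝 (∑ p : Fin n with 1 ≤ p.val ∧ p.val < ℓ.val + 1, 0)) := by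
      refine tendsto_finsetSum _ fun p hp => ?_
      have hp' : 1 ≤ p.val ∧ p.val < ℓ.val + 1 := by simpa using hp
      have hp0 : p ≠ 0 := by rintro rfl; simp at hp'
      have := (hz.tendsto_z hg hc hD p i).const_mul
        ((-1) ^ (ℓ.val + 1 - p.val + 1) * symProd (k i) (ℓ.val + 1 - p.val) p.val)
      simpa [zeq, hp0] using this
    have hlead : Tendsto (rightDeriv^[ℓ.val + 1 - 1] (leadTerm S g k₁ x lam mu i)) atTop (𝓝 0) :=
      (hT.tower_lead hS hg h.coordRel i).tendsto_iterate (by omega) (by omega)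
    have hsum2 : Tendsto (fun t => ∑ q : Fin n with 1 ≤ q.val ∧ q.val < ℓ.val + 1,
        rightDeriv^[ℓ.val + 1 - 1 - q.val] (innerTerm S x q i) t) atTop
        (𝓝 (∑ q : Fin n with 1 ≤ q.val ∧ q.val < ℓ.val + 1,
          if q = ℓ then S.gainProd xs ℓ.val i * S.Γ ℓ i (firstBlocks xs ℓ) else 0)) := by
      refine tendsto_finsetSum _ fun q hq => ?_
      have hq' : 1 ≤ q.val ∧ q.val < ℓ.val + 1 := by simpa using hq
      by_cases hqℓ : q = ℓ
      · subst hqℓ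
        simpa using hinner
      · have hne : q.val ≠ ℓ.val := fun e => hqℓ (Fin.ext e)
        rw [if_neg hqℓ]
        exact (hT.tower_inner hS (q := q) (by omega) (fun s i _ => htx s i) i).tendsto_iterate
          (by omega) (by omega)
    have hmem : ℓ ∈ Finset.univ.filter (fun q : Fin n => 1 ≤ q.val ∧ q.val < ℓ.val + 1) := by
      simp; omega
    rw [Finset.sum_ite_eq' , if_pos hmem] at hsum2
    have h1 := (hsum1.add hlead).add hsum2
    rw [Finset.sum_const_zero, zero_add, zero_add] at h1
    exact h1

lemma tendsto_next (hS : S.Regular) (hg : g.Regular n) (hk0 : 0 < k₁) (hc : 0 < c)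
    (hys : ys ∈ g.feasible) (hD : Dissipative g k₁ k c ys lams mus)
    (h : IsTrajectory S g k₁ k x u z lam mu) {xs : Fin n → Fin N → ℝ} {us : Fin N → ℝ}
    (hss : S.IsSteadyState xs us) (ℓ : Fin n)
    (hx : ∀ (s : Fin n) i, s.val ≤ ℓ.val → Tendsto (fun t => x t s i) atTop (𝓝 (xs s i)))
    (i : Fin N) :
    Tendsto (fun t => if hn : ℓ.val + 1 < n then x t ⟨ℓ.val + 1, hn⟩ i else u t i) atTop
      (𝓝 (if hn : ℓ.val + 1 < n then xs ⟨ℓ.val + 1, hn⟩ i else us i)) := by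
  have hz := h.isTransformedSolution hS
  have hznext : Tendsto (fun t => if hn : ℓ.val + 1 < n then z t ⟨ℓ.val + 1, hn⟩ i else 0) atTop
      (𝓝 0) := by
    split_ifs with hn
    · have hne : (⟨ℓ.val + 1, hn⟩ : Fin n) ≠ 0 := fun e => by
        have := congrArg Fin.val e
        simp at this
      simpa [zeq, hne] using hz.tendsto_z hg hc hD ⟨ℓ.val + 1, hn⟩ i
    · exact tendsto_const_nhds
  have hgain := StrictFeedback.tendsto_gainProd (q := ℓ.val + 1) hS (fun s i hs => hx s i (by omega)) i
  have hne := StrictFeedback.gainProd_ne_zero hS xs (ℓ.val + 1) i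
  have h1 := ((hznext.sub (h.tendsto_bracket hS hg hk0 hc hys hD ℓ hx i)).div hgain hne)
  have hlim : (0 - S.gainProd xs ℓ.val i * S.Γ ℓ i (firstBlocks xs ℓ)) /
      S.gainProd xs (ℓ.val + 1) i =
      if hn : ℓ.val + 1 < n then xs ⟨ℓ.val + 1, hn⟩ i else us i := by
    have h2 := hss ℓ i
    rw [StrictFeedback.rhs] at h2
    have h3 := StrictFeedback.gainProd_ne_zero hS xs ℓ.val i
    have h4 := hS.ne_zero ℓ i (firstBlocks xs ℓ)
    rw [div_eq_iff hne, StrictFeedback.gainProd_succ]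
    linear_combination (-S.gainProd xs ℓ.val i) * h2
  rw [hlim] at h1
  refine h1.congr' ?_
  filter_upwards [eventually_ge_atTop 0] with t ht
  have h3 := StrictFeedback.gainProd_ne_zero hS (x t) (ℓ.val + 1) i
  rw [Pi.div_apply, h.isCoordChange.next hS ht ℓ i, div_eq_iff h3]
  ring

lemma tendsto_x (hS : S.Regular) (hg : g.Regular n) (hk0 : 0 < k₁) (hc : 0 < c)
    (hys : ys ∈ g.feasible) (hD : Dissipative g k₁ k c ys lams mus)
    (h : IsTrajectory S g k₁ k x u z lam mu) {xs : Fin n → Fin N → ℝ} {us : Fin N → ℝ}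
    (hss : S.IsSteadyState xs us) (hxs : xs 0 = ys) (p : Fin n) (i : Fin N) :
    Tendsto (fun t => x t p i) atTop (𝓝 (xs p i)) := by
  obtain ⟨P, hP⟩ : ∃ P, p.val = P := ⟨_, rfl⟩
  induction P using Nat.strong_induction_on generalizing p i with
  | _ P ih =>
    rcases Nat.eq_zero_or_pos p.val with h0 | hpos
    · have hp0 : p = 0 := Fin.ext (by simpa using h0)
      subst hp0
      have h1 := (h.isTransformedSolution hS).tendsto_z hg hc hD 0 i
      rw [zeq, if_pos rfl, ← hxs] at h1
      refine h1.congr' ?_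
      filter_upwards [eventually_ge_atTop 0] with t ht
      rw [h.coord_zero t ht]
    · have hn : p.val - 1 + 1 < n := by omega
      have h1 := h.tendsto_next hS hg hk0 hc hys hD hss ⟨p.val - 1, by omega⟩
        (fun s i hs => ih s.val (by simp at hs; omega) s i rfl) i
      simp only [hn, dif_pos] at h1
      have hp : (⟨p.val - 1 + 1, hn⟩ : Fin n) = p := Fin.ext (by simp; omega)
      rwa [hp] at h1

/-- Trajectories converge to the steady state. -/
theorem tendsto (hS : S.Regular) (hg : g.Regular n) (hk0 : 0 < k₁) (hc : 0 < c)
    (hys : ys ∈ g.feasible) (hD : Dissipative g k₁ k c ys lams mus)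
    (h : IsTrajectory S g k₁ k x u z lam mu) {xs : Fin n → Fin N → ℝ} {us : Fin N → ℝ}
    (hss : S.IsSteadyState xs us) (hxs : xs 0 = ys) :
    Tendsto x atTop (𝓝 xs) ∧ Tendsto u atTop (𝓝 us) := by
  have hx := h.tendsto_x hS hg hk0 hc hys hD hss hxs
  refine ⟨tendsto_pi_nhds.2 fun p => tendsto_pi_nhds.2 fun i => hx p i,
    tendsto_pi_nhds.2 fun i => ?_⟩
  have hn0 := NeZero.pos n
  have h1 := h.tendsto_next hS hg hk0 hc hys hD hss ⟨n - 1, by omega⟩ (fun s i _ => hx s i) i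
  have hn : ¬ (n - 1 + 1 < n) := by omega
  simpa only [hn, dif_neg, not_false_eq_true] using h1

end IsTrajectory

end Trajectories

/-! ### Inverting the coordinate change -/

section Congruence

variable {N n : ℕ} {S : StrictFeedback N n}

lemma firstBlocks_congr {x x' : Fin n → Fin N → ℝ} {ℓ : Fin n}
    (h : ∀ p : Fin n, p.val ≤ ℓ.val → x p = x' p) : firstBlocks x ℓ = firstBlocks x' ℓ :=
  funext fun p => h ⟨p.val, by omega⟩ (by simp; omega)

lemma StrictFeedback.gainProd_congr {x x' : Fin n → Fin N → ℝ} {q : ℕ}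
    (h : ∀ p : Fin n, p.val < q → x p = x' p) (i : Fin N) :
    S.gainProd x q i = S.gainProd x' q i := by
  refine Finset.prod_congr rfl fun r hr => ?_
  have hr' : r.val < q := by simpa using hr
  rw [firstBlocks_congr fun p hp => h p (by omega)]

end Congruence

section Reconstruction

variable {N m l n : ℕ} [NeZero n] {S : StrictFeedback N n} {g : SharedGame N m l}
  {k₁ : ℝ} {k : Fin N → Fin n → ℝ} {x x' z : ℝ → Fin n → Fin N → ℝ} {u : ℝ → Fin N → ℝ}
  {lam : ℝ → Fin m → ℝ} {mu : ℝ → Fin l → ℝ}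
  {ys : Fin N → ℝ} {lams : Fin m → ℝ} {mus : Fin l → ℝ} {c : ℝ}

lemma bracket_congr {ℓ : ℕ} (hℓ : 1 ≤ ℓ) (h : ∀ t (p : Fin n), p.val < ℓ → x t p = x' t p)
    (i : Fin N) : bracket S g k₁ k x z lam mu ℓ i = bracket S g k₁ k x' z lam mu ℓ i := by
  have hlead : leadTerm S g k₁ x lam mu i = leadTerm S g k₁ x' lam mu i := by
    funext t
    rw [leadTerm, leadTerm, h t 0 (by simp; omega),
      firstBlocks_congr fun p hp => h t p (by simp at hp; simp [hp]; omega)]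
  have hinner : ∀ q : Fin n, q.val < ℓ → innerTerm S x q i = innerTerm S x' q i := by
    intro q hq
    have hg : ∀ t, S.gainProd (x t) q.val i = S.gainProd (x' t) q.val i := fun t =>
      StrictFeedback.gainProd_congr (fun p hp => h t p (by omega)) i
    funext t
    simp only [innerTerm, hg]
    rw [h t q hq, firstBlocks_congr fun p hp => h t p (by omega)]
  funext t
  rw [bracket, bracket, hlead]
  congr 1
  refine Finset.sum_congr rfl fun q hq => ?_
  have hq' : 1 ≤ q.val ∧ q.val < ℓ := by simpa using hq
  rw [hinner q hq'.2]

/-- The plant states recovered from the new coordinates, up to block `j` (excluded). -/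
noncomputable def recoverStage (S : StrictFeedback N n) (g : SharedGame N m l) (k₁ : ℝ)
    (k : Fin N → Fin n → ℝ) (z : ℝ → Fin n → Fin N → ℝ) (lam : ℝ → Fin m → ℝ)
    (mu : ℝ → Fin l → ℝ) : ℕ → ℝ → Fin n → Fin N → ℝ
  | 0 => 0
  | j + 1 => fun t ℓ i =>
    if ℓ.val = j then
      (if j = 0 then z t 0 i else
        (z t ℓ i - bracket S g k₁ k (recoverStage S g k₁ k z lam mu j) z lam mu j i t) /
          S.gainProd (recoverStage S g k₁ k z lam mu j t) j i)
    else recoverStage S g k₁ k z lam mu j t ℓ i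

/-- The plant states recovered from the new coordinates. -/
noncomputable def recover (S : StrictFeedback N n) (g : SharedGame N m l) (k₁ : ℝ)
    (k : Fin N → Fin n → ℝ) (z : ℝ → Fin n → Fin N → ℝ) (lam : ℝ → Fin m → ℝ)
    (mu : ℝ → Fin l → ℝ) : ℝ → Fin n → Fin N → ℝ :=
  recoverStage S g k₁ k z lam mu n

lemma recoverStage_eq {j j' : ℕ} (hj : j ≤ j') (t : ℝ) (p : Fin n) (hp : p.val < j) :
    recoverStage S g k₁ k z lam mu j' t p = recoverStage S g k₁ k z lam mu j t p := by
  induction j', hj using Nat.le_induction with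
  | base => rfl
  | succ j' hj' ih =>
    funext i
    rw [← ih]
    simp only [recoverStage]
    rw [if_neg (by omega)]

lemma recover_zero (t : ℝ) : recover S g k₁ k z lam mu t 0 = z t 0 := by
  rw [recover, recoverStage_eq (j := 1) (NeZero.pos n) t 0 (by simp)]
  funext i
  simp [recoverStage]

lemma recover_pos (hS : S.Regular) (t : ℝ) {ℓ : Fin n} (hℓ : 1 ≤ ℓ.val) (i : Fin N) :
    z t ℓ i = bracket S g k₁ k (recover S g k₁ k z lam mu) z lam mu ℓ.val i t +
      S.gainProd (recover S g k₁ k z lam mu t) ℓ.val i * recover S g k₁ k z lam mu t ℓ i := by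
  have h1 : recover S g k₁ k z lam mu t ℓ = recoverStage S g k₁ k z lam mu (ℓ.val + 1) t ℓ :=
    recoverStage_eq (by omega) t ℓ (by omega)
  have h2 : ∀ t (p : Fin n), p.val < ℓ.val →
      recover S g k₁ k z lam mu t p = recoverStage S g k₁ k z lam mu ℓ.val t p :=
    fun t p hp => recoverStage_eq (by omega) t p hp
  rw [bracket_congr hℓ h2, StrictFeedback.gainProd_congr (h2 t), h1]
  simp only [recoverStage]
  rw [if_pos trivial, if_neg (by omega)]
  have := StrictFeedback.gainProd_ne_zero hS (recoverStage S g k₁ k z lam mu ℓ.val t) ℓ.val i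
  field_simp
  ring

lemma coordRel_recover {Ω : Type} (hS : S.Regular) (z : Ω → ℝ → Fin n → Fin N → ℝ)
    (lam : Ω → ℝ → Fin m → ℝ) (mu : Ω → ℝ → Fin l → ℝ) :
    CoordRel S g k₁ k (fun ω => recover S g k₁ k (z ω) (lam ω) (mu ω)) z lam mu :=
  fun _ t _ => ⟨(recover_zero t).symm, fun _ i hℓ => recover_pos hS t hℓ i⟩

namespace IsTransformedSolution

lemma towerData_ac (hg : g.Regular n) (hln : l = 0 ∨ n ≤ 2)
    (h : IsTransformedSolution g k₁ k z lam mu) :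
    TowerData g k₁ k (RegClass.acClass Unit) (n - 1) n (fun _ => z) (fun _ => lam)
      (fun _ => mu) := by
  have hn := NeZero.pos n
  refine ⟨by omega, by omega, by omega, fun _ t ht ℓ i => (h.hasDeriv_z hg ht ℓ i).rightDeriv_eq,
    fun _ t ht j => (h.hasDeriv_lam hg ht j).rightDeriv_eq,
    fun p i _ _ => ⟨h.z_ac p i, fun t ht => (h.hasDeriv_z hg ht p i).differentiableWithinAt⟩,
    fun _ _ _ => trivial,
    fun j _ => ⟨h.dual.lam_ac j, fun t ht => (h.hasDeriv_lam hg ht j).differentiableWithinAt⟩,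
    fun _ => trivial, fun a j ha _ => ?_⟩
  rcases hln with rfl | hn2
  · exact j.elim0
  · obtain rfl : a = 0 := by omega
    exact ⟨fun _ => ⟨h.dual.mu_ac j, (h.isReflected hg j).rdiff⟩, trivial⟩

/-- Without inequality constraints, or with at most two states per agent, solutions of the
transformed system give trajectories. -/
theorem isTrajectory (hS : S.Regular) (hg : g.Regular n) (hln : l = 0 ∨ n ≤ 2)
    (h : IsTransformedSolution g k₁ k z lam mu) :
    IsTrajectory S g k₁ k (recover S g k₁ k z lam mu)
      (fun t i => -(1 / S.gainProd (recover S g k₁ k z lam mu t) n i) *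
        bracket S g k₁ k (recover S g k₁ k z lam mu) z lam mu n i t) z lam mu := by
  have hn := NeZero.pos n
  have hT := h.towerData_ac hg hln
  set x := recover S g k₁ k z lam mu with hx
  set u : ℝ → Fin N → ℝ := fun t i => -(1 / S.gainProd (x t) n i) *
        bracket S g k₁ k x z lam mu n i t with hu
  have hrel : CoordRel S g k₁ k (fun _ : Unit => x) (fun _ => z) (fun _ => lam) (fun _ => mu) :=
    coordRel_recover hS _ _ _
  have htx : ∀ (s : Fin n) i, (RegClass.acClass Unit).Tower (n - s.val)
      (fun _ t => x t s i) := fun s i => hT.tower_x hS hg hrel s i (by omega)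
  have hac : ∀ (s : Fin n) i, LocallyAC (fun t => x t s i) := fun s i =>
    (((htx s i).mono (show 0 + 1 ≤ n - s.val by omega)).Q ()).1
  have hcc : IsCoordChange S g k₁ k x u z lam mu := by
    refine ⟨fun i => (hT.tower_lead hS hg hrel i).rightDifferentiable (), fun q i => ?_,
      fun q i hq => ?_, fun t _ => (recover_zero t).symm, fun t _ ℓ i hℓ => recover_pos hS t hℓ i,
      fun t _ i => rfl⟩
    · exact (tower_gainProd (R := RegClass.acClass Unit) (x := fun _ => x) hS (a := 1)
        (q := q.val) (fun r hr => by omega)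
        (fun s i hs => (htx s i).mono (by omega)) i).1.rightDifferentiable ()
    · exact (hT.tower_inner hS (q := q) (by omega) (fun s i _ => htx s i) i).rightDifferentiable ()
  refine ⟨hac, h.z_ac, ?_, hcc.diff_lead, hcc.diff_gain, hcc.diff_inner, hcc.coord_zero, hcc.coord,
    hcc.control, h.dual⟩
  have hxd : ∀ᵐ t ∂(volume.restrict (Set.Ioi (0 : ℝ))), ∀ ℓ i,
      DifferentiableAt ℝ (fun s => x s ℓ i) t :=
    ae_all_iff.2 fun ℓ => ae_all_iff.2 fun i => (hac ℓ i).ae_differentiableAt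
  filter_upwards [hxd, ae_restrict_mem measurableSet_Ioi] with t hxt (ht : 0 < t) ℓ i
  have hdef := hcc.defect hS ht.le (dx := fun ℓ i => deriv (fun s => x s ℓ i) t)
    (fun ℓ i => (hxt ℓ i).hasDerivAt.hasDerivWithinAt) (fun ℓ i => h.hasDeriv_z hg ht.le ℓ i) ℓ i
  simp only [sub_self, mul_zero, Finset.sum_const_zero, zero_add] at hdef
  have h1 := (mul_eq_zero.1 hdef.symm).resolve_left
    (StrictFeedback.gainProd_ne_zero hS (x t) ℓ.val i)
  rw [← sub_eq_zero.1 h1]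
  exact (hxt ℓ i).hasDerivAt

end IsTransformedSolution

/-- The initial values of the recovered states below block `ℓ`, and of the bracket of order `ℓ`,
depend only on the initial values of the new coordinates below block `ℓ`. -/
lemma recover_initial_congr (hS : S.Regular) (hg : g.Regular n) (hln : l = 0 ∨ n ≤ 2)
    {z : Bool → ℝ → Fin n → Fin N → ℝ} {lam : Bool → ℝ → Fin m → ℝ} {mu : Bool → ℝ → Fin l → ℝ}
    (h : ∀ ω, IsTransformedSolution g k₁ k (z ω) (lam ω) (mu ω)) {ℓ : ℕ} (hℓ : 1 ≤ ℓ) (hℓn : ℓ < n)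
    (hz : ∀ ω ω' (p : Fin n), p.val < ℓ → z ω 0 p = z ω' 0 p)
    (hlam : ∀ ω ω', lam ω 0 = lam ω' 0) (hmu : ∀ ω ω', mu ω 0 = mu ω' 0) (ω ω' : Bool) :
    (∀ p : Fin n, p.val < ℓ → recover S g k₁ k (z ω) (lam ω) (mu ω) 0 p =
      recover S g k₁ k (z ω') (lam ω') (mu ω') 0 p) ∧
    ∀ i, bracket S g k₁ k (recover S g k₁ k (z ω) (lam ω) (mu ω)) (z ω) (lam ω) (mu ω) ℓ i 0 =
      bracket S g k₁ k (recover S g k₁ k (z ω') (lam ω') (mu ω')) (z ω') (lam ω') (mu ω')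
        ℓ i 0 := by
  have hrel := coordRel_recover (g := g) (k₁ := k₁) (k := k) hS z lam mu
  have hT : TowerData g k₁ k (RegClass.jetClass Bool) (ℓ - 1) (ℓ - 1) z lam mu := by
    refine ⟨by omega, le_rfl, by omega,
      fun ω t ht ℓ i => ((h ω).hasDeriv_z hg ht ℓ i).rightDeriv_eq,
      fun ω t ht j => ((h ω).hasDeriv_lam hg ht j).rightDeriv_eq,
      fun p i hp => ⟨fun ω ω' => congrFun (hz ω ω' p (by omega)) i,
        fun ω t ht => ((h ω).hasDeriv_z hg ht p i).differentiableWithinAt⟩,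
      fun p i hp ω ω' => congrFun (hz ω ω' p (by omega)) i,
      fun j => ⟨fun ω ω' => congrFun (hlam ω ω') j,
        fun ω t ht => ((h ω).hasDeriv_lam hg ht j).differentiableWithinAt⟩,
      fun j ω ω' => congrFun (hmu ω ω') j, fun a j ha _ => ?_⟩
    rcases hln with rfl | hn2
    · exact j.elim0
    · omega
  have hx : ∀ (p : Fin n) i, p.val < ℓ → (RegClass.jetClass Bool).Tower (ℓ - 1 - p.val)
      (fun ω t => recover S g k₁ k (z ω) (lam ω) (mu ω) t p i) := fun p i hp =>
    hT.tower_x hS hg hrel p i (by omega)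
  exact ⟨fun p hp => funext fun i => (hx p i hp).P ω ω',
    fun i => (hT.tower_bracket hS hg hrel hℓ (by omega) hx i).P ω ω'⟩

/-- The initial values of the recovered states can be prescribed. -/
lemma exists_recover_initial (hS : S.Regular) (hg : g.Regular n) (hln : l = 0 ∨ n ≤ 2)
    (hc : 0 ≤ c) (hD : Dissipative g k₁ k c ys lams mus) (x₀ : Fin n → Fin N → ℝ)
    (lam₀ : Fin m → ℝ) {mu₀ : Fin l → ℝ} (hmu₀ : mu₀ ∈ nonnegOrthant l) (ℓ : ℕ) (hℓ : ℓ ≤ n) :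
    ∃ z lam mu, IsTransformedSolution g k₁ k z lam mu ∧ lam 0 = lam₀ ∧ mu 0 = mu₀ ∧
      ∀ p : Fin n, p.val < ℓ → recover S g k₁ k z lam mu 0 p = x₀ p := by
  induction ℓ with
  | zero =>
    obtain ⟨z, lam, mu, h, -, h2, h3⟩ := exists_transformedSolution hg hc hD 0 lam₀ hmu₀
    exact ⟨z, lam, mu, h, h2, h3, fun p hp => absurd hp (by omega)⟩
  | succ ℓ ih =>
    obtain ⟨z, lam, mu, h, hlam, hmu, hx⟩ := ih (by omega)
    rcases Nat.eq_zero_or_pos ℓ with rfl | hpos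
    · obtain ⟨z', lam', mu', h', hz', h2, h3⟩ := exists_transformedSolution hg hc hD x₀ lam₀ hmu₀
      refine ⟨z', lam', mu', h', h2, h3, fun p hp => ?_⟩
      have hp0 : p = 0 := Fin.ext (by simpa using hp)
      rw [hp0, recover_zero, hz']
    · set L : Fin n := ⟨ℓ, by omega⟩ with hL
      obtain ⟨z', lam', mu', h', hz', hlam', hmu'⟩ := exists_transformedSolution hg hc hD
        (Function.update (z 0) L fun i =>
          bracket S g k₁ k (recover S g k₁ k z lam mu) z lam mu ℓ i 0 +
            S.gainProd x₀ ℓ i * x₀ L i) lam₀ hmu₀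
      have hzeq : ∀ p : Fin n, p.val < ℓ → z' 0 p = z 0 p := fun p hp => by
        rw [hz', Function.update_of_ne]
        rintro rfl
        exact lt_irrefl _ hp
      have hcongr := recover_initial_congr (k₁ := k₁) (k := k) hS hg hln
        (z := fun ω => bif ω then z' else z) (lam := fun ω => bif ω then lam' else lam)
        (mu := fun ω => bif ω then mu' else mu) (by rintro (_ | _) <;> assumption) hpos (by omega)
        (by
          rintro (_ | _) (_ | _) p hp
          · rfl
          · exact (hzeq p hp).symm
          · exact hzeq p hp
          · rfl)
        (by rintro (_ | _) (_ | _) <;> simp [hlam, hlam'])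
        (by rintro (_ | _) (_ | _) <;> simp [hmu, hmu']) true false
      have hx' : ∀ p : Fin n, p.val < ℓ → recover S g k₁ k z' lam' mu' 0 p = x₀ p :=
        fun p hp => (hcongr.1 p hp).trans (hx p hp)
      refine ⟨z', lam', mu', h', hlam', hmu', fun p hp => ?_⟩
      rcases Nat.lt_succ_iff_lt_or_eq.1 hp with hlt | heq
      · exact hx' p hlt
      · obtain rfl : p = L := Fin.ext heq
        funext i
        have h1 := recover_pos (g := g) (k₁ := k₁) (k := k) (z := z') (lam := lam') (mu := mu')
          hS 0 (ℓ := L) hpos i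
        have h2 := hcongr.2 i
        simp only [cond_true, cond_false] at h2
        rw [hz', Function.update_self, StrictFeedback.gainProd_congr hx'] at h1
        have hne := StrictFeedback.gainProd_ne_zero hS x₀ ℓ i
        rw [show L.val = ℓ from rfl, h2] at h1
        exact (mul_left_cancel₀ hne (add_left_cancel h1)).symm

/-- Trajectories exist from all initial data. -/
theorem exists_trajectory (hS : S.Regular) (hg : g.Regular n) (hln : l = 0 ∨ n ≤ 2)
    (hc : 0 ≤ c) (hD : Dissipative g k₁ k c ys lams mus) (x₀ : Fin n → Fin N → ℝ)
    (lam₀ : Fin m → ℝ) {mu₀ : Fin l → ℝ} (hmu₀ : mu₀ ∈ nonnegOrthant l) :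
    ∃ x u z lam mu, IsTrajectory S g k₁ k x u z lam mu ∧
      x 0 = x₀ ∧ lam 0 = lam₀ ∧ mu 0 = mu₀ := by
  obtain ⟨z, lam, mu, h, hlam, hmu, hx⟩ :=
    exists_recover_initial hS hg hln hc hD x₀ lam₀ hmu₀ n le_rfl
  exact ⟨_, _, z, lam, mu, h.isTrajectory hS hg hln, funext fun p => hx p p.isLt, hlam, hmu⟩

end Reconstruction

/-! ### Uniqueness of the equilibrium and of the steady state -/

lemma SharedGame.SolvesVI.eq {N m l : ℕ} {g : SharedGame N m l} {M : ℝ} (hM : 0 < M)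
    (hmono : g.StronglyMonotone M) {y y' : Fin N → ℝ} (hy : g.SolvesVI y) (hy' : g.SolvesVI y') :
    y = y' := by
  have h1 := hy.2 y' hy'.1
  have h2 := hy'.2 y hy.1
  have h3 := hmono y y'
  have h4 : ∑ i, (y i - y' i) * (g.pseudoGrad y i - g.pseudoGrad y' i) =
      -(∑ i, (y' i - y i) * g.pseudoGrad y i) - ∑ i, (y i - y' i) * g.pseudoGrad y' i := by
    rw [← Finset.sum_neg_distrib, ← Finset.sum_sub_distrib]
    exact Finset.sum_congr rfl fun i _ => by ring
  have h5 : 0 ≤ ∑ i, (y i - y' i) ^ 2 := Finset.sum_nonneg fun i _ => sq_nonneg _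
  have h6 : ∑ i, (y i - y' i) ^ 2 = 0 := by nlinarith
  funext i
  have h7 := (Finset.sum_eq_zero_iff_of_nonneg fun i _ => sq_nonneg (y i - y' i)).1 h6 i
    (Finset.mem_univ i)
  exact sub_eq_zero.1 (pow_eq_zero_iff two_ne_zero |>.1 h7)

namespace StrictFeedback

variable {N n : ℕ} [NeZero n] {S : StrictFeedback N n}

/-- A steady state is determined by its first block. -/
lemma IsSteadyState.eq (hS : S.Regular) {x x' : Fin n → Fin N → ℝ} {u u' : Fin N → ℝ}
    (h : S.IsSteadyState x u) (h' : S.IsSteadyState x' u') (h0 : x 0 = x' 0) :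
    x = x' ∧ u = u' := by
  have hnext : ∀ ℓ : Fin n, (∀ p : Fin n, p.val ≤ ℓ.val → x p = x' p) → ∀ i,
      (if hn : ℓ.val + 1 < n then x ⟨ℓ.val + 1, hn⟩ i else u i) =
        (if hn : ℓ.val + 1 < n then x' ⟨ℓ.val + 1, hn⟩ i else u' i) := by
    intro ℓ hp i
    have h1 := h ℓ i
    have h2 := h' ℓ i
    rw [rhs] at h1 h2
    rw [firstBlocks_congr hp] at h1
    exact mul_left_cancel₀ (hS.ne_zero ℓ i (firstBlocks x' ℓ)) (by linarith)
  have hx : ∀ P : ℕ, ∀ p : Fin n, p.val = P → x p = x' p := by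
    intro P
    induction P using Nat.strong_induction_on with
    | _ P ih =>
      intro p hp
      rcases Nat.eq_zero_or_pos p.val with hz | hpos
      · have hp0 : p = 0 := Fin.ext (by simpa using hz)
        rw [hp0, h0]
      · have hn : p.val - 1 + 1 < n := by omega
        have hpe : (⟨p.val - 1 + 1, hn⟩ : Fin n) = p := Fin.ext (by simp; omega)
        funext i
        have h1 := hnext ⟨p.val - 1, by omega⟩
          (fun q hq => ih q.val (by simp at hq; omega) q rfl) i
        simpa only [hn, dif_pos, hpe] using h1
  refine ⟨funext fun p => hx _ p rfl, funext fun i => ?_⟩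
  have hn0 := NeZero.pos n
  have hn : ¬ (n - 1 + 1 < n) := by omega
  simpa only [hn, dif_neg, not_false_eq_true] using
    hnext ⟨n - 1, by omega⟩ (fun q _ => hx _ q rfl) i

lemma exists_isSteadyState (hS : S.Regular) (y : Fin N → ℝ) :
    ∃ x u, S.IsSteadyState x u ∧ x 0 = y := by
  have hn0 := NeZero.pos n
  have key : ∀ j ≤ n, ∃ x : Fin n → Fin N → ℝ, x 0 = y ∧ ∀ (ℓ : Fin n) (hn : ℓ.val + 1 < n) i,
      ℓ.val + 1 < j → S.Γ ℓ i (firstBlocks x ℓ) +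
        S.Θ ℓ i (firstBlocks x ℓ) * x ⟨ℓ.val + 1, hn⟩ i = 0 := by
    intro j
    induction j with
    | zero => exact fun _ => ⟨fun _ => y, rfl, fun _ _ _ h => absurd h (by omega)⟩
    | succ j ih =>
      intro hj
      obtain ⟨x, hx0, hx⟩ := ih (by omega)
      rcases Nat.eq_zero_or_pos j with rfl | hpos
      · exact ⟨x, hx0, fun _ _ _ h => absurd h (by omega)⟩
      · set L : Fin n := ⟨j - 1, by omega⟩ with hL
        set J : Fin n := ⟨j, by omega⟩ with hJ
        set x' := Function.update x J fun i =>
          -S.Γ L i (firstBlocks x L) / S.Θ L i (firstBlocks x L) with hx'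
        have hlow : ∀ p : Fin n, p.val < j → x' p = x p := fun p hp => by
          rw [hx', Function.update_of_ne]
          rintro rfl
          exact lt_irrefl _ hp
        refine ⟨x', by rw [hlow 0 (by simpa using hpos), hx0], fun ℓ hn i hℓ => ?_⟩
        rw [firstBlocks_congr (x := x') (x' := x) fun p hp => hlow p (by omega)]
        rcases Nat.lt_succ_iff_lt_or_eq.1 hℓ with hlt | heq
        · rw [hlow _ hlt]
          exact hx ℓ hn i hlt
        · have h1 : ℓ = L := Fin.ext (by simp [hL]; omega)
          have h2 : (⟨ℓ.val + 1, hn⟩ : Fin n) = J := Fin.ext heq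
          rw [h2, hx', Function.update_self, h1]
          have := hS.ne_zero L i (firstBlocks x L)
          field_simp
          ring
  obtain ⟨x, hx0, hx⟩ := key n le_rfl
  set L : Fin n := ⟨n - 1, by omega⟩ with hL
  refine ⟨x, fun i => -S.Γ L i (firstBlocks x L) / S.Θ L i (firstBlocks x L), fun ℓ i => ?_, hx0⟩
  rw [rhs]
  by_cases hn : ℓ.val + 1 < n
  · rw [dif_pos hn]
    exact hx ℓ hn i hn
  · rw [dif_neg hn]
    have h1 : ℓ = L := Fin.ext (by simp [hL]; omega)
    have := hS.ne_zero L i (firstBlocks x L)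
    rw [h1]
    field_simp
    ring

end StrictFeedback

/-- Finitely many strict lower bounds leave a common positive margin. -/
lemma exists_common_margin {ι : Type*} [Finite ι] {a : ι → ℝ} (ha : ∀ i, 1 < a i) :
    ∃ c > 0, ∀ i, 1 + c ≤ a i := by
  cases nonempty_fintype ι
  rcases isEmpty_or_nonempty ι with h | h
  · exact ⟨1, one_pos, fun i => h.elim i⟩
  · obtain ⟨i₀, h0⟩ := Finite.exists_min a
    exact ⟨a i₀ - 1, sub_pos.2 (ha i₀), fun i => by linarith [h0 i]⟩

theorem theorem2 {N m l n : ℕ} [NeZero n]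
    (S : StrictFeedback N n) (g : SharedGame N m l)
    (M k₁ : ℝ) (k : Fin N → Fin n → ℝ)
    (hS : S.Regular) (hg : g.Regular n) (hSlater : g.Slater) (hVE : ∃ y, g.IsVE y)
    (hM : 0 < M) (hmono : g.StronglyMonotone M)
    (hk₁ : 1 < k₁ * M) (hk : ∀ (i : Fin N) (ℓ : Fin n), 1 ≤ ℓ.val → 1 < k i ℓ) :
    ∃ (xs : Fin n → Fin N → ℝ) (us : Fin N → ℝ),
      -- the unique variational equilibrium and the unique steady state above it
      g.IsVE (xs 0) ∧ (∀ y, g.IsVE y → y = xs 0) ∧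
      S.IsSteadyState xs us ∧
      (∀ x' u', S.IsSteadyState x' u' → x' 0 = xs 0 → x' = xs ∧ u' = us) ∧
      -- every trajectory follows the transformed dynamics and converges to the steady state
      (∀ (x : ℝ → Fin n → Fin N → ℝ) (u : ℝ → Fin N → ℝ) (z : ℝ → Fin n → Fin N → ℝ)
          (lam : ℝ → Fin m → ℝ) (mu : ℝ → Fin l → ℝ),
        IsTrajectory S g k₁ k x u z lam mu →
          IsTransformedSolution g k₁ k z lam mu ∧
          Tendsto x atTop (𝓝 xs) ∧ Tendsto u atTop (𝓝 us)) ∧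
      -- trajectories exist from all initial data, unless the control law involves second
      -- derivatives of projected dual variables
      (l = 0 ∨ n ≤ 2 →
        ∀ (x₀ : Fin n → Fin N → ℝ) (lam₀ : Fin m → ℝ), ∀ mu₀ ∈ nonnegOrthant l,
          ∃ x u z lam mu, IsTrajectory S g k₁ k x u z lam mu ∧
            x 0 = x₀ ∧ lam 0 = lam₀ ∧ mu 0 = mu₀) ∧
      -- the transformed dynamics is globally solvable and convergent in all cases
      (∀ (z₀ : Fin n → Fin N → ℝ) (lam₀ : Fin m → ℝ), ∀ mu₀ ∈ nonnegOrthant l,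
        ∃ z lam mu, IsTransformedSolution g k₁ k z lam mu ∧
          z 0 = z₀ ∧ lam 0 = lam₀ ∧ mu 0 = mu₀) ∧
      (∀ (z : ℝ → Fin n → Fin N → ℝ) (lam : ℝ → Fin m → ℝ) (mu : ℝ → Fin l → ℝ),
        IsTransformedSolution g k₁ k z lam mu →
          Tendsto z atTop (𝓝 (fun ℓ => if ℓ = 0 then xs 0 else 0))) := by

  have hk0 : 0 < k₁ := by
    by_contra hneg
    have := mul_nonpos_of_nonpos_of_nonneg (not_lt.1 hneg) hM.le
    linarith
  obtain ⟨ys, hys⟩ := hVE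
  obtain ⟨xs, us, hss, hxs⟩ := StrictFeedback.exists_isSteadyState hS ys
  obtain ⟨lams, mus, hKKT⟩ := hys.2.exists_isKKT hg hSlater
  obtain ⟨c, hc, hmargin⟩ := exists_common_margin
    (a := fun p : Option {q : Fin N × Fin n // 1 ≤ q.2.val} =>
      p.elim (k₁ * M) fun q => k q.1.1 q.1.2)
    (by rintro (_ | q); exacts [hk₁, hk _ _ q.2])
  have hD := hKKT.dissipative hg hmono hk0.le (hmargin none)
    (fun i ℓ hℓ => hmargin (some ⟨(i, ℓ), hℓ⟩))
  subst hxs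
  refine ⟨xs, us, hys, fun y hy => hy.2.eq hM hmono hys.2, hss,
    fun x' u' h' h0 => h'.eq hS hss h0,
    fun x u z lam mu h => ⟨h.isTransformedSolution hS, h.tendsto hS hg hk0 hc hys.2.1 hD hss rfl⟩,
    fun hln x₀ lam₀ mu₀ hmu₀ => exists_trajectory hS hg hln hc.le hD x₀ lam₀ hmu₀,
    fun z₀ lam₀ mu₀ hmu₀ => exists_transformedSolution hg hc.le hD z₀ lam₀ hmu₀,
    fun z lam mu h => ?_⟩
  exact tendsto_pi_nhds.2 fun ℓ => tendsto_pi_nhds.2 fun i => h.tendsto_z hg hc hD ℓ i
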